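/- Let $G$ be an abelian group (written multiplicatively, with identity $e$) and let $\mathcal{B}=\bigoplus_{g\in G}\mathcal{B}_g$ be a finite-dimensional $G$-graded unital Jordan algebra over $\mathbb{R}$ which is graded-simple ($\mathcal{B}^2\neq 0$ and the only graded ideals are $0$ and $\mathcal{B}$) and has degree $2$ over its center $\mathbb{L}$. Here the degree of a finite-dimensional unital Jordan algebra over a field is the degree of its generic minimal polynomial, and the degree over $\mathbb{L}$, which is a direct product of fields, is the maximum of the degrees of the corresponding factors of $\mathcal{B}$. Put $\mathbb{L}_g=\mathbb{L}\cap\mathcal{B}_g$, let $H=\{g\in G: \mathbb{L}_g\ne 0\}$ be the support of $\mathbb{L}$ (a subgroup of $G$), $\overline{G}=G/H$ with identity $\bar e$, $\pi:G\to\overline{G}$ the natural homomorphism, and $\overline{G}_{[2]}=\{q\in\overline{G}: q^2=\bar e\}$. *Notation.* - A function $\kappa:\overline{G}\to\mathbb{Z}_{\ge0}$ is *balanced* if $\kappa(q^{-1})=\kappa(q)$ for all $q$; a *signature function* for $\kappa$ is a function $\sigma:\overline{G}_{[2]}\to\mathbb{Z}$ with $|\sigma(q)|\le\kappa(q)$ and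 $\sigma(q)\equiv\kappa(q)\pmod 2$ for all $q\in\overline{G}_{[2]}$. - For a symmetric bilinear form $b$ on a vector space $V$ over a field $\mathbb{F}$, $\mathcal{J}(V,b)=\mathbb{F}1\oplus V$ is the unital algebra with $uv=b(u,v)1$ for $u,v\in V$. For balanced $\kappa$ with finite support and a signature function $\sigma$, $\mathcal{J}(\kappa,\sigma)$ is the real algebra $\mathcal{J}(V,b)$, where $V=\bigoplus_{q\in\overline{G}}V_q$ with $\dim V_q=\kappa(q)$ and $b$ is a nondegenerate symmetric bilinear form such that $b(V_q,V_r)=0$ whenever $qr\neq\bar e$ and $b|_{V_q}$ has signature $\sigma(q)$ for $q\in\overline{G}_{[2]}$; it is $\overline{G}$-graded with $1$ in degree $\bar e$ and $V_q$ in degree $q$. The $\overline{G}$-graded complex algebra $\mathcal{J}_{\mathbb{C}}(\kappa)$ is defined in the same way over $\mathbb{C}$, without $\sigma$. (These are unique up to graded isomorphism.) - For a $\overline{G}$-graded complex algebra $\mathcal{A}$, $L_\pi(\mathcal{A})=\bigoplus_{g\in G}\mathcal{A}_{\pi(g)}\otimes g\subset\mathcal{A}\otimes_{\mathbb{C}}\mathbb{C}G$.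 For a character $\chi:G\to U$, where $U$ is the unit circle in $\mathbb{C}$, and a $\overline{G}$-graded real algebra $\mathcal{A}$, $L_\pi^\chi(\mathcal{A})=\bigoplus_{g\in G}\mathcal{A}_{\pi(g)}\otimes u_g\subset\mathcal{A}\otimes_{\mathbb{R}}\mathbb{C}G$, where $u_g=z_g g$ and $z_g\in\mathbb{C}^\times$ satisfies $z_g/\overline{z_g}=\chi(g)$. Both are $G$-graded algebras, with the displayed components; $\mathbb{R}$ is regarded as $\overline{G}$-graded with $\mathbb{R}_{\bar e}=\mathbb{R}$. - $\mathcal{B}$ is a *graded-division algebra* if every nonzero homogeneous element $a$ is invertible, i.e. there is $b\in\mathcal{B}$ with $ab=1$ and $a^2b=a$. **Statement.** Either $\mathbb{L}_e=\mathbb{R}1$ or $\mathbb{L}_e\cong\mathbb{C}$ as real algebras. 1. Suppose $\mathbb{L}_e=\mathbb{R}1$. Then there is a character $\chi:G\to U$ such that $\mathbb{L}\cong L_\pi^\chi(\mathbb{R})$ as $G$-graded algebras. For every such $\chi$, there are a balanced function $\kappa:\overline{G}\to\mathbb{Z}_{\ge0}$ with finite support and a signature function $\sigma$ for $\kappa$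 such that $\mathcal{B}\cong L_\pi^\chi(\mathcal{J}(\kappa,\sigma))$ as $G$-graded algebras; and, for every such pair $(\kappa,\sigma)$, $\mathcal{B}$ is a graded-division algebra if and only if the support of $\kappa$ is contained in $\overline{G}_{[2]}$, $|\sigma(q)|=\kappa(q)$ for all $q\in\overline{G}_{[2]}$, and $\sigma(\bar e)=-\kappa(\bar e)$. 2. Suppose $\mathbb{L}_e\cong\mathbb{C}$. Then there is a balanced function $\kappa:\overline{G}\to\mathbb{Z}_{\ge0}$ with finite support such that $\mathcal{B}\cong L_\pi(\mathcal{J}_{\mathbb{C}}(\kappa))$ as $G$-graded real algebras; and, for every such $\kappa$, $\mathcal{B}$ is a graded-division algebra if and only if the support of $\kappa$ is contained in $\overline{G}_{[2]}$, $\kappa(q)\in\{0,1\}$ for all $q\in\overline{G}_{[2]}$, and $\kappa(\bar e)=0$. -/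

import Mathlib

open scoped TensorProduct

noncomputable section

namespace GradedJordan

/-! ## Gradings by an abelian group, on algebras that need not be associative -/

section Gradings

variable {k : Type*} [CommSemiring k] {G : Type*} [CommGroup G]
variable {A : Type*} [NonUnitalNonAssocSemiring A] [Module k A]

/-- `𝓐` is a `G`-grading of the algebra `A`: the subspaces `𝓐 g` form a direct sum decomposition
of `A`, and `𝓐 g * 𝓐 h ⊆ 𝓐 (g * h)`. -/
class IsGrading (𝓐 : G → Submodule k A) : Prop where
  indep : iSupIndep 𝓐
  iSup_eq_top : ⨆ g, 𝓐 g = ⊤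
  mul_mem : ∀ {g h : G} {x y : A}, x ∈ 𝓐 g → y ∈ 𝓐 h → x * y ∈ 𝓐 (g * h)

/-- `A` is graded-simple: `A² ≠ 0`, and the only graded (two-sided) ideals are `0` and `A`. -/
def IsGradedSimple (𝓐 : G → Submodule k A) : Prop :=
  (∃ x y : A, x * y ≠ 0) ∧
    ∀ I : Submodule k A, (∀ x ∈ I, ∀ a : A, a * x ∈ I ∧ x * a ∈ I) →
      I = ⨆ g, I ⊓ 𝓐 g → I = ⊥ ∨ I = ⊤

/-- Isomorphism of `G`-graded algebras. -/
def GradedIsomorphic {A' : Type*} [NonUnitalNonAssocSemiring A'] [Module k A']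
    (𝓐 : G → Submodule k A) (𝓐' : G → Submodule k A') : Prop :=
  ∃ f : A ≃ₗ[k] A', (∀ x y, f (x * y) = f x * f y) ∧ ∀ g x, x ∈ 𝓐 g ↔ f x ∈ 𝓐' g

/-- The grading of the ground ring concentrated in the identity degree. -/
def trivialGrading (k G : Type*) [CommRing k] [CommGroup G] : G → Submodule k k :=
  open Classical in fun g => if g = 1 then ⊤ else ⊥

instance (k G : Type*) [CommRing k] [CommGroup G] : IsGrading (trivialGrading k G) where
  indep := by
    classical
    intro g
    by_cases hg : g = 1
    · have : (⨆ j, ⨆ (_ : j ≠ g), trivialGrading k G j) = ⊥ := by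
        simp only [iSup_eq_bot]
        intro j hj
        simp [trivialGrading, show j ≠ 1 from fun h => hj (h.trans hg.symm)]
      rw [this]; exact disjoint_bot_right
    · simp [trivialGrading, hg]
  iSup_eq_top := by
    classical
    refine eq_top_iff.2 (le_trans ?_ (le_iSup _ (1 : G)))
    simp [trivialGrading]
  mul_mem := by
    classical
    intro g h x y hx hy
    by_cases hg : g = 1 <;> by_cases hh : h = 1 <;> simp_all [trivialGrading]

end Gradings

/-- Invertibility in a unital Jordan algebra. -/
def IsJordanInvertible {B : Type*} [NonAssocRing B] (a : B) : Prop :=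
  ∃ b : B, a * b = 1 ∧ (a * a) * b = a

/-- A graded unital Jordan algebra is a graded-division algebra if every nonzero homogeneous
element is invertible. -/
def IsGradedDivision {k G B : Type*} [CommRing k] [NonAssocRing B] [Module k B]
    (𝓑 : G → Submodule k B) : Prop :=
  ∀ g, ∀ x ∈ 𝓑 g, x ≠ 0 → IsJordanInvertible x

/-! ## The center -/

section Center

variable (k : Type*) [CommRing k] (B : Type*) [NonAssocRing B] [Module k B]
  [SMulCommClass k B B] [IsScalarTower k B B]

/-- The center of `B`: the elements that commute and associate with all elements. -/
abbrev Center : Type _ := ↥(NonUnitalSubalgebra.center k B)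

instance : CommRing (Center k B) :=
  { (inferInstance : NonUnitalNonAssocRing (Center k B)) with
    one := ⟨1, Set.one_mem_center⟩
    one_mul := fun a => Subtype.ext (one_mul (a : B))
    mul_one := fun a => Subtype.ext (mul_one (a : B))
    mul_assoc := fun a b c => Subtype.ext ((a.2.left_assoc (b : B) (c : B)).symm)
    mul_comm := fun a b => Subtype.ext (a.2.comm (b : B)) }

instance : Algebra k (Center k B) :=
  Algebra.ofModule (fun c x y => smul_mul_assoc c x y) (fun c x y => mul_smul_comm c x y)

/-- `B` as an algebra over its center. -/
instance : Module (Center k B) B where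
  smul z x := (z : B) * x
  one_smul x := one_mul x
  mul_smul z w x := (z.2.left_assoc (w : B) x).symm
  smul_zero z := mul_zero (z : B)
  smul_add z x y := mul_add (z : B) x y
  add_smul z w x := add_mul (z : B) (w : B) x
  zero_smul x := zero_mul x

theorem center_smul_def (z : Center k B) (x : B) : z • x = (z : B) * x := rfl

instance : IsScalarTower (Center k B) B B where
  smul_assoc z x y := (z.2.left_assoc x y).symm

instance : SMulCommClass (Center k B) B B where
  smul_comm z x y := (z.2.left_comm x y)

variable {k B} {G : Type*}

/-- The grading of the center of a graded algebra `B`: `𝕃_g = 𝕃 ∩ B_g`. -/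
def centerGrading (𝓑 : G → Submodule k B) (g : G) : Submodule k (Center k B) :=
  (𝓑 g).comap (NonUnitalSubalgebra.center k B).toSubmodule.subtype

/-- The subgroup of `G` generated by the support of the center. (If `B` is graded-simple, the
support of the center is already a subgroup.) -/
def centerSupport [CommGroup G] (𝓑 : G → Submodule k B) : Subgroup G :=
  Subgroup.closure {g | centerGrading 𝓑 g ≠ ⊥}

end Center

/-! ## The degree of a finite-dimensional unital algebra -/

section Degree

/-- Powers of an element in a power-associative unital algebra. -/
def npower {A : Type*} [NonAssocRing A] (x : A) : ℕ → A
  | 0 => 1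
  | n + 1 => x * npower x n

/-- The value of a polynomial at an element of a power-associative unital algebra. -/
def polyEval {F A : Type*} [Field F] [NonAssocRing A] [Module F A] (p : Polynomial F) (x : A) : A :=
  p.sum fun i c => c • npower x i

/-- The generic element `∑ ξᵢ eᵢ` of `A` with respect to the basis `e`, an element of the extension
of `A` to the field of rational functions in the variables `ξᵢ`. -/
def genericElement {F A : Type*} [Field F] [NonAssocRing A] [Module F A] {n : ℕ}
    (e : Module.Basis (Fin n) F A) : FractionRing (MvPolynomial (Fin n) F) ⊗[F] A :=
  ∑ i, algebraMap (MvPolynomial (Fin n) F) (FractionRing (MvPolynomial (Fin n) F))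
    (MvPolynomial.X i) ⊗ₜ[F] e i

/-- The finite-dimensional (strictly power-associative) unital algebra `A` over the field `F` has
degree `d`: the generic minimal polynomial, that is, the minimal polynomial of the generic element
over the field of rational functions, has degree `d`. -/
def HasDegree (F A : Type*) [Field F] [NonAssocRing A] [Module F A]
    [SMulCommClass F A A] [IsScalarTower F A A] (d : ℕ) : Prop :=
  ∃ (n : ℕ) (e : Module.Basis (Fin n) F A),
    IsLeast {m | ∃ p : Polynomial (FractionRing (MvPolynomial (Fin n) F)),
      p.Monic ∧ p.natDegree = m ∧ polyEval p (genericElement e) = 0} d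

/-- The degree of an algebra `B` over `L`, where `L` is a direct product of finitely many fields:
the maximum of the degrees of the factors `(L/𝔪) ⊗ B` of `B`, considered as algebras over the
factors `L/𝔪` of `L`. -/
def HasDegreeOver (L B : Type*) [CommRing L] [NonAssocRing B] [Module L B]
    [SMulCommClass L B B] [IsScalarTower L B B] (d : ℕ) : Prop :=
  let deg (𝔪 : MaximalSpectrum L) (m : ℕ) : Prop :=
    letI : Field (L ⧸ 𝔪.asIdeal) := Ideal.Quotient.field 𝔪.asIdeal
    HasDegree (L ⧸ 𝔪.asIdeal) ((L ⧸ 𝔪.asIdeal) ⊗[L] B) m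
  (∀ 𝔪, ∃ m ≤ d, deg 𝔪 m) ∧ ∃ 𝔪, deg 𝔪 d

end Degree

/-! ## Loop algebras -/

section Loop

variable {k : Type*} [CommRing k] {G G' : Type*} [CommGroup G] [CommGroup G']
variable {A : Type*} [NonUnitalNonAssocRing A] [Module k A] [SMulCommClass k A A]
  [IsScalarTower k A A]
variable {S : Type*} [CommRing S] [Algebra k S]

/-- The subspace `A_{π(g)} ⊗ D_g` of `A ⊗ S`. -/
def loopComponent (π : G →* G') (𝓐 : G' → Submodule k A) (D : G → Submodule k S) (g : G) :
    Submodule k (A ⊗[k] S) :=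
  Submodule.map₂ (TensorProduct.mk k A S) (𝓐 (π g)) (D g)

/-- The subalgebra `⨁_g A_{π(g)} ⊗ D_g` of `A ⊗ S`. -/
def loopSubalgebra (π : G →* G') (𝓐 : G' → Submodule k A) [IsGrading 𝓐] (D : G → Submodule k S)
    (hD : ∀ g h : G, ∀ x ∈ D g, ∀ y ∈ D h, x * y ∈ D (g * h)) :
    NonUnitalSubalgebra k (A ⊗[k] S) :=
  { (⨆ g, loopComponent π 𝓐 D g : Submodule k (A ⊗[k] S)) with
    mul_mem' := by
      intro x y hx hy
      change x ∈ (⨆ g, loopComponent π 𝓐 D g : Submodule k (A ⊗[k] S)) at hx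
      change y ∈ (⨆ g, loopComponent π 𝓐 D g : Submodule k (A ⊗[k] S)) at hy
      change x * y ∈ (⨆ g, loopComponent π 𝓐 D g : Submodule k (A ⊗[k] S))
      have key : ∀ g h : G, ∀ x ∈ loopComponent π 𝓐 D g, ∀ y ∈ loopComponent π 𝓐 D h,
          x * y ∈ loopComponent π 𝓐 D (g * h) := by
        intro g h x hx y hy
        have h1 : loopComponent π 𝓐 D g ≤ (loopComponent π 𝓐 D (g * h)).comap
            ((LinearMap.mul k (A ⊗[k] S)).flip y) := by
          refine Submodule.map₂_le.2 fun a ha s hs => ?_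
          have h2 : loopComponent π 𝓐 D h ≤ (loopComponent π 𝓐 D (g * h)).comap
              (LinearMap.mul k (A ⊗[k] S) (a ⊗ₜ s)) := by
            refine Submodule.map₂_le.2 fun b hb t ht => ?_
            have h3 : (a * b) ⊗ₜ[k] (s * t) ∈ loopComponent π 𝓐 D (g * h) :=
              Submodule.apply_mem_map₂ (TensorProduct.mk k A S)
                (by rw [map_mul]; exact IsGrading.mul_mem ha hb) (hD g h s hs t ht)
            simpa using h3
          exact h2 hy
        exact h1 hx
      refine Submodule.iSup_induction _ (motive := fun x => x * y ∈ _) hx ?_ ?_ ?_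
      · intro g x hx
        refine Submodule.iSup_induction _ (motive := fun y => x * y ∈ _) hy ?_ ?_ ?_
        · intro h y hy
          exact Submodule.mem_iSup_of_mem (g * h) (key g h x hx y hy)
        · rw [mul_zero]; exact Submodule.zero_mem _
        · intro y z hy hz
          rw [mul_add]; exact Submodule.add_mem _ hy hz
      · rw [zero_mul]; exact Submodule.zero_mem _
      · intro x z hx hz
        rw [add_mul]; exact Submodule.add_mem _ hx hz }

/-- The component of degree `g` of the group algebra `kG`. -/
def groupAlgebraComponent (k : Type*) [CommRing k] {G : Type*} [CommGroup G] (g : G) :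
    Submodule k (MonoidAlgebra k G) :=
  LinearMap.range (MonoidAlgebra.lsingle g : k →ₗ[k] MonoidAlgebra k G)

theorem groupAlgebraComponent_mul_mem (g h : G) : ∀ x ∈ groupAlgebraComponent k g,
    ∀ y ∈ groupAlgebraComponent k h, x * y ∈ groupAlgebraComponent k (g * h) := by
  rintro _ ⟨a, rfl⟩ _ ⟨b, rfl⟩
  exact ⟨a * b, by simp [MonoidAlgebra.single_mul_single]⟩

/-- The loop algebra `L_π(A) = ⨁_g A_{π(g)} ⊗ g ⊆ A ⊗ kG`. -/
def loopAlgebra (π : G →* G') (𝓐 : G' → Submodule k A) [IsGrading 𝓐] :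
    NonUnitalSubalgebra k (A ⊗[k] MonoidAlgebra k G) :=
  loopSubalgebra π 𝓐 (groupAlgebraComponent k) groupAlgebraComponent_mul_mem

/-- The `G`-grading of `L_π(A)`, with components `A_{π(g)} ⊗ g`. -/
def loopGrading (π : G →* G') (𝓐 : G' → Submodule k A) [IsGrading 𝓐] (g : G) :
    Submodule k (loopAlgebra π 𝓐) :=
  (loopComponent π 𝓐 (groupAlgebraComponent k) g).comap (loopAlgebra π 𝓐).toSubmodule.subtype

/-- The real line spanned by `u_g = z_g g` in the complex group algebra `ℂG`, where
`z_g / conj z_g = χ g`. It is the component of degree `g` of the real form of `ℂG` given by the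
antilinear involution `z g ↦ conj z * χ g • g`. -/
def twistedComponent (χ : G →* Circle) (g : G) : Submodule ℝ (MonoidAlgebra ℂ G) where
  carrier := {x | ∃ z : ℂ, z = (starRingEnd ℂ) z * (χ g : ℂ) ∧ x = MonoidAlgebra.single g z}
  zero_mem' := ⟨0, by simp, by simp⟩
  add_mem' := by
    rintro _ _ ⟨z, hz, rfl⟩ ⟨w, hw, rfl⟩
    refine ⟨z + w, ?_, by simp⟩
    rw [map_add, add_mul, ← hz, ← hw]
  smul_mem' := by
    rintro c _ ⟨z, hz, rfl⟩
    refine ⟨c • z, ?_, by simp⟩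
    rw [Complex.real_smul, map_mul, Complex.conj_ofReal, mul_assoc, ← hz]

theorem twistedComponent_mul_mem (χ : G →* Circle) (g h : G) : ∀ x ∈ twistedComponent χ g,
    ∀ y ∈ twistedComponent χ h, x * y ∈ twistedComponent χ (g * h) := by
  rintro _ ⟨z, hz, rfl⟩ _ ⟨w, hw, rfl⟩
  refine ⟨z * w, ?_, by simp [MonoidAlgebra.single_mul_single]⟩
  rw [map_mul, map_mul, Circle.coe_mul, mul_mul_mul_comm, ← hz, ← hw]

variable {A : Type*} [NonUnitalNonAssocRing A] [Module ℝ A] [SMulCommClass ℝ A A]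
  [IsScalarTower ℝ A A]

/-- The twisted loop algebra `L_π^χ(A) = ⨁_g A_{π(g)} ⊗ u_g ⊆ A ⊗ ℂG` of a real algebra `A`. -/
def twistedLoopAlgebra (π : G →* G') (χ : G →* Circle) (𝓐 : G' → Submodule ℝ A) [IsGrading 𝓐] :
    NonUnitalSubalgebra ℝ (A ⊗[ℝ] MonoidAlgebra ℂ G) :=
  loopSubalgebra π 𝓐 (twistedComponent χ) (twistedComponent_mul_mem χ)

/-- The `G`-grading of `L_π^χ(A)`, with components `A_{π(g)} ⊗ u_g`. -/
def twistedLoopGrading (π : G →* G') (χ : G →* Circle) (𝓐 : G' → Submodule ℝ A) [IsGrading 𝓐]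
    (g : G) : Submodule ℝ (twistedLoopAlgebra π χ 𝓐) :=
  (loopComponent π 𝓐 (twistedComponent χ) g).comap (twistedLoopAlgebra π χ 𝓐).toSubmodule.subtype

end Loop

/-! ## Jordan algebras of symmetric bilinear forms -/

section BilinForm

variable {k V : Type*} [CommRing k] [AddCommGroup V] [Module k V]

/-- The algebra `𝒥(V, b) = k 1 ⊕ V`, with `u * v = b(u, v) 1` for `u, v ∈ V`. The element
`c 1 + v` is `⟨c, v⟩`. -/
@[ext]
structure BilinJordan (b : LinearMap.BilinForm k V) where
  fst : k
  snd : V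

namespace BilinJordan

variable (b : LinearMap.BilinForm k V)

/-- The underlying pair. -/
def toPair : BilinJordan b ≃ k × V where
  toFun x := (x.fst, x.snd)
  invFun p := ⟨p.1, p.2⟩

instance : AddCommGroup (BilinJordan b) := (toPair b).addCommGroup

instance : Module k (BilinJordan b) := (toPair b).module k

instance : Mul (BilinJordan b) :=
  ⟨fun x y => ⟨x.fst * y.fst + b x.snd y.snd, x.fst • y.snd + y.fst • x.snd⟩⟩

instance : One (BilinJordan b) := ⟨⟨1, 0⟩⟩

variable {b}

theorem fst_mul (x y : BilinJordan b) : (x * y).fst = x.fst * y.fst + b x.snd y.snd := rfl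

theorem snd_mul (x y : BilinJordan b) : (x * y).snd = x.fst • y.snd + y.fst • x.snd := rfl

theorem fst_one : (1 : BilinJordan b).fst = 1 := rfl

theorem snd_one : (1 : BilinJordan b).snd = 0 := rfl

theorem fst_add (x y : BilinJordan b) : (x + y).fst = x.fst + y.fst := rfl

theorem snd_add (x y : BilinJordan b) : (x + y).snd = x.snd + y.snd := rfl

theorem fst_smul (c : k) (x : BilinJordan b) : (c • x).fst = c * x.fst := rfl

theorem snd_smul (c : k) (x : BilinJordan b) : (c • x).snd = c • x.snd := rfl

theorem fst_zero : (0 : BilinJordan b).fst = 0 := rfl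

theorem snd_zero : (0 : BilinJordan b).snd = 0 := rfl

variable (b)

instance : NonAssocRing (BilinJordan b) :=
  { (inferInstance : AddCommGroup (BilinJordan b)) with
    left_distrib := fun x y z => by
      refine BilinJordan.ext ?_ ?_
      · simp only [fst_mul, fst_add, snd_add, map_add]; ring
      · simp only [snd_mul, fst_add, snd_add, smul_add, add_smul]; abel
    right_distrib := fun x y z => by
      refine BilinJordan.ext ?_ ?_
      · simp only [fst_mul, fst_add, snd_add, map_add, LinearMap.add_apply]; ring
      · simp only [snd_mul, fst_add, snd_add, smul_add, add_smul]; abel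
    zero_mul := fun x => by
      refine BilinJordan.ext ?_ ?_ <;> simp [fst_mul, snd_mul, fst_zero, snd_zero]
    mul_zero := fun x => by
      refine BilinJordan.ext ?_ ?_ <;> simp [fst_mul, snd_mul, fst_zero, snd_zero]
    one_mul := fun x => by
      refine BilinJordan.ext ?_ ?_ <;> simp [fst_mul, snd_mul, fst_one, snd_one]
    mul_one := fun x => by
      refine BilinJordan.ext ?_ ?_ <;> simp [fst_mul, snd_mul, fst_one, snd_one] }

instance : IsScalarTower k (BilinJordan b) (BilinJordan b) where
  smul_assoc c x y := by
    refine BilinJordan.ext ?_ ?_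
    · simp only [smul_eq_mul, fst_mul, fst_smul, snd_smul, map_smul, LinearMap.smul_apply]; ring
    · simp only [smul_eq_mul, snd_mul, fst_smul, snd_smul, smul_add, mul_smul]
      rw [smul_comm c y.fst]

instance : SMulCommClass k (BilinJordan b) (BilinJordan b) where
  smul_comm c x y := by
    refine BilinJordan.ext ?_ ?_
    · simp only [smul_eq_mul, fst_mul, fst_smul, snd_smul, map_smul]; ring
    · simp only [smul_eq_mul, snd_mul, fst_smul, snd_smul, smul_add, mul_smul]
      rw [smul_comm c x.fst]

variable {Q : Type*} [CommGroup Q]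

/-- The grading `𝒥(V, b)_e = k 1 ⊕ V_e` and `𝒥(V, b)_q = V_q` for `q ≠ e`, given a grading of `V`. -/
def grading (𝓥 : Q → Submodule k V) (q : Q) : Submodule k (BilinJordan b) where
  carrier := {x | x.fst ∈ trivialGrading k Q q ∧ x.snd ∈ 𝓥 q}
  zero_mem' := ⟨Submodule.zero_mem _, Submodule.zero_mem _⟩
  add_mem' hx hy := ⟨Submodule.add_mem _ hx.1 hy.1, Submodule.add_mem _ hx.2 hy.2⟩
  smul_mem' c _ hx := ⟨Submodule.smul_mem _ c hx.1, Submodule.smul_mem _ c hx.2⟩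

variable {b}

theorem isGrading_grading {𝓥 : Q → Submodule k V} (h1 : iSupIndep 𝓥) (h2 : ⨆ q, 𝓥 q = ⊤)
    (h3 : ∀ q r : Q, q * r ≠ 1 → ∀ u ∈ 𝓥 q, ∀ v ∈ 𝓥 r, b u v = 0) :
    IsGrading (grading b 𝓥) where
  indep := by
    intro q
    rw [Submodule.disjoint_def]
    intro x hx hy
    let p1 : BilinJordan b →ₗ[k] k :=
      { toFun := fst, map_add' := fst_add, map_smul' := fst_smul }
    let p2 : BilinJordan b →ₗ[k] V :=
      { toFun := snd, map_add' := snd_add, map_smul' := snd_smul }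
    have hy1 : (⨆ j, ⨆ (_ : j ≠ q), grading b 𝓥 j) ≤
        (⨆ j, ⨆ (_ : j ≠ q), trivialGrading k Q j).comap p1 :=
      iSup₂_le fun j hj z hz =>
        le_iSup₂ (f := fun j (_ : j ≠ q) => trivialGrading k Q j) j hj hz.1
    have hy2 : (⨆ j, ⨆ (_ : j ≠ q), grading b 𝓥 j) ≤ (⨆ j, ⨆ (_ : j ≠ q), 𝓥 j).comap p2 :=
      iSup₂_le fun j hj z hz => le_iSup₂ (f := fun j (_ : j ≠ q) => 𝓥 j) j hj hz.2
    refine BilinJordan.ext ?_ ?_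
    · exact Submodule.disjoint_def.1
        (IsGrading.indep (𝓐 := trivialGrading k Q) q) x.fst hx.1 (hy1 hy)
    · exact Submodule.disjoint_def.1 (h1 q) x.snd hx.2 (hy2 hy)
  iSup_eq_top := by
    rw [eq_top_iff]
    rintro ⟨c, v⟩ -
    have hc : (⟨c, 0⟩ : BilinJordan b) ∈ ⨆ q, grading b 𝓥 q := by
      refine Submodule.mem_iSup_of_mem (1 : Q) ?_
      exact ⟨by simp [trivialGrading], Submodule.zero_mem _⟩
    have hv : (⟨0, v⟩ : BilinJordan b) ∈ ⨆ q, grading b 𝓥 q := by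
      let f : V →ₗ[k] BilinJordan b :=
        { toFun := fun v => ⟨0, v⟩
          map_add' := fun u v => BilinJordan.ext (by simp [fst_add]) (by simp [snd_add])
          map_smul' := fun c v => BilinJordan.ext (by simp [fst_smul]) (by simp [snd_smul]) }
      have hle : (⨆ q, 𝓥 q) ≤ (⨆ q, grading b 𝓥 q).comap f :=
        iSup_le fun q u hu => Submodule.mem_iSup_of_mem q ⟨Submodule.zero_mem _, hu⟩
      exact hle (by rw [h2]; trivial)
    have e : (⟨c, 0⟩ : BilinJordan b) + ⟨0, v⟩ = ⟨c, v⟩ :=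
      BilinJordan.ext (by simp [fst_add]) (by simp [snd_add])
    exact e ▸ Submodule.add_mem _ hc hv
  mul_mem := by
    classical
    rintro q r ⟨c, u⟩ ⟨d, v⟩ ⟨hc, hu⟩ ⟨hd, hv⟩
    change c ∈ _ at hc
    change d ∈ _ at hd
    change u ∈ _ at hu
    change v ∈ _ at hv
    refine ⟨Submodule.add_mem _ (IsGrading.mul_mem hc hd) ?_, Submodule.add_mem _ ?_ ?_⟩
    · by_cases hqr : q * r = 1
      · simp [trivialGrading, hqr]
      · change b u v ∈ _
        rw [h3 q r hqr u hu v hv]; exact Submodule.zero_mem _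
    · change c • v ∈ _
      by_cases hq : q = 1
      · subst hq; rw [one_mul]; exact Submodule.smul_mem _ _ hv
      · have : c = 0 := by simpa [trivialGrading, hq] using hc
        rw [this, zero_smul]; exact Submodule.zero_mem _
    · change d • u ∈ _
      by_cases hr : r = 1
      · subst hr; rw [mul_one]; exact Submodule.smul_mem _ _ hu
      · have : d = 0 := by simpa [trivialGrading, hr] using hd
        rw [this, zero_smul]; exact Submodule.zero_mem _

end BilinJordan

/-! ### The standard forms -/

variable {Q : Type*} [CommGroup Q]

/-- The graded space with `κ q` basis vectors in degree `q`, for each `q`. -/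
abbrev StdSpace (k : Type*) [CommRing k] (κ : Q → ℕ) : Type _ := (Σ q, Fin (κ q)) →₀ k

/-- The component of degree `q` of the graded space `StdSpace k κ`: the span of the basis vectors
of degree `q`. -/
def stdGrading (k : Type*) [CommRing k] (κ : Q → ℕ) (q : Q) : Submodule k (StdSpace k κ) :=
  Finsupp.supported k k {a | a.1 = q}

/-- The bilinear form that pairs the `i`th basis vector of degree `q` with the `i`th basis vector of
degree `q⁻¹`, with value `ε q i`; all other pairs of basis vectors are orthogonal. -/
def stdForm (κ : Q → ℕ) (ε : Q → ℕ → k) : LinearMap.BilinForm k (StdSpace k κ) :=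
  open Classical in
  Finsupp.lsum k fun a => LinearMap.toSpanSingleton k (StdSpace k κ →ₗ[k] k) <|
    Finsupp.lsum k fun c => LinearMap.toSpanSingleton k k <|
      if c.1 = a.1⁻¹ ∧ (c.2 : ℕ) = a.2 then ε a.1 a.2 else 0

theorem stdForm_single (κ : Q → ℕ) (ε : Q → ℕ → k) (a c : Σ q, Fin (κ q)) (s t : k) :
    stdForm κ ε (Finsupp.single a s) (Finsupp.single c t) =
      open Classical in
      s * t * (if c.1 = a.1⁻¹ ∧ (c.2 : ℕ) = a.2 then ε a.1 a.2 else 0) := by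
  simp [stdForm, mul_assoc]

instance stdJordan_isGrading (κ : Q → ℕ) (ε : Q → ℕ → k) :
    IsGrading (BilinJordan.grading (stdForm κ ε) (stdGrading k κ)) := by
  classical
  refine BilinJordan.isGrading_grading ?_ ?_ ?_
  · intro q
    have h : (⨆ j, ⨆ (_ : j ≠ q), stdGrading k κ j) ≤
        Finsupp.supported k k {a : Σ q, Fin (κ q) | a.1 ≠ q} :=
      iSup₂_le fun j hj => Finsupp.supported_mono fun a (ha : a.1 = j) =>
        show a.1 ≠ q from ha ▸ hj
    refine Disjoint.mono_right h ?_
    refine Finsupp.disjoint_supported_supported (Set.disjoint_left.2 fun a ha hb => hb ha)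
  · change (⨆ q, Finsupp.supported k k {a : Σ q, Fin (κ q) | a.1 = q}) = ⊤
    rw [← Finsupp.supported_iUnion, eq_top_iff, ← Finsupp.supported_univ]
    exact Finsupp.supported_mono fun a _ => Set.mem_iUnion.2 ⟨a.1, rfl⟩
  · intro q r hqr u hu v hv
    rw [stdGrading, Finsupp.supported_eq_span_single] at hu hv
    refine Submodule.span_induction (p := fun u _ => stdForm κ ε u v = 0) ?_ (by simp) ?_ ?_ hu
    · rintro _ ⟨a, ha, rfl⟩
      refine Submodule.span_induction (p := fun v _ => stdForm κ ε (Finsupp.single a 1) v = 0)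
        ?_ (by simp) ?_ ?_ hv
      · rintro _ ⟨c, hc, rfl⟩
        change a.1 = q at ha
        change c.1 = r at hc
        beta_reduce
        rw [stdForm_single, if_neg, mul_zero]
        rintro ⟨h, -⟩
        rw [ha, hc] at h
        exact hqr (by rw [h, mul_inv_cancel])
      · intro x y _ _ hx hy; rw [map_add, hx, hy, add_zero]
      · intro c x _ hx; rw [map_smul, hx, smul_zero]
    · intro x y _ _ hx hy; rw [map_add, LinearMap.add_apply, hx, hy, add_zero]
    · intro c x _ hx; rw [map_smul, LinearMap.smul_apply, hx, smul_zero]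

end BilinForm

section Parameters

variable {Q : Type*} [CommGroup Q]

/-- The subgroup `Q_[2]` of the elements `q` with `q² = e`. -/
def twoTorsion (Q : Type*) [CommGroup Q] : Subgroup Q := (powMonoidHom 2 : Q →* Q).ker

/-- `κ` is balanced and has finite support. -/
def IsBalanced (κ : Q → ℕ) : Prop :=
  (∀ q, κ q⁻¹ = κ q) ∧ (Function.support κ).Finite

/-- `σ` is a signature function for `κ`. -/
def IsSignature (κ : Q → ℕ) (σ : twoTorsion Q → ℤ) : Prop :=
  ∀ q : twoTorsion Q, |σ q| ≤ κ q ∧ σ q ≡ κ q [ZMOD 2]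

/-- The diagonal entries of the matrices `I_{p,q}` for the elements of `Q_[2]`, where
`p + q = κ` and `p - q = σ`; for the other elements of `Q`, the value is `1`. -/
def stdSign (κ : Q → ℕ) (σ : twoTorsion Q → ℤ) (q : Q) (i : ℕ) : ℝ :=
  open Classical in
  if h : q ∈ twoTorsion Q then (if 2 * (i : ℤ) < κ q + σ ⟨q, h⟩ then 1 else -1) else 1

/-- The grading of the real Jordan algebra `𝒥(κ, σ)`. The bilinear form on `V` has matrix
`I_{p,q}` on each `V_g` with `g² = e`, where `p + q = κ g` and `p - q = σ g`, and the matrix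
`(0 I; I 0)` on each `V_g ⊕ V_{g⁻¹}` with `g² ≠ e`. -/
abbrev realJordanGrading (κ : Q → ℕ) (σ : twoTorsion Q → ℤ) :
    Q → Submodule ℝ (BilinJordan (stdForm κ (stdSign κ σ))) :=
  BilinJordan.grading (stdForm κ (stdSign κ σ)) (stdGrading ℝ κ)

/-- The grading of the complex Jordan algebra `𝒥_ℂ(κ)`. The bilinear form on `V` has matrix
`I` on each `V_g` with `g² = e`, and the matrix `(0 I; I 0)` on each `V_g ⊕ V_{g⁻¹}` with
`g² ≠ e`. -/
abbrev complexJordanGrading (κ : Q → ℕ) :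
    Q → Submodule ℂ (BilinJordan (stdForm κ (fun _ _ => (1 : ℂ)))) :=
  BilinJordan.grading (stdForm κ (fun _ _ => (1 : ℂ))) (stdGrading ℂ κ)

end Parameters

section Main

variable {G B : Type*} [CommGroup G] [NonAssocRing B] [Module ℝ B] [SMulCommClass ℝ B B]
  [IsScalarTower ℝ B B]

/-- `𝕃_e = ℝ`, where `𝕃` is the center. -/
def CenterIdentityReal (𝓑 : G → Submodule ℝ B) : Prop :=
  centerGrading 𝓑 1 = Submodule.span ℝ {1}

/-- `𝕃_e ≅ ℂ` as real algebras, where `𝕃` is the center. -/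
def CenterIdentityComplex (𝓑 : G → Submodule ℝ B) : Prop :=
  ∃ f : ℂ →ₐ[ℝ] Center ℝ B, Function.Injective f ∧ LinearMap.range f.toLinearMap = centerGrading 𝓑 1

/-- The natural homomorphism `G → G/H`, where `H` is the support of the center. -/
abbrev centerQuotient (𝓑 : G → Submodule ℝ B) : G →* G ⧸ centerSupport 𝓑 :=
  QuotientGroup.mk' (centerSupport 𝓑)

/-- `𝕃 ≅ L_π^χ(ℝ)` as graded algebras, where `𝕃` is the center. -/
def CenterIsTwistedLoop (𝓑 : G → Submodule ℝ B) (χ : G →* Circle) : Prop :=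
  GradedIsomorphic (centerGrading 𝓑)
    (twistedLoopGrading (centerQuotient 𝓑) χ (trivialGrading ℝ (G ⧸ centerSupport 𝓑)))

/-- `κ` is balanced with finite support, `σ` is a signature function for it, and
`B ≅ L_π^χ(𝒥(κ, σ))` as graded algebras. -/
def HasRealParameters (𝓑 : G → Submodule ℝ B) (χ : G →* Circle)
    (κ : G ⧸ centerSupport 𝓑 → ℕ) (σ : twoTorsion (G ⧸ centerSupport 𝓑) → ℤ) : Prop :=
  IsBalanced κ ∧ IsSignature κ σ ∧
    GradedIsomorphic 𝓑 (twistedLoopGrading (centerQuotient 𝓑) χ (realJordanGrading κ σ))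

/-- `κ` is balanced with finite support, and `B ≅ L_π(𝒥_ℂ(κ))` as graded real algebras. -/
def HasComplexParameter (𝓑 : G → Submodule ℝ B) (κ : G ⧸ centerSupport 𝓑 → ℕ) : Prop :=
  IsBalanced κ ∧
    GradedIsomorphic 𝓑 fun g =>
      (loopGrading (centerQuotient 𝓑) (complexJordanGrading κ) g).restrictScalars ℝ

end Main

end GradedJordan

end

open scoped TensorProduct

set_option linter.unusedSectionVars false

namespace GradedJordan

/-! ### Quadratic equations from degree at most two. -/

section DualFamily

variable {F V ι : Type*} [Field F] [AddCommGroup V] [Module F V]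

/-! The center 𝕃 is a graded field: for a nonzero homogeneous central `u`, the graded ideal `uB` is
all of `B`, so `u` is invertible (`IsGradedSimple.exists_inv`). Hence 𝕃_e is a finite field
extension of ℝ, that is, ℝ or ℂ. In the second case `B` is regarded as an algebra over 𝕃_e, so that
both cases become one situation over `k` = 𝕃_e (`IsGradedCentral`), where every nonzero component of
𝕃 is a `k`-line spanned by a unit.

The degree enters only through `IsQuadraticModulo`: modulo one proper ideal of 𝕃, each element
satisfies a quadratic equation when tested by 𝕃-linear functionals. A `k`-functional on one
component extends to a graded 𝕃-functional (`exists_functional`). Testing with functionals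
concentrated on one coset of H shows that elements of degree e are quadratic over `k`, and that
after removing scalars in degree e all products between chosen components are central
(`exists_isTracelessFamily`). With one degree τ(q) chosen in each coset q, this gives B = 𝕃1 ⊕ 𝕃V,
where V is the sum of the V_q. For degree reasons V_q V_r = 0 unless qr = 1, and V_q V_{q⁻¹} lies in
a single line of 𝕃; so the product on V is a `k`-valued form once units are chosen. It is
nondegenerate, because a vector v in its radical would span a proper graded ideal 𝕃v.

A complex point φ of 𝕃 embeds 𝕃 into ℂG by z ↦ φ(z)g for z of degree g. When `k` = ℝ, the quotients
of φ(z) by its conjugate form a character of H; it extends to G because the circle is divisible, and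
this is χ. Given such an embedding and units s_q in the degrees τ(q), normalized bases of the V_q
are sent to v ⊗ s_q, and this is the required isomorphism (`exists_gradedIsomorphic`).

An element a = c + v of 𝒥(V, b) satisfies a² = 2ca − n(a)1 with n(a) = c² − b(v, v). Therefore the
loop algebra is graded-division exactly when n has no nonzero homogeneous zero
(`isGradedDivision_iff`). Away from degree e this says that b is anisotropic on each V_q, and in
degree e that moreover b does not take the value 1. Over ℝ this means definite, and negative
definite in degree e; over ℂ it means dimension at most one, and zero in degree e. -/

theorem exists_dual_family {v : ι → V} (hv : LinearIndependent F v) :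
    ∃ f : ι → V →ₗ[F] F, ∀ i j, f i (v j) = open Classical in if i = j then 1 else 0 := by
  classical
  have key : ∀ i, ∃ g : V →ₗ[F] F, ∀ j, g (v j) = if i = j then 1 else 0 := by
    intro i
    obtain ⟨g, hg⟩ := LinearMap.exists_extend (Finsupp.lapply i ∘ₗ hv.repr)
    refine ⟨g, fun j => ?_⟩
    have := LinearMap.congr_fun hg ⟨v j, Submodule.subset_span ⟨j, rfl⟩⟩
    rw [LinearMap.comp_apply, Submodule.subtype_apply] at this
    rw [this, LinearMap.comp_apply, hv.repr_eq_single j _ rfl, Finsupp.lapply_apply,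
      Finsupp.single_apply]
    simp [eq_comm]
  choose g hg using key
  exact ⟨g, hg⟩

end DualFamily

section DegreeAtMostTwo

variable {F A : Type*} [Field F] [NonAssocRing A] [Module F A]

theorem baseChange_genericElement_one {n : ℕ} (e : Module.Basis (Fin n) F A) (f : A →ₗ[F] F) :
    f.baseChange (FractionRing (MvPolynomial (Fin n) F)) (genericElement e) =
      algebraMap (MvPolynomial (Fin n) F) _
        (∑ i, MvPolynomial.X i * MvPolynomial.C (f (e i))) ⊗ₜ 1 := by
  simp only [genericElement, map_sum, LinearMap.baseChange_tmul, map_mul, TensorProduct.sum_tmul]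
  refine Finset.sum_congr rfl fun i _ => ?_
  rw [← mul_one (f (e i)), ← smul_eq_mul, TensorProduct.tmul_smul, TensorProduct.smul_tmul',
    Algebra.smul_def, smul_eq_mul, mul_one, mul_comm,
    IsScalarTower.algebraMap_apply F (MvPolynomial (Fin n) F), MvPolynomial.algebraMap_eq]

variable [SMulCommClass F A A]

/-- A dependence need not involve `x * x`, but then `x` is itself a scalar and the equation is
trivial. -/
theorem sq_mem_span_of_not_linearIndependent {x : A} (h1 : ¬ LinearIndependent F ![1, x, x * x]) :
    ∃ a b : F, x * x = a • x + b • 1 := by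
  by_cases hx : ∃ c : F, x = c • 1
  · obtain ⟨c, rfl⟩ := hx
    exact ⟨0, c * c, by simp [mul_smul]⟩
  · by_contra! hab
    refine h1 ?_
    rw [Fintype.linearIndependent_iff]
    intro g hg
    rw [Fin.sum_univ_three] at hg
    simp only [Matrix.cons_val_zero, Matrix.cons_val_one, Matrix.cons_val] at hg
    have h2 : g 2 = 0 := by
      by_contra h2
      refine hab (-(g 2)⁻¹ * g 1) (-(g 2)⁻¹ * g 0) ?_
      have : (g 2)⁻¹ • (g 0 • (1 : A) + g 1 • x + g 2 • (x * x)) = 0 := by rw [hg, smul_zero]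
      simp only [smul_add, smul_smul, inv_mul_cancel₀ h2, one_smul] at this
      rw [← sub_eq_zero, ← this]
      module
    have h3 : g 1 = 0 := by
      by_contra h3
      refine hx ⟨-(g 1)⁻¹ * g 0, ?_⟩
      have : (g 1)⁻¹ • (g 0 • (1 : A) + g 1 • x + g 2 • (x * x)) = 0 := by rw [hg, smul_zero]
      simp only [h2, smul_add, smul_smul, inv_mul_cancel₀ h3, one_smul, zero_smul,
        add_zero] at this
      rw [← sub_eq_zero, ← this]
      module
    have h4 : g 0 = 0 := by
      by_contra h4
      refine hx ⟨0, ?_⟩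
      have h10 : (1 : A) = 0 := by
        simpa [h2, h3, h4] using hg
      rw [zero_smul, ← mul_one x, h10, mul_zero]
    intro i
    fin_cases i <;> assumption

variable [IsScalarTower F A A]

theorem baseChange_genericElement_sq {n : ℕ} (e : Module.Basis (Fin n) F A) (f : A →ₗ[F] F) :
    f.baseChange (FractionRing (MvPolynomial (Fin n) F)) (genericElement e * genericElement e) =
      algebraMap (MvPolynomial (Fin n) F) _ (∑ i, ∑ j,
        MvPolynomial.X i * MvPolynomial.X j * MvPolynomial.C (f (e i * e j))) ⊗ₜ 1 := by
  simp only [genericElement, Finset.sum_mul_sum, map_sum, Algebra.TensorProduct.tmul_mul_tmul,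
    LinearMap.baseChange_tmul, map_mul, TensorProduct.sum_tmul]
  refine Finset.sum_congr rfl fun i _ => Finset.sum_congr rfl fun j _ => ?_
  rw [← mul_one (f (e i * e j)), ← smul_eq_mul (f (e i * e j)) 1, TensorProduct.tmul_smul, TensorProduct.smul_tmul',
    Algebra.smul_def, smul_eq_mul, mul_one, mul_comm (algebraMap F _ _),
    IsScalarTower.algebraMap_apply F (MvPolynomial (Fin n) F), MvPolynomial.algebraMap_eq]

/-- In an algebra of degree at most two, every element is a root of a quadratic polynomial. -/
theorem HasDegree.exists_dependent {d : ℕ} (h : HasDegree F A d) (hd : d ≤ 2) (x : A) :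
    ¬ LinearIndependent F ![1, x, x * x] := by
  intro hli
  obtain ⟨n, e, ⟨p, hp, hpd, hp0⟩, -⟩ := h
  set R := MvPolynomial (Fin n) F
  set K := FractionRing R
  obtain ⟨f, hf⟩ : ∃ f : Fin 3 → A →ₗ[F] F, ∀ i j, f i (![1, x, x * x] j) =
      if i = j then 1 else 0 := by
    obtain ⟨f, hf⟩ := exists_dual_family hli
    exact ⟨f, fun i j => (hf i j).trans (by congr)⟩
  -- Specialization: the columns of `M` are the dual functionals applied to 1, the generic element
  -- and its square. At the coordinates of `x` it becomes the identity, whereas the generic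
  -- quadratic relation makes it singular over the fraction field.
  let M : Matrix (Fin 3) (Fin 3) R := Matrix.of fun i =>
    ![MvPolynomial.C (f i 1), ∑ a, MvPolynomial.X a * MvPolynomial.C (f i (e a)),
      ∑ a, ∑ b, MvPolynomial.X a * MvPolynomial.X b * MvPolynomial.C (f i (e a * e b))]
  have hMx : (MvPolynomial.eval fun a => e.repr x a).mapMatrix M = 1 := by
    have hx : ∑ a, e.repr x a • e a = x := e.sum_repr x
    ext i j
    have hij := hf i j
    fin_cases j
    · simpa [M, Matrix.one_apply] using hij
    · have : f i x = ∑ a, e.repr x a * f i (e a) := by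
        conv_lhs => rw [← hx, map_sum]
        simp only [map_smul, smul_eq_mul]
      simpa [M, Matrix.one_apply, this] using hij
    · have : f i (x * x) = ∑ a, ∑ b, e.repr x a * e.repr x b * f i (e a * e b) := by
        conv_lhs => rw [← hx, Finset.sum_mul_sum, map_sum]
        simp only [map_sum, smul_mul_assoc, mul_smul_comm, map_smul, smul_eq_mul]
        exact Finset.sum_congr rfl fun a _ => Finset.sum_congr rfl fun b _ => by ring
      simpa [M, Matrix.one_apply, this] using hij
  have hdet : M.det ≠ 0 := by
    intro h0
    have := congrArg (MvPolynomial.eval fun a => e.repr x a) h0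
    rw [RingHom.map_det, hMx] at this
    simp at this
  -- As `p` is monic of degree at most 2, its leading coefficient is one of these three, so `c` is a
  -- nonzero kernel vector.
  let c : Fin 3 → K := fun j => p.coeff j
  have hc : c ≠ 0 := by
    intro h0
    have h1 : p.coeff d = 1 := hpd ▸ hp
    have h2 : c ⟨d, by omega⟩ = 0 := by rw [h0]; rfl
    exact one_ne_zero (h1.symm.trans h2)
  have hsum : c 0 • (1 : K ⊗[F] A) + c 1 • genericElement e +
      c 2 • (genericElement e * genericElement e) = 0 := by
    rw [polyEval, Polynomial.sum_over_range' (n := 3)] at hp0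
    · simpa [Finset.sum_range_succ, npower, c] using hp0
    · simp
    · omega
  refine hdet ?_
  have hdetK : ((algebraMap R K).mapMatrix M).det = 0 := by
    refine Matrix.exists_mulVec_eq_zero_iff.1 ⟨c, hc, funext fun i => ?_⟩
    have := congrArg ((f i).baseChange K) hsum
    rw [map_add, map_add, map_smul, map_smul, map_smul, baseChange_genericElement_one,
      baseChange_genericElement_sq, Algebra.TensorProduct.one_def, LinearMap.baseChange_tmul,
      map_zero] at this
    have h2 := congrArg (TensorProduct.rid F K) this
    simp only [map_add, TensorProduct.smul_tmul', TensorProduct.rid_tmul, one_smul, map_zero] at h2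
    rw [Matrix.mulVec, dotProduct, Fin.sum_univ_three]
    simp only [RingHom.mapMatrix_apply, Matrix.map_apply, M, Matrix.of_apply, Matrix.cons_val_zero,
      Matrix.cons_val_one, Matrix.cons_val, Pi.zero_apply]
    rw [← h2]
    simp only [smul_eq_mul, mul_comm (c _)]
    congr 2
    rw [Algebra.smul_def, mul_comm,
      IsScalarTower.algebraMap_apply F (MvPolynomial (Fin n) F), MvPolynomial.algebraMap_eq]
    simp [R, K, mul_comm]
  rw [← RingHom.map_det] at hdetK
  exact (IsFractionRing.injective R K) (by rw [hdetK, map_zero])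

theorem HasDegree.sq_mem_span {d : ℕ} (h : HasDegree F A d) (hd : d ≤ 2) (x : A) :
    ∃ a b : F, x * x = a • x + b • 1 :=
  sq_mem_span_of_not_linearIndependent (h.exists_dependent hd x)

end DegreeAtMostTwo

/-- Every element of `B` satisfies, modulo a proper ideal of `L` and after applying any `L`-linear
functional, a quadratic equation with coefficients in `L`. -/
def IsQuadraticModulo (L B : Type*) [CommRing L] [NonAssocRing B] [Module L B] : Prop :=
  ∃ I : Ideal L, I ≠ ⊤ ∧ ∀ x : B, ∃ a b : L, ∀ f : B →ₗ[L] L, f (x * x) - a * f x - b * f 1 ∈ I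

/-- One factor of `L` suffices. The equation of `1 ⊗ x` over `L/𝔪` is lifted coefficientwise, and
each `L`-functional turns it into a congruence modulo 𝔪, which removes the tensor product from all
later arguments. -/
theorem HasDegreeOver.isQuadraticModulo {L B : Type*} [CommRing L] [NonAssocRing B] [Module L B]
    [SMulCommClass L B B] [IsScalarTower L B B] (h : HasDegreeOver L B 2) :
    IsQuadraticModulo L B := by
  obtain ⟨h1, 𝔪, -⟩ := h
  obtain ⟨m, hm, hdeg⟩ := h1 𝔪
  let _ : Field (L ⧸ 𝔪.asIdeal) := Ideal.Quotient.field 𝔪.asIdeal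
  refine ⟨𝔪.asIdeal, 𝔪.isMaximal.ne_top, fun x => ?_⟩
  obtain ⟨a, b, hab⟩ := HasDegree.sq_mem_span hdeg hm ((1 : L ⧸ 𝔪.asIdeal) ⊗ₜ[L] x)
  obtain ⟨a, rfl⟩ := Ideal.Quotient.mk_surjective a
  obtain ⟨b, rfl⟩ := Ideal.Quotient.mk_surjective b
  refine ⟨a, b, fun f => ?_⟩
  rw [← Ideal.Quotient.eq_zero_iff_mem]
  have := congrArg (TensorProduct.rid L (L ⧸ 𝔪.asIdeal) ∘ f.lTensor (L ⧸ 𝔪.asIdeal)) hab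
  simp only [Function.comp_apply, Algebra.TensorProduct.tmul_mul_tmul,
    Algebra.TensorProduct.one_def, TensorProduct.smul_tmul', map_add, LinearMap.lTensor_tmul,
    TensorProduct.rid_tmul, smul_eq_mul, mul_one] at this
  simp only [Algebra.smul_def, Ideal.Quotient.algebraMap_eq, mul_one] at this
  rw [map_sub, map_sub, map_mul (Ideal.Quotient.mk _) a, map_mul (Ideal.Quotient.mk _) b, this]
  ring

/-! ### Homogeneous components and the grading of the center. -/

namespace IsGrading

section Projections

variable {k G A M : Type*} [CommRing k] [CommGroup G] [NonUnitalNonAssocRing A] [Module k A]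
  [AddCommGroup M] [Module k M] {𝓐 : G → Submodule k A} [IsGrading 𝓐]

theorem isInternal [DecidableEq G] : DirectSum.IsInternal 𝓐 :=
  DirectSum.isInternal_submodule_of_iSupIndep_of_iSup_eq_top indep iSup_eq_top

/-- The decomposition attached to a grading. -/
@[reducible]
noncomputable def decomposition (𝓐 : G → Submodule k A) [IsGrading 𝓐] [DecidableEq G] :
    DirectSum.Decomposition 𝓐 :=
  (isInternal (𝓐 := 𝓐)).chooseDecomposition

/-- The projection onto the component of degree `g`. -/
noncomputable def proj (𝓐 : G → Submodule k A) [IsGrading 𝓐] (g : G) : A →ₗ[k] A :=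
  letI := Classical.decEq G
  letI := decomposition 𝓐
  (𝓐 g).subtype ∘ₗ DirectSum.component k G (fun i => 𝓐 i) g ∘ₗ
    (DirectSum.decomposeLinearEquiv 𝓐).toLinearMap

variable (𝓐) in
theorem proj_mem (g : G) (x : A) : proj 𝓐 g x ∈ 𝓐 g := by
  simp [proj]

theorem proj_of_mem {g : G} {x : A} (hx : x ∈ 𝓐 g) : proj 𝓐 g x = x := by
  let _ := Classical.decEq G
  let _ := decomposition 𝓐
  exact DirectSum.decompose_of_mem_same 𝓐 hx

theorem proj_of_mem_ne {g h : G} {x : A} (hx : x ∈ 𝓐 h) (hgh : h ≠ g) : proj 𝓐 g x = 0 := by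
  let _ := Classical.decEq G
  let _ := decomposition 𝓐
  exact DirectSum.decompose_of_mem_ne 𝓐 hx hgh

variable (𝓐) in
theorem ext_proj {x y : A} (h : ∀ g, proj 𝓐 g x = proj 𝓐 g y) : x = y := by
  let _ := Classical.decEq G
  let _ := decomposition 𝓐
  refine (DirectSum.decompose 𝓐).injective (DFinsupp.ext fun g => Subtype.ext (h g))

variable (𝓐) in
theorem induction {p : A → Prop} (zero : p 0) (mem : ∀ g, ∀ x ∈ 𝓐 g, p x)
    (add : ∀ x y, p x → p y → p (x + y)) (x : A) : p x :=
  Submodule.iSup_induction 𝓐 (motive := p)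
    (by rw [IsGrading.iSup_eq_top (𝓐 := 𝓐)]; trivial) mem zero add

variable (𝓐) in
theorem exists_sum_proj (x : A) : ∃ s : Finset G, x = ∑ g ∈ s, proj 𝓐 g x := by
  let _ := Classical.decEq G
  let _ := decomposition 𝓐
  let _ : (i : G) → (x : 𝓐 i) → Decidable (x ≠ 0) := fun _ _ => Classical.dec _
  exact ⟨_, (DirectSum.sum_support_decompose 𝓐 x).symm⟩

variable (𝓐) in
theorem addMonoidHom_ext {N : Type*} [AddCommMonoid N] {f g : A →+ N}
    (h : ∀ i, ∀ x ∈ 𝓐 i, f x = g x) : f = g :=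
  AddMonoidHom.ext fun x => induction 𝓐 (by simp) h (fun x y hx hy => by simp [hx, hy]) x

variable (𝓐) in
theorem exists_linearMap (f : G → A →ₗ[k] M) :
    ∃ F : A →ₗ[k] M, ∀ g, ∀ x ∈ 𝓐 g, F x = f g x := by
  let _ := Classical.decEq G
  let _ := decomposition 𝓐
  refine ⟨DirectSum.toModule k G M (fun g => f g ∘ₗ (𝓐 g).subtype) ∘ₗ
    (DirectSum.decomposeLinearEquiv 𝓐).toLinearMap, fun g x hx => ?_⟩
  rw [LinearMap.comp_apply, LinearEquiv.coe_coe, DirectSum.decomposeLinearEquiv_apply,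
    DirectSum.decompose_of_mem 𝓐 hx]
  erw [DirectSum.toModule_lof]
  rfl

theorem eq_zero_of_mem_of_mem {g h : G} {x : A} (hg : x ∈ 𝓐 g) (hh : x ∈ 𝓐 h) (hgh : g ≠ h) :
    x = 0 := by
  rw [← proj_of_mem hh, proj_of_mem_ne hg hgh]

theorem proj_mul_of_mem_right {g h : G} {x : A} (hx : x ∈ 𝓐 h) (z : A) :
    proj 𝓐 (g * h) (z * x) = proj 𝓐 g z * x := by
  have : (proj 𝓐 (g * h)).toAddMonoidHom.comp (AddMonoidHom.mulRight x) =
      (AddMonoidHom.mulRight x).comp (proj 𝓐 g).toAddMonoidHom := by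
    refine addMonoidHom_ext 𝓐 fun i y hy => ?_
    simp only [AddMonoidHom.comp_apply, LinearMap.toAddMonoidHom_coe, AddMonoidHom.mulRight_apply]
    by_cases hi : i = g
    · subst hi
      rw [proj_of_mem hy, proj_of_mem (mul_mem hy hx)]
    · rw [proj_of_mem_ne hy hi, zero_mul,
        proj_of_mem_ne (mul_mem hy hx) fun h' => hi (mul_right_cancel h')]
  exact DFunLike.congr_fun this z

end Projections

section Unital

variable {k G B : Type*} [CommRing k] [CommGroup G] [NonAssocRing B] [Module k B]
  {𝓑 : G → Submodule k B} [IsGrading 𝓑]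

variable (𝓑) in
-- Taking the component of degree `g` in `1 * x = x`, with `x` of degree `g`, shows that the
-- degree-one component of 1 acts as a left unit; hence it equals 1.
theorem one_mem : (1 : B) ∈ 𝓑 1 := by
  have h : ∀ x : B, proj 𝓑 1 1 * x = x := by
    refine induction 𝓑 (mul_zero _) (fun g x hx => ?_) fun x y hx hy => by rw [mul_add, hx, hy]
    rw [← proj_mul_of_mem_right hx, one_mul, one_mul, proj_of_mem hx]
  have h1 := h 1
  rw [mul_one] at h1
  rw [← h1]
  exact proj_mem 𝓑 1 1

end Unital

section Center

variable {k G B : Type*} [CommRing k] [CommGroup G] [NonAssocCommRing B] [Module k B]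
  [SMulCommClass k B B] [IsScalarTower k B B] {𝓑 : G → Submodule k B} [IsGrading 𝓑]

theorem mem_center_of_assoc {z : B} (h : ∀ a b : B, z * (a * b) = z * a * b) :
    z ∈ Set.center B :=
  ⟨fun a => mul_comm z a, h, fun a b => by
    rw [mul_comm (a * b) z, mul_comm a b, h, mul_comm a, mul_comm b z]⟩

/-- For homogeneous `a` and `b`, compare components of one degree on both sides of `z(ab) = (za)b`.
-/
theorem proj_mem_center {z : B} (hz : z ∈ Set.center B) (g : G) :
    proj 𝓑 g z ∈ Set.center B := by
  refine mem_center_of_assoc fun a b => ?_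
  revert b
  refine induction 𝓑 (by simp) (fun h b hb => ?_) fun x y hx hy => by simp [mul_add, hx, hy]
  revert a
  refine induction 𝓑 (by simp) (fun i a ha => ?_)
    fun x y hx hy => by simp [mul_add, add_mul, hx, hy]
  rw [← proj_mul_of_mem_right ha, ← proj_mul_of_mem_right hb, ← hz.left_assoc, mul_assoc g,
    ← proj_mul_of_mem_right (mul_mem ha hb)]

theorem mem_centerGrading {g : G} {z : Center k B} : z ∈ centerGrading 𝓑 g ↔ (z : B) ∈ 𝓑 g :=
  Iff.rfl

instance isGrading_centerGrading : IsGrading (centerGrading 𝓑) where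
  indep := by
    intro g
    rw [Submodule.disjoint_def]
    intro z hz hz'
    have hle : (⨆ j, ⨆ (_ : j ≠ g), centerGrading 𝓑 j) ≤
        LinearMap.ker (proj 𝓑 g ∘ₗ (NonUnitalSubalgebra.center k B).toSubmodule.subtype) :=
      iSup₂_le fun j hj w hw => proj_of_mem_ne (𝓐 := 𝓑) hw hj
    refine Subtype.ext ?_
    rw [← proj_of_mem (mem_centerGrading.1 hz)]
    exact hle hz'
  iSup_eq_top := by
    rw [eq_top_iff]
    intro z _
    obtain ⟨s, hs⟩ := exists_sum_proj 𝓑 (z : B)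
    have : z = ∑ g ∈ s, (⟨proj 𝓑 g z, proj_mem_center z.2 g⟩ : Center k B) := by
      refine Subtype.ext (hs.trans ?_)
      exact (map_sum (NonUnitalSubalgebra.center k B).toSubmodule.subtype
        (fun g => (⟨proj 𝓑 g z, proj_mem_center z.2 g⟩ : Center k B)) s).symm
    rw [this]
    exact Submodule.sum_mem _ fun g _ => Submodule.mem_iSup_of_mem g (proj_mem 𝓑 g (z : B))
  mul_mem {g h x y} hx hy := mul_mem (𝓐 := 𝓑) hx hy

end Center

end IsGrading

/-! ### The center as a graded field. -/

section Support

variable {k G Q B : Type*} [CommRing k] [CommGroup G] [CommGroup Q] [NonAssocCommRing B]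
  [Module k B] [SMulCommClass k B B] [IsScalarTower k B B] {𝓑 : G → Submodule k B}

instance : IsScalarTower k (Center k B) B :=
  ⟨fun c z x => smul_mul_assoc c (z : B) x⟩

instance [IsNoetherian k B] : IsNoetherian k (Center k B) :=
  inferInstanceAs (IsNoetherian k (NonUnitalSubalgebra.center k B).toSubmodule)

/-- The center of `B` is a graded field whose component of degree `1` is the ground ring, and `π` is
the quotient by its support. -/
structure IsGradedCentral (𝓑 : G → Submodule k B) (π : G →* Q) : Prop where
  surjective : Function.Surjective π
  exists_inv : ∀ {g} {u : Center k B}, u ∈ centerGrading 𝓑 g → u ≠ 0 →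
    ∃ v ∈ centerGrading 𝓑 g⁻¹, u * v = 1
  apply_eq_one_iff : ∀ g, π g = 1 ↔ centerGrading 𝓑 g ≠ ⊥
  exists_algebraMap : ∀ u ∈ centerGrading 𝓑 1, ∃ c : k, u = algebraMap k _ c

variable [IsGrading 𝓑]

theorem IsGradedSimple.nontrivial (h : IsGradedSimple 𝓑) : Nontrivial B := by
  obtain ⟨⟨x, y, hxy⟩, -⟩ := h
  exact ⟨⟨_, _, hxy⟩⟩

/-- A nonzero homogeneous central element of a graded-simple algebra is invertible. -/
theorem IsGradedSimple.exists_inv (h : IsGradedSimple 𝓑) {g : G} {u : Center k B}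
    (hu : u ∈ centerGrading 𝓑 g) (hu0 : u ≠ 0) : ∃ v ∈ centerGrading 𝓑 g⁻¹, u * v = 1 := by
  have hug : (u : B) ∈ 𝓑 g := hu
  -- `uB` is a nonzero graded ideal, hence contains 1. The component of degree `g⁻¹` of a solution
  -- of `u * b = 1` is still an inverse, and its centrality is verified after multiplying by `u`,
  -- which is injective.
  let I : Submodule k B := LinearMap.range (LinearMap.mulLeft k (u : B))
  have hI : I = ⊤ := by
    refine (h.2 I ?_ ?_).resolve_left ?_
    · rintro _ ⟨b, rfl⟩ a
      have : a * (u * b) = u * (a * b) := by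
        rw [mul_comm a, ← u.2.left_assoc, mul_comm b]
      exact ⟨⟨a * b, this.symm⟩, ⟨a * b, by rw [LinearMap.mulLeft_apply, LinearMap.mulLeft_apply,
        mul_comm _ a, this]⟩⟩
    · refine le_antisymm ?_ (iSup_le fun _ => inf_le_left)
      rintro _ ⟨b, rfl⟩
      obtain ⟨s, hs⟩ := IsGrading.exists_sum_proj 𝓑 b
      rw [hs, map_sum]
      exact Submodule.sum_mem _ fun i _ => Submodule.mem_iSup_of_mem (g * i)
        ⟨⟨_, rfl⟩, IsGrading.mul_mem hug (IsGrading.proj_mem 𝓑 i b)⟩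
    · intro h0
      have : (u : B) * 1 ∈ I := ⟨1, rfl⟩
      rw [h0, Submodule.mem_bot, mul_one] at this
      exact hu0 (Subtype.ext this)
  obtain ⟨b, hb⟩ : (1 : B) ∈ I := hI ▸ Submodule.mem_top
  rw [LinearMap.mulLeft_apply] at hb
  have hinj : ∀ x y : B, u * x = u * y → x = y := by
    intro x y hxy
    have key : ∀ z : B, b * (u * z) = z := fun z => by
      rw [mul_comm b, ← u.2.left_assoc, mul_comm z, u.2.left_assoc, hb, one_mul]
    rw [← key x, hxy, key]
  have h1 : (u : B) * IsGrading.proj 𝓑 g⁻¹ b = 1 := by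
    rw [mul_comm, ← IsGrading.proj_mul_of_mem_right hug, mul_comm b, hb, inv_mul_cancel,
      IsGrading.proj_of_mem (IsGrading.one_mem 𝓑)]
  refine ⟨⟨IsGrading.proj 𝓑 g⁻¹ b, IsGrading.mem_center_of_assoc fun x y => hinj _ _ ?_⟩,
    IsGrading.proj_mem 𝓑 _ b, Subtype.ext h1⟩
  rw [u.2.left_assoc, h1, u.2.left_assoc, u.2.left_assoc, h1, one_mul, one_mul]

/-- Invertibility of homogeneous central elements makes the support closed under products and
inverses, so the generated subgroup adds no new degrees. -/
theorem IsGradedSimple.mem_centerSupport (h : IsGradedSimple 𝓑) (g : G) :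
    g ∈ centerSupport 𝓑 ↔ centerGrading 𝓑 g ≠ ⊥ := by
  have : Nontrivial B := h.nontrivial
  have hne : ∀ {g : G} {u v : Center k B}, u ∈ centerGrading 𝓑 g → u * v = 1 →
      centerGrading 𝓑 g ≠ ⊥ := fun {g u v} hu huv h0 => by
    rw [h0, Submodule.mem_bot] at hu
    rw [hu, zero_mul] at huv
    exact zero_ne_one (congrArg Subtype.val huv)
  refine ⟨fun hg => ?_, fun hg => Subgroup.subset_closure hg⟩
  refine Subgroup.closure_induction (p := fun g _ => centerGrading 𝓑 g ≠ ⊥) (fun g hg => hg) ?_ ?_ ?_ hg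
  · exact hne (u := 1) (v := 1) (IsGrading.one_mem 𝓑) (one_mul 1)
  · intro x y _ _ hx hy
    obtain ⟨u, hu, hu0⟩ := Submodule.exists_mem_ne_zero_of_ne_bot hx
    obtain ⟨v, hv, hv0⟩ := Submodule.exists_mem_ne_zero_of_ne_bot hy
    obtain ⟨u', hu', huu⟩ := h.exists_inv hu hu0
    obtain ⟨v', hv', hvv⟩ := h.exists_inv hv hv0
    refine hne (u := u * v) (v := u' * v') (IsGrading.mul_mem hu hv) ?_
    rw [mul_mul_mul_comm, huu, hvv, one_mul]
  · intro x _ hx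
    obtain ⟨u, hu, hu0⟩ := Submodule.exists_mem_ne_zero_of_ne_bot hx
    obtain ⟨u', hu', huu⟩ := h.exists_inv hu hu0
    exact hne hu' ((mul_comm u' u).trans huu)

theorem IsGradedSimple.isGradedCentral (h : IsGradedSimple 𝓑)
    (h1 : centerGrading 𝓑 1 = Submodule.span k {1}) :
    IsGradedCentral 𝓑 (QuotientGroup.mk' (centerSupport 𝓑)) where
  surjective := QuotientGroup.mk'_surjective _
  exists_inv := h.exists_inv
  apply_eq_one_iff g := by
    rw [← h.mem_centerSupport, QuotientGroup.mk'_apply, QuotientGroup.eq_one_iff]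
  exists_algebraMap u hu := by
    rw [h1, Submodule.mem_span_singleton] at hu
    obtain ⟨c, rfl⟩ := hu
    exact ⟨c, (Algebra.algebraMap_eq_smul_one c).symm⟩

end Support

section CenterIdentity

variable {G B : Type*} [CommGroup G] [NonAssocCommRing B] [Module ℝ B] [SMulCommClass ℝ B B]
  [IsScalarTower ℝ B B] [FiniteDimensional ℝ B] {𝓑 : G → Submodule ℝ B} [IsGrading 𝓑]

/-- Inverses of degree-one elements have degree one, so this component is a finite field extension
of ℝ. -/
theorem IsGradedSimple.centerIdentity (h : IsGradedSimple 𝓑) :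
    CenterIdentityReal 𝓑 ∨ CenterIdentityComplex 𝓑 := by
  have : Nontrivial B := h.nontrivial
  have h1 : (1 : Center ℝ B) ∈ centerGrading 𝓑 1 := IsGrading.one_mem 𝓑
  let K : Subalgebra ℝ (Center ℝ B) :=
    Submodule.toSubalgebra (centerGrading 𝓑 1) h1 fun x y hx hy => by
      simpa using IsGrading.mul_mem hx hy
  have hK : IsField K :=
    { exists_pair_ne := ⟨0, 1, fun h01 => zero_ne_one (α := B) (
        congrArg (fun z : K => ((z : Center ℝ B) : B)) h01)⟩
      mul_comm := mul_comm
      mul_inv_cancel := by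
        rintro ⟨u, hu⟩ hu0
        obtain ⟨v, hv, huv⟩ := h.exists_inv (u := u) hu fun h0 => hu0 (Subtype.ext h0)
        rw [inv_one] at hv
        exact ⟨⟨v, hv⟩, Subtype.ext huv⟩ }
  let _ : Field K := hK.toField
  have : FiniteDimensional ℝ K := inferInstanceAs (FiniteDimensional ℝ (Subalgebra.toSubmodule K))
  have : Algebra.IsAlgebraic ℝ K := Algebra.IsAlgebraic.of_finite ℝ K
  rcases Real.nonempty_algEquiv_or K with ⟨⟨e⟩⟩ | ⟨⟨e⟩⟩
  · left
    refine le_antisymm (fun u hu => ?_) ?_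
    · have : (⟨u, hu⟩ : K) = algebraMap ℝ K (e ⟨u, hu⟩) := by
        rw [← e.symm_apply_apply ⟨u, hu⟩, e.apply_symm_apply]
        exact e.symm.commutes _
      rw [Submodule.mem_span_singleton]
      refine ⟨e ⟨u, hu⟩, ?_⟩
      rw [← Algebra.algebraMap_eq_smul_one]
      exact (congrArg Subtype.val this).symm
    · rw [Submodule.span_singleton_le_iff_mem]
      exact h1
  · right
    refine ⟨K.val.comp e.symm.toAlgHom, ?_, ?_⟩
    · exact Subtype.val_injective.comp e.symm.injective
    · ext u
      constructor
      · rintro ⟨c, rfl⟩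
        exact (e.symm c).2
      · intro hu
        exact ⟨e ⟨u, hu⟩, congrArg Subtype.val (e.symm_apply_apply ⟨u, hu⟩)⟩

end CenterIdentity

/-! ### Graded functionals with values in the center. -/

section Functionals

variable {k G Q B : Type*} [Field k] [CommGroup G] [CommGroup Q] [NonAssocCommRing B]
  [Module k B] [SMulCommClass k B B] [IsScalarTower k B B] [Nontrivial B]
  {𝓑 : G → Submodule k B} [IsGrading 𝓑] {π : G →* Q}

theorem IsGradedCentral.centerGrading_ne_bot_of_mul_eq_one {g : G} {u v : Center k B}
    (hu : u ∈ centerGrading 𝓑 g) (huv : u * v = 1) : centerGrading 𝓑 g ≠ ⊥ := fun h0 => by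
  rw [h0, Submodule.mem_bot] at hu
  rw [hu, zero_mul] at huv
  exact zero_ne_one (congrArg Subtype.val huv)

namespace IsGradedCentral

variable (hc : IsGradedCentral 𝓑 π)
include hc

/-- A choice defined for every degree: outside the support `u` is necessarily 0, which makes the
functionals built from it vanish there. -/
theorem exists_unit (g : G) : ∃ u ∈ centerGrading 𝓑 g, ∃ v ∈ centerGrading 𝓑 g⁻¹,
    π g = 1 → u * v = 1 := by
  by_cases hg : π g = 1
  · obtain ⟨u, hu, hu0⟩ := Submodule.exists_mem_ne_zero_of_ne_bot ((hc.apply_eq_one_iff g).1 hg)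
    obtain ⟨v, hv, huv⟩ := hc.exists_inv hu hu0
    exact ⟨u, hu, v, hv, fun _ => huv⟩
  · exact ⟨0, zero_mem _, 0, zero_mem _, fun h => absurd h hg⟩

theorem eq_zero_of_mem {g : G} (hg : π g ≠ 1) {u : Center k B} (hu : u ∈ centerGrading 𝓑 g) :
    u = 0 := by
  have : centerGrading 𝓑 g = ⊥ := by
    by_contra h
    exact hg ((hc.apply_eq_one_iff g).2 h)
  rwa [this, Submodule.mem_bot] at hu

/-- A `k`-linear functional on the component of degree `t` extends to a graded `L`-linear
functional. -/
theorem exists_functional (t : G) (f : B →ₗ[k] k) : ∃ F : B →ₗ[Center k B] Center k B,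
    (∀ x ∈ 𝓑 t, F x = algebraMap k _ (f x)) ∧
      ∀ g, ∀ x ∈ 𝓑 g, F x ∈ centerGrading 𝓑 (g * t⁻¹) := by
  choose u hu v hv huv using hc.exists_unit
  -- With `u` of degree `g * t⁻¹` and inverse `v`, an element `x` of degree `g` is carried to degree
  -- `t` and back: `F x = f (v • x) • u`.
  obtain ⟨F, hF⟩ := IsGrading.exists_linearMap 𝓑 fun g =>
    LinearMap.toSpanSingleton k (Center k B) (u (g * t⁻¹)) ∘ₗ f ∘ₗ
      LinearMap.mulLeft k (v (g * t⁻¹) : B)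
  replace hF : ∀ g, ∀ x ∈ 𝓑 g, F x = f (v (g * t⁻¹) • x) • u (g * t⁻¹) := hF
  -- Independence of the unit: two units of one degree differ by a scalar of `k`, which cancels in
  -- the formula. This freedom is what yields linearity over the center.
  have key : ∀ g, ∀ x ∈ 𝓑 g, ∀ w ∈ centerGrading 𝓑 (g * t⁻¹),
      ∀ w' ∈ centerGrading 𝓑 (g * t⁻¹)⁻¹, w * w' = 1 → F x = f (w' • x) • w := by
    intro g x hx w hw w' hw' hww
    have hπ := (hc.apply_eq_one_iff _).2 (centerGrading_ne_bot_of_mul_eq_one hw hww)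
    obtain ⟨c, hcw⟩ := hc.exists_algebraMap (w * v (g * t⁻¹)) (by
      have := IsGrading.mul_mem hw (hv (g * t⁻¹))
      rwa [mul_inv_cancel] at this)
    have h1 : w = c • u (g * t⁻¹) := by
      rw [Algebra.smul_def, ← hcw, mul_assoc, mul_comm (v _), huv _ hπ, mul_one]
    have h2 : v (g * t⁻¹) = c • w' := by
      rw [Algebra.smul_def, ← hcw, mul_right_comm, hww, one_mul]
    rw [hF g x hx, h2, smul_assoc, map_smul, h1, smul_smul, smul_eq_mul, mul_comm]
  have hzero : ∀ g, ∀ x ∈ 𝓑 g, π (g * t⁻¹) ≠ 1 → F x = 0 := by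
    intro g x hx hg
    rw [hF g x hx, hc.eq_zero_of_mem hg (hu _), smul_zero]
  have hlin : ∀ (z : Center k B) (x : B), F (z • x) = z * F x := by
    intro z x
    revert z
    refine IsGrading.induction (centerGrading 𝓑) (by simp) (fun h z hz => ?_)
      fun z w hz hw => by rw [add_smul, map_add, hz, hw, add_mul]
    by_cases hz0 : z = 0
    · simp [hz0]
    obtain ⟨z', hz', hzz⟩ := hc.exists_inv hz hz0
    revert x
    refine IsGrading.induction 𝓑 (by simp) (fun g x hx => ?_)
      fun x y hx hy => by rw [smul_add, map_add, hx, hy, map_add, mul_add]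
    have hzx : z • x ∈ 𝓑 (h * g) := IsGrading.mul_mem (𝓐 := 𝓑) hz hx
    have hh : π h = 1 := (hc.apply_eq_one_iff _).2 (centerGrading_ne_bot_of_mul_eq_one hz hzz)
    by_cases hg : π (g * t⁻¹) = 1
    · rw [key _ _ hzx (z * u (g * t⁻¹)) (by rw [mul_assoc]; exact IsGrading.mul_mem hz (hu _))
        (z' * v (g * t⁻¹)) (by
          rw [mul_assoc, mul_inv]; exact IsGrading.mul_mem hz' (hv _))
        (by rw [mul_mul_mul_comm, hzz, huv _ hg, one_mul]), smul_smul,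
        mul_right_comm, mul_comm z', hzz, one_mul, hF g x hx, mul_smul_comm]
    · rw [hzero _ _ hx hg, hzero _ _ hzx (by rwa [mul_assoc, map_mul, hh, one_mul]), mul_zero]
  refine ⟨{ F with map_smul' := hlin }, fun x hx => ?_, fun g x hx => ?_⟩
  · change F x = _
    rw [key t x hx 1 (by rw [mul_inv_cancel]; exact IsGrading.one_mem 𝓑) 1
      (by rw [mul_inv_cancel, inv_one]; exact IsGrading.one_mem 𝓑) (one_mul 1), one_smul,
      Algebra.algebraMap_eq_smul_one]
  · change F x ∈ _
    rw [hF g x hx]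
    exact Submodule.smul_mem _ _ (hu _)

/-- A homogeneous element outside the center is detected by a graded functional that vanishes
at `1`. -/
theorem exists_functional_eq_one {g : G} {y : B} (hy : y ∈ 𝓑 g) (hyc : y ∉ Set.center B) :
    ∃ F : B →ₗ[Center k B] Center k B, F y = 1 ∧ F 1 = 0 ∧
      ∀ h, π h ≠ π g → ∀ x ∈ 𝓑 h, F x = 0 := by
  -- If `g` lies in the support, `y` is moved to degree one, where it is independent of 1 because it
  -- is not central. Otherwise `F 1 = 0` holds for degree reasons.
  by_cases hg : π g = 1
  · obtain ⟨u, hu, v, hv, huv⟩ := hc.exists_unit g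
    replace huv := huv hg
    have hvy : v • y ∈ 𝓑 1 := by
      have := IsGrading.mul_mem (𝓐 := 𝓑) hv hy
      rwa [inv_mul_cancel] at this
    have hli : LinearIndependent k ![1, v • y] := by
      rw [LinearIndependent.pair_iff' one_ne_zero]
      intro a ha
      refine hyc ?_
      have : y = (a • u : Center k B) • (1 : B) := by
        rw [smul_assoc, smul_comm, ha, smul_smul, huv, one_smul]
      rw [this, center_smul_def, mul_one]
      exact Subtype.property _
    obtain ⟨f, hf⟩ := exists_dual_family hli
    obtain ⟨F, hF1, hF2⟩ := hc.exists_functional 1 (f 1)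
    refine ⟨v • F, ?_, ?_, fun h hh x hx => ?_⟩
    · have h2 : f 1 (v • y) = 1 := by simpa using hf 1 1
      rw [LinearMap.smul_apply, ← map_smul, hF1 _ hvy, h2, map_one]
    · have h2 : f 1 1 = 0 := by simpa using hf 1 0
      rw [LinearMap.smul_apply, hF1 1 (IsGrading.one_mem 𝓑), h2, map_zero, smul_zero]
    · rw [LinearMap.smul_apply, hc.eq_zero_of_mem _ (hF2 h x hx), smul_zero]
      rw [inv_one, mul_one, ← hg]
      exact hh
  · have hy0 : y ≠ 0 := fun h => hyc (h ▸ Set.zero_mem_center)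
    have hli : LinearIndependent k ![y] := LinearIndependent.of_subsingleton 0 hy0
    obtain ⟨f, hf⟩ := exists_dual_family hli
    obtain ⟨F, hF1, hF2⟩ := hc.exists_functional g (f 0)
    have hF3 : ∀ h, π h ≠ π g → ∀ x ∈ 𝓑 h, F x = 0 := fun h hh x hx =>
      hc.eq_zero_of_mem (by rwa [map_mul, map_inv, ne_eq, mul_inv_eq_one]) (hF2 h x hx)
    refine ⟨F, ?_, ?_, hF3⟩
    · have : f 0 y = 1 := by simpa using hf 0 0
      rw [hF1 y hy, this, map_one]
    · exact hF3 1 (by rw [map_one]; exact Ne.symm hg) 1 (IsGrading.one_mem 𝓑)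

end IsGradedCentral

end Functionals

/-! ### The trace-zero part in degree one. -/

section Traceless

variable {k B : Type*} [Field k] [NonAssocCommRing B] [Module k B] [SMulCommClass k B B]
  [IsScalarTower k B B]

/-- In a subspace `W` of a commutative algebra all of whose elements are quadratic over the ground
field, the elements `v` with `v² ∈ k1` that are not nonzero scalars form a subspace. -/
def traceless (h2 : (2 : k) ≠ 0) (W : Submodule k B)
    (hW : ∀ x ∈ W, ∃ a b : k, x * x = a • x + b • 1) : Submodule k B where
  carrier := {v | v ∈ W ∧ (∃ c : k, v * v = c • 1) ∧ ∀ c : k, v = c • 1 → v = 0}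
  zero_mem' := ⟨W.zero_mem, ⟨0, by simp⟩, fun _ _ => rfl⟩
  smul_mem' := by
    rintro a v ⟨hv, ⟨c, hc⟩, hv0⟩
    refine ⟨W.smul_mem a hv, ⟨a * a * c, ?_⟩, fun d hd => ?_⟩
    · rw [smul_mul_assoc, mul_smul_comm, hc, smul_smul, smul_smul]
    · by_cases ha : a = 0
      · rw [ha, zero_smul]
      · rw [hv0 (a⁻¹ * d) (by rw [mul_smul, ← hd, smul_smul, inv_mul_cancel₀ ha, one_smul]),
          smul_zero]
  add_mem' := by
    rintro v w ⟨hv, ⟨c, hc⟩, hv0⟩ ⟨hw, ⟨d, hd⟩, hw0⟩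
    by_cases hvz : v = 0
    · rw [hvz, zero_add]; exact ⟨hw, ⟨d, hd⟩, hw0⟩
    -- A nonzero element of the set is never a scalar, hence is independent of 1.
    have hv1 : ∀ p r : k, p • v + r • (1 : B) = 0 → p = 0 := by
      intro p r hpr
      by_contra hp
      refine hvz (hv0 (-(p⁻¹ * r)) ?_)
      have : p⁻¹ • (p • v + r • (1 : B)) = 0 := by rw [hpr, smul_zero]
      rw [smul_add, smul_smul, smul_smul, inv_mul_cancel₀ hp, one_smul] at this
      rw [neg_smul]
      exact eq_neg_of_add_eq_zero_left this
    by_cases hwv : ∃ a b : k, w = a • v + b • 1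
    · obtain ⟨a, b, rfl⟩ := hwv
      -- The coefficient of `v` in the square of `a • v + b • 1` is `2 * (a * b)`, and that square
      -- is a scalar.
      have hab : a * b = 0 := by
        have h3 : (2 * (a * b)) • v + (a * a * c + b * b - d) • (1 : B) = 0 := by
          have : (a • v + b • (1 : B)) * (a • v + b • 1) =
              (a * a) • (v * v) + (2 * (a * b)) • v + (b * b) • 1 := by
            simp only [add_mul, mul_add, smul_mul_assoc, mul_smul_comm, mul_one, one_mul]
            module
          rw [hd, hc] at this
          rw [← sub_eq_zero] at this
          rw [← neg_eq_zero, ← this]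
          module
        exact (mul_eq_zero.1 (hv1 _ _ h3)).resolve_left h2
      rcases mul_eq_zero.1 hab with ha | hb
      · have h0 := hw0 b (by rw [ha, zero_smul, zero_add])
        rw [h0, add_zero]
        exact ⟨hv, ⟨c, hc⟩, hv0⟩
      · have : v + (a • v + b • (1 : B)) = (1 + a) • v := by rw [hb]; module
        rw [this]
        refine ⟨W.smul_mem _ hv, ⟨(1 + a) * (1 + a) * c, ?_⟩, fun e he => ?_⟩
        · rw [smul_mul_assoc, mul_smul_comm, hc, smul_smul, smul_smul]
        · rw [hv1 (1 + a) (-e) (by rw [he]; module), zero_smul]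
    · have hli : ∀ p q r : k, p • v + q • w + r • (1 : B) = 0 → p = 0 ∧ q = 0 := by
        intro p q r h0
        have hq : q = 0 := by
          by_contra hq
          refine hwv ⟨-(q⁻¹ * p), -(q⁻¹ * r), ?_⟩
          have : q⁻¹ • (p • v + q • w + r • (1 : B)) = 0 := by rw [h0, smul_zero]
          simp only [smul_add, smul_smul, inv_mul_cancel₀ hq, one_smul] at this
          rw [← sub_eq_zero, ← this]
          module
        subst hq
        rw [zero_smul, add_zero] at h0
        exact ⟨hv1 _ _ h0, rfl⟩
      obtain ⟨a, b, hab⟩ := hW (v + w) (W.add_mem hv hw)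
      obtain ⟨a', b', hab'⟩ := hW (v - w) (W.sub_mem hv hw)
      -- Parallelogram identity. Inserting the quadratic equations of `v + w` and `v - w`, with
      -- linear coefficients `a` and `a'`, and using independence of `v`, `w`, 1 gives `a + a' = a -
      -- a' = 0`.
      have hsum : (v + w) * (v + w) + (v - w) * (v - w) = (2 : k) • (v * v) + (2 : k) • (w * w) := by
        simp only [add_mul, mul_add, sub_mul, mul_sub]
        module
      rw [hab, hab', hc, hd] at hsum
      obtain ⟨e1, e2⟩ := hli (a + a') (a - a') (b + b' - 2 * c - 2 * d) (by
        rw [← sub_eq_zero] at hsum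
        rw [← hsum]
        module)
      have ha : a = 0 := by
        have : 2 * a = 0 := by linear_combination e1 + e2
        exact (mul_eq_zero.1 this).resolve_left h2
      refine ⟨W.add_mem hv hw, ⟨b, by rw [hab, ha, zero_smul, zero_add]⟩, fun e he => ?_⟩
      exact absurd (hli 1 1 (-e) (by rw [one_smul, one_smul, he]; module)).1 one_ne_zero

variable (h2 : (2 : k) ≠ 0) (W : Submodule k B) (hW : ∀ x ∈ W, ∃ a b : k, x * x = a • x + b • 1)

theorem mul_mem_span_of_mem_traceless {v w : B} (hv : v ∈ traceless h2 W hW)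
    (hw : w ∈ traceless h2 W hW) : ∃ c : k, v * w = c • 1 := by
  obtain ⟨-, ⟨c, hc⟩, -⟩ := (traceless h2 W hW).add_mem hv hw
  obtain ⟨-, ⟨a, ha⟩, -⟩ := hv
  obtain ⟨-, ⟨b, hb⟩, -⟩ := hw
  refine ⟨2⁻¹ * (c - a - b), ?_⟩
  have : (2 : k) • (v * w) = (c - a - b) • 1 := by
    rw [sub_smul, sub_smul, ← hc, ← ha, ← hb]
    simp only [add_mul, mul_add, mul_comm w v]
    module
  rw [mul_smul, ← this, smul_smul, inv_mul_cancel₀ h2, one_smul]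

/-- Completing the square: half the linear coefficient is subtracted from a nonscalar `x`. -/
theorem exists_mem_traceless (h1 : 1 ∈ W) {x : B} (hx : x ∈ W) :
    ∃ v ∈ traceless h2 W hW, ∃ c : k, x = v + c • 1 := by
  by_cases hxc : ∃ c : k, x = c • 1
  · obtain ⟨c, rfl⟩ := hxc
    exact ⟨0, zero_mem _, c, (zero_add _).symm⟩
  · obtain ⟨a, b, hab⟩ := hW x hx
    have h22 : (2 : k)⁻¹ * 2 = 1 := inv_mul_cancel₀ h2
    refine ⟨x - (2⁻¹ * a) • 1, ⟨W.sub_mem hx (W.smul_mem _ h1),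
      ⟨b + (2⁻¹ * a) * (2⁻¹ * a), ?_⟩, fun c hc => ?_⟩, 2⁻¹ * a, by abel⟩
    · simp only [sub_mul, mul_sub, smul_mul_assoc, mul_smul_comm, mul_one, one_mul, hab]
      match_scalars
      · linear_combination -a * h22
      · ring
    · exact absurd ⟨c + 2⁻¹ * a, by rw [add_smul, ← hc]; abel⟩ hxc

end Traceless

/-! ### Products that are forced to be central. -/

section Quadratic

variable {k G Q B : Type*} [Field k] [CommGroup G] [CommGroup Q] [NonAssocCommRing B]
  [Module k B] [SMulCommClass k B B] [IsScalarTower k B B] [Nontrivial B]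
  {𝓑 : G → Submodule k B} [IsGrading 𝓑] {π : G →* Q}

namespace IsGradedCentral

variable (hc : IsGradedCentral 𝓑 π) (hq : IsQuadraticModulo (Center k B) B) (h2 : (2 : k) ≠ 0)

theorem functional_apply_of_mem_center {F : B →ₗ[Center k B] Center k B} (hF : F 1 = 0) {z : B}
    (hz : z ∈ Set.center B) : F z = 0 := by
  have : z = (⟨z, hz⟩ : Center k B) • (1 : B) := by rw [center_smul_def, mul_one]
  rw [this, map_smul, hF, smul_zero]

include h2 in
theorem eq_top_of_two_mem {I : Ideal (Center k B)} (h : 2 ∈ I) : I = ⊤ := by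
  refine I.eq_top_of_isUnit_mem h ?_
  have := (IsUnit.mk0 (2 : k) h2).map (algebraMap k (Center k B))
  rwa [map_ofNat] at this

include hc hq in
-- A functional detecting a noncentral `x * x` lives on the coset of `t * t`, which differs from
-- that of `t`; it kills `x` and 1, so the quadratic equation would put 1 in a proper ideal.
theorem sq_mem_center {t : G} (ht : π t ≠ 1) {x : B} (hx : x ∈ 𝓑 t) : x * x ∈ Set.center B := by
  by_contra hxx
  obtain ⟨I, hI, h⟩ := hq
  obtain ⟨a, b, hab⟩ := h x
  obtain ⟨F, hF, hF1, hF0⟩ := hc.exists_functional_eq_one (IsGrading.mul_mem hx hx) hxx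
  have := hab F
  rw [hF, hF1, hF0 t (by rwa [map_mul, ne_eq, eq_comm, mul_eq_left]) x hx, mul_zero, mul_zero, sub_zero,
    sub_zero] at this
  exact hI (I.eq_top_of_isUnit_mem this isUnit_one)

include h2 in
theorem mem_center_of_sq {x y : B} (hx : x * x ∈ Set.center B) (hy : y * y ∈ Set.center B)
    (hxy : (x + y) * (x + y) ∈ Set.center B) : x * y ∈ Set.center B := by
  have : x * y = (2 : k)⁻¹ • ((x + y) * (x + y) - x * x - y * y) := by
    have : (x + y) * (x + y) - x * x - y * y = (2 : k) • (x * y) := by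
      simp only [add_mul, mul_add, mul_comm y x]
      module
    rw [this, smul_smul, inv_mul_cancel₀ h2, one_smul]
  rw [this]
  let C := (NonUnitalSubalgebra.center k B).toSubmodule
  exact C.smul_mem _ (C.sub_mem (C.sub_mem hxy hx) hy)

include hc hq h2 in
-- Equal degrees are handled by polarization. For distinct cosets a functional detecting `x * y`
-- kills `x`, `y` and both central squares, so the equation of `x + y` leaves 2 in the ideal. Since
-- one degree per coset will be used, these alternatives are enough.
theorem mul_mem_center {t s : G} (ht : π t ≠ 1) (hs : π s ≠ 1) (hts : t = s ∨ π t ≠ π s) {x y : B}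
    (hx : x ∈ 𝓑 t) (hy : y ∈ 𝓑 s) : x * y ∈ Set.center B := by
  have hxx := hc.sq_mem_center hq ht hx
  have hyy := hc.sq_mem_center hq hs hy
  rcases hts with rfl | hts
  · exact mem_center_of_sq h2 hxx hyy (hc.sq_mem_center hq ht (add_mem hx hy))
  by_contra hxy
  obtain ⟨I, hI, h⟩ := hq
  obtain ⟨a, b, hab⟩ := h (x + y)
  obtain ⟨F, hF, hF1, hF0⟩ := hc.exists_functional_eq_one (IsGrading.mul_mem hx hy) hxy
  have := hab F
  have e : (x + y) * (x + y) = x * x + y * y + (x * y + x * y) := by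
    rw [add_mul, mul_add, mul_add, mul_comm y x]; abel
  rw [e, map_add, map_add, functional_apply_of_mem_center hF1 hxx,
    functional_apply_of_mem_center hF1 hyy, map_add, map_add, hF, hF1,
    hF0 t (by rwa [map_mul, ne_eq, eq_comm, mul_eq_left]) x hx,
    hF0 s (by rwa [map_mul, ne_eq, eq_comm, mul_eq_right]) y hy] at this
  refine hI (eq_top_of_two_mem h2 ?_)
  convert this using 1
  ring

include hc hq in
-- Were 1, `x`, `x * x` independent, the functional dual to `x * x`, extended over the center, would
-- put 1 in the ideal.
theorem sq_mem_span {x : B} (hx : x ∈ 𝓑 1) : ∃ a b : k, x * x = a • x + b • 1 := by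
  refine sq_mem_span_of_not_linearIndependent fun hli => ?_
  obtain ⟨I, hI, h⟩ := hq
  obtain ⟨a, b, hab⟩ := h x
  obtain ⟨f, hf⟩ := exists_dual_family hli
  obtain ⟨F, hF, -⟩ := hc.exists_functional 1 (f 2)
  have hxx : x * x ∈ 𝓑 1 := by simpa using IsGrading.mul_mem hx hx
  have h0 : f 2 1 = 0 := by simpa using hf 2 0
  have h1 : f 2 x = 0 := by simpa using hf 2 1
  have h2 : f 2 (x * x) = 1 := by simpa using hf 2 2
  have := hab F
  rw [hF _ hxx, hF _ hx, hF _ (IsGrading.one_mem 𝓑), h0, h1, h2] at this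
  refine hI (I.eq_top_of_isUnit_mem this ?_)
  simp

include hc in
theorem exists_smul_one_of_mem_center {z : B} (hz : z ∈ Set.center B) (hz1 : z ∈ 𝓑 1) :
    ∃ c : k, z = c • 1 := by
  obtain ⟨c, h⟩ := hc.exists_algebraMap ⟨z, hz⟩ hz1
  refine ⟨c, ?_⟩
  rw [Algebra.algebraMap_eq_smul_one] at h
  exact congrArg Subtype.val h

theorem smul_one_mem_center (c : k) : c • (1 : B) ∈ Set.center B :=
  (NonUnitalSubalgebra.center k B).toSubmodule.smul_mem c (Set.one_mem_center (M := B))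

include hc hq h2 in
-- The equation of `x + y` is tested twice: a functional detecting `x` puts its linear coefficient
-- in the ideal, and then one detecting `x * y` leaves 2 there.
theorem mul_mem_center_of_sq_mem_center {t : G} (ht : π t ≠ 1) {x y : B} (hx : x ∈ 𝓑 1)
    (hy : y ∈ 𝓑 t) (hxx : x * x ∈ Set.center B) (hx0 : x ∈ Set.center B → x = 0) :
    x * y ∈ Set.center B := by
  have hyy := hc.sq_mem_center hq ht hy
  by_cases hxz : x = 0
  · rw [hxz, zero_mul]; exact Set.zero_mem_center
  by_contra hxy
  obtain ⟨I, hI, h⟩ := hq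
  obtain ⟨a, b, hab⟩ := h (x + y)
  have hxyt : x * y ∈ 𝓑 t := by simpa using IsGrading.mul_mem hx hy
  have ht' : π t ≠ π 1 := by rwa [map_one]
  have e : (x + y) * (x + y) = x * x + y * y + (x * y + x * y) := by
    rw [add_mul, mul_add, mul_add, mul_comm y x]; abel
  have ha : a ∈ I := by
    obtain ⟨F, hF, hF1, hF0⟩ := hc.exists_functional_eq_one hx fun h => hxz (hx0 h)
    have := hab F
    rw [e, map_add, map_add, functional_apply_of_mem_center hF1 hxx,
      functional_apply_of_mem_center hF1 hyy, map_add, map_add, hF, hF1, hF0 t ht' y hy,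
      hF0 t ht' _ hxyt] at this
    rw [← neg_mem_iff]
    convert this using 1
    ring
  obtain ⟨F, hF, hF1, hF0⟩ := hc.exists_functional_eq_one hxyt hxy
  have := hab F
  rw [e, map_add, map_add, functional_apply_of_mem_center hF1 hxx,
    functional_apply_of_mem_center hF1 hyy, map_add, map_add, hF, hF1, hF0 1 ht'.symm x hx] at this
  refine hI (eq_top_of_two_mem h2 ?_)
  have h3 := I.add_mem this (I.mul_mem_right (F y) ha)
  convert h3 using 1
  ring

end IsGradedCentral

/-- A family of complements to the center in the components of degrees `τ q`, where `τ` is a section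
of `π`, with products in the center. -/
structure IsTracelessFamily (𝓑 : G → Submodule k B) (π : G →* Q) (τ : Q → G)
    (V : Q → Submodule k B) : Prop where
  apply_section : ∀ q, π (τ q) = q
  section_one : τ 1 = 1
  le : ∀ q, V q ≤ 𝓑 (τ q)
  one_notMem : ∀ q, 1 ∉ V q
  le_sup : ∀ q, ∀ x ∈ 𝓑 (τ q), ∃ v ∈ V q, ∃ c : k, x = v + c • 1
  mul_mem : ∀ q r, ∀ x ∈ V q, ∀ y ∈ V r, x * y ∈ Set.center B

theorem IsGradedCentral.exists_isTracelessFamily (hc : IsGradedCentral 𝓑 π)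
    (hq : IsQuadraticModulo (Center k B) B) (h2 : (2 : k) ≠ 0) :
    ∃ τ V, IsTracelessFamily 𝓑 π τ V := by
  classical
  let σ := Function.surjInv hc.surjective
  have hσ : ∀ q, π (σ q) = q := Function.surjInv_eq hc.surjective
  let τ : Q → G := fun q => if q = 1 then 1 else σ q
  have hτ1 : τ 1 = 1 := if_pos rfl
  have hτ : ∀ q, π (τ q) = q := fun q => by
    by_cases h : q = 1
    · rw [h, hτ1, map_one]
    · rw [show τ q = σ q from if_neg h, hσ]
  have hW : ∀ x ∈ 𝓑 1, ∃ a b : k, x * x = a • x + b • 1 := fun x hx => hc.sq_mem_span hq hx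
  -- Outside the trivial coset the center has no nonzero component, so nothing needs to be split
  -- off.
  let V : Q → Submodule k B := fun q => if q = 1 then traceless h2 (𝓑 1) hW else 𝓑 (τ q)
  have hV1 : V 1 = traceless h2 (𝓑 1) hW := if_pos rfl
  have hV : ∀ q, q ≠ 1 → V q = 𝓑 (τ q) := fun q hq => if_neg hq
  have hmul1 : ∀ q, q ≠ 1 → ∀ x ∈ V 1, ∀ y ∈ V q, x * y ∈ Set.center B := by
    intro q hq1 x hx y hy
    rw [hV1] at hx
    rw [hV q hq1] at hy
    obtain ⟨hx1, ⟨c, hx2⟩, hx3⟩ := hx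
    refine hc.mul_mem_center_of_sq_mem_center hq h2 (by rwa [hτ]) hx1 hy
      (hx2 ▸ smul_one_mem_center c) fun hxc => ?_
    obtain ⟨d, hd⟩ := hc.exists_smul_one_of_mem_center hxc hx1
    exact hx3 d hd
  refine ⟨τ, V, hτ, hτ1, fun q => ?_, fun q h1 => ?_, fun q x hx => ?_, fun q r x hx y hy => ?_⟩
  · by_cases h : q = 1
    · rw [h, hV1, hτ1]
      exact fun x hx => hx.1
    · rw [hV q h]
  · by_cases h : q = 1
    · rw [h, hV1] at h1
      exact one_ne_zero (h1.2.2 1 (one_smul k 1).symm)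
    · rw [hV q h] at h1
      refine one_ne_zero (α := B) (IsGrading.eq_zero_of_mem_of_mem h1 (IsGrading.one_mem 𝓑) ?_)
      intro h3
      rw [← hτ q, h3, map_one] at h
      exact h rfl
  · by_cases h : q = 1
    · rw [h, hτ1] at hx
      rw [h, hV1]
      exact exists_mem_traceless h2 _ hW (IsGrading.one_mem 𝓑) hx
    · exact ⟨x, by rwa [hV q h], 0, by simp⟩
  · by_cases hq1 : q = 1
    · by_cases hr1 : r = 1
      · rw [hq1, hV1] at hx
        rw [hr1, hV1] at hy
        obtain ⟨c, hxy⟩ := mul_mem_span_of_mem_traceless h2 _ hW hx hy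
        exact hxy ▸ smul_one_mem_center c
      · exact hmul1 r hr1 x (hq1 ▸ hx) y hy
    · by_cases hr1 : r = 1
      · rw [mul_comm]
        exact hmul1 q hq1 y (hr1 ▸ hy) x hx
      · rw [hV q hq1] at hx
        rw [hV r hr1] at hy
        refine hc.mul_mem_center hq h2 (by rwa [hτ]) (by rwa [hτ]) ?_ hx hy
        by_cases hqr : q = r
        · exact Or.inl (hqr ▸ rfl)
        · right
          rwa [hτ, hτ]

end Quadratic

section Trace

variable {k B : Type*} [CommRing k] [NonAssocCommRing B] [Module k B] [SMulCommClass k B B]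
  [IsScalarTower k B B]

theorem eq_apply_smul_one_of_mem_center {T : B →ₗ[Center k B] Center k B} (hT1 : T 1 = 1) {z : B}
    (hz : z ∈ Set.center B) : z = T z • (1 : B) := by
  have h : z = (⟨z, hz⟩ : Center k B) • (1 : B) := by rw [center_smul_def, mul_one]
  have : T z = ⟨z, hz⟩ := by
    conv_lhs => rw [h]
    rw [map_smul, hT1, smul_eq_mul, mul_one]
  rw [this]
  exact h

end Trace

/-! ### Trace, nondegeneracy and coordinates over the center. -/

section Coordinates

variable {k G Q B : Type*} [Field k] [CommGroup G] [CommGroup Q] [NonAssocCommRing B]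
  [Module k B] [SMulCommClass k B B] [IsScalarTower k B B] [Nontrivial B]
  {𝓑 : G → Submodule k B} [IsGrading 𝓑] {π : G →* Q} {τ : Q → G} {V : Q → Submodule k B}

namespace IsTracelessFamily

variable (hc : IsGradedCentral 𝓑 π) (hT : IsTracelessFamily 𝓑 π τ V)
include hc hT

/-- A central unit carries any homogeneous element to the chosen degree in its coset, where it is a
sum of a traceless element and a scalar. So 1 and the family generate `B` over the center. -/
theorem eq_top_of_le {N : Submodule (Center k B) B} (h1 : 1 ∈ N) (hV : ∀ q, ∀ v ∈ V q, v ∈ N)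
    (x : B) : x ∈ N := by
  revert x
  refine IsGrading.induction 𝓑 (zero_mem _) (fun g x hx => ?_) fun x y => N.add_mem
  obtain ⟨u, hu, v, hv, huv⟩ := hc.exists_unit (g * (τ (π g))⁻¹)
  replace huv := huv (by rw [map_mul, map_inv, hT.apply_section, mul_inv_cancel])
  have hvx : v • x ∈ 𝓑 (τ (π g)) := by
    have := IsGrading.mul_mem (𝓐 := 𝓑) hv hx
    rwa [mul_inv, inv_inv, mul_comm g⁻¹, inv_mul_cancel_right] at this
  obtain ⟨w, hw, c, hwc⟩ := hT.le_sup _ _ hvx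
  have : x = u • (w + algebraMap k (Center k B) c • (1 : B)) := by
    rw [algebraMap_smul, ← hwc, smul_smul, huv, one_smul]
  rw [this]
  exact N.smul_mem _ (N.add_mem (hV _ _ hw) (N.smul_mem _ h1))

/-- The graded `L`-linear projection onto the center along the traceless part. -/
theorem exists_trace : ∃ T : B →ₗ[Center k B] Center k B, T 1 = 1 ∧
    (∀ q, ∀ v ∈ V q, T v = 0) ∧ ∀ g, ∀ x ∈ 𝓑 g, T x ∈ centerGrading 𝓑 g := by
  obtain ⟨f, hf1, hf⟩ : ∃ f : B →ₗ[k] k, f 1 = 1 ∧ ∀ v ∈ V 1, f v = 0 := by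
    obtain ⟨f, hf1, hf⟩ := Submodule.exists_le_ker_of_notMem (hT.one_notMem 1)
    refine ⟨(f 1)⁻¹ • f, by simp [inv_mul_cancel₀ hf1], fun v hv => ?_⟩
    rw [LinearMap.smul_apply, LinearMap.mem_ker.1 (hf hv), smul_zero]
  obtain ⟨T, hT1, hT2⟩ := hc.exists_functional 1 f
  simp only [inv_one, mul_one] at hT2
  refine ⟨T, ?_, fun q v hv => ?_, hT2⟩
  · rw [hT1 1 (IsGrading.one_mem 𝓑), hf1, map_one]
  · by_cases hq : q = 1
    · subst hq
      rw [hT1 v (hT.section_one ▸ hT.le 1 hv), hf v hv, map_zero]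
    · exact hc.eq_zero_of_mem (by rwa [hT.apply_section]) (hT2 _ v (hT.le q hv))

/-- The product is central, and its degree is outside the support of the center. -/
theorem mul_eq_zero_of_ne {q r : Q} (hqr : q * r ≠ 1) {x y : B} (hx : x ∈ V q) (hy : y ∈ V r) :
    x * y = 0 := by
  have h := hc.eq_zero_of_mem (g := τ q * τ r) (u := ⟨x * y, hT.mul_mem q r x hx y hy⟩)
    (by rwa [map_mul, hT.apply_section, hT.apply_section])
    (IsGrading.mul_mem (hT.le q hx) (hT.le r hy))
  exact congrArg Subtype.val h

/-- If the algebra is graded-simple, then the form on its traceless part is nondegenerate. -/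
theorem exists_mul_ne_zero (hs : IsGradedSimple 𝓑) {q : Q} {v : B} (hv : v ∈ V q) (hv0 : v ≠ 0) :
    ∃ w ∈ V q⁻¹, v * w ≠ 0 := by
  -- Otherwise `v` is killed by every `V r`, and its span over the center is a nonzero graded ideal.
  -- The trace vanishes on this ideal but not at 1, contradicting simplicity.
  by_contra! h
  have hmul : ∀ r, ∀ w ∈ V r, w * v = 0 := by
    intro r w hw
    by_cases hr : q * r = 1
    · rw [mul_comm]
      exact h w (eq_inv_of_mul_eq_one_right hr ▸ hw)
    · rw [mul_comm]
      exact mul_eq_zero_of_ne hc hT hr hv hw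
  let N : Submodule (Center k B) B := Submodule.span _ {v}
  have hN : ∀ a x : B, x ∈ N → a * x ∈ N := by
    intro a x hx
    obtain ⟨z, rfl⟩ := Submodule.mem_span_singleton.1 hx
    rw [mul_smul_comm]
    refine N.smul_mem _ ?_
    refine eq_top_of_le hc hT (N := N.comap (LinearMap.mulRight (Center k B) v)) ?_ ?_ a
    · rw [Submodule.mem_comap, LinearMap.mulRight_apply, one_mul]
      exact Submodule.mem_span_singleton_self v
    · intro r w hw
      rw [Submodule.mem_comap, LinearMap.mulRight_apply, hmul r w hw]
      exact zero_mem _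
  have htop := (hs.2 (N.restrictScalars k) (fun x hx a => ⟨hN a x hx, mul_comm x a ▸ hN a x hx⟩)
    ?_).resolve_left ?_
  · have h1 : (1 : B) ∈ N.restrictScalars k := htop ▸ Submodule.mem_top
    obtain ⟨z, hz⟩ := Submodule.mem_span_singleton.1 (show (1 : B) ∈ N from h1)
    obtain ⟨T, hT1, hT2, -⟩ := exists_trace hc hT
    have := congrArg T hz
    rw [map_smul, hT2 q v hv, smul_zero, hT1] at this
    exact zero_ne_one (congrArg Subtype.val this)
  · refine le_antisymm (fun x hx => ?_) (iSup_le fun _ => inf_le_left)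
    obtain ⟨z, rfl⟩ := Submodule.mem_span_singleton.1 (show x ∈ N from hx)
    revert z
    refine IsGrading.induction (centerGrading 𝓑) (fun _ => by rw [zero_smul]; exact zero_mem _)
      (fun g z hz hx => ?_) fun z w hz hw hzw => ?_
    · exact Submodule.mem_iSup_of_mem (g * τ q) ⟨hx, IsGrading.mul_mem (𝓐 := 𝓑) hz (hT.le q hv)⟩
    · rw [add_smul]
      exact add_mem (hz (N.smul_mem _ (Submodule.mem_span_singleton_self v)))
        (hw (N.smul_mem _ (Submodule.mem_span_singleton_self v)))
  · intro h0
    have : v ∈ N.restrictScalars k := Submodule.mem_span_singleton_self v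
    rw [h0] at this
    exact hv0 this

/-- The `L`-linear coordinates with respect to bases of the traceless family. -/
theorem exists_coordinates {κ : Q → ℕ} {e : (Σ q, Fin (κ q)) → B}
    (he : ∀ q, LinearIndependent k fun i => e ⟨q, i⟩)
    (hspan : ∀ q, Submodule.span k (Set.range fun i => e ⟨q, i⟩) = V q) :
    ∃ C : (Σ q, Fin (κ q)) → B →ₗ[Center k B] Center k B, (∀ a, C a 1 = 0) ∧
      (∀ a c, C a (e c) = open Classical in if a = c then 1 else 0) ∧
      ∀ a g, ∀ x ∈ 𝓑 g, C a x ∈ centerGrading 𝓑 (g * (τ a.1)⁻¹) := by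
  classical
  have heV : ∀ c, e c ∈ V c.1 := fun c => hspan c.1 ▸ Submodule.subset_span ⟨c.2, rfl⟩
  have key : ∀ a : Σ q, Fin (κ q), ∃ F : B →ₗ[Center k B] Center k B, F 1 = 0 ∧
      (∀ c, F (e c) = if a = c then 1 else 0) ∧
      ∀ g, ∀ x ∈ 𝓑 g, F x ∈ centerGrading 𝓑 (g * (τ a.1)⁻¹) := by
    rintro ⟨q, i⟩
    -- Adjoining 1 to the basis makes the dual functional vanish at 1, which matters when `q = 1`.
    have hli := (he q).option (x := 1) (by rw [hspan]; exact hT.one_notMem q)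
    obtain ⟨f, hf⟩ := exists_dual_family hli
    obtain ⟨F, hF1, hF2⟩ := hc.exists_functional (τ q) (f (some i))
    refine ⟨F, ?_, ?_, hF2⟩
    · by_cases hq : q = 1
      · subst hq
        rw [hF1 1 (by rw [hT.section_one]; exact IsGrading.one_mem 𝓑)]
        have := hf (some i) none
        simp only [Option.casesOn'_none] at this
        rw [this]
        simp
      · refine hc.eq_zero_of_mem ?_ (hF2 1 1 (IsGrading.one_mem 𝓑))
        rwa [one_mul, map_inv, hT.apply_section, ne_eq, inv_eq_one]
    · rintro ⟨r, j⟩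
      by_cases hqr : q = r
      · subst hqr
        rw [hF1 _ (hT.le _ (heV ⟨q, j⟩))]
        have := hf (some i) (some j)
        simp only [Option.casesOn'_some] at this
        rw [this]
        by_cases hij : i = j <;> simp [hij]
      · rw [if_neg (fun h => hqr (congrArg Sigma.fst h))]
        refine hc.eq_zero_of_mem ?_ (hF2 _ _ (hT.le _ (heV _)))
        rw [map_mul, map_inv, hT.apply_section, hT.apply_section, ne_eq, mul_inv_eq_one]
        exact Ne.symm hqr
  choose C hC using key
  exact ⟨C, fun a => (hC a).1, fun a c => ((hC a).2.1 c).trans (by congr), fun a => (hC a).2.2⟩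

theorem eq_trace_add_sum {κ : Q → ℕ} [Fintype (Σ q, Fin (κ q))] {e : (Σ q, Fin (κ q)) → B}
    (hspan : ∀ q, Submodule.span k (Set.range fun i => e ⟨q, i⟩) = V q)
    {T : B →ₗ[Center k B] Center k B} (hT1 : T 1 = 1) (hTV : ∀ q, ∀ v ∈ V q, T v = 0)
    {C : (Σ q, Fin (κ q)) → B →ₗ[Center k B] Center k B} (hC1 : ∀ a, C a 1 = 0)
    (hC : ∀ a c, C a (e c) = open Classical in if a = c then 1 else 0) (x : B) :
    x = T x • (1 : B) + ∑ a, C a x • e a := by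
  classical
  let P : B →ₗ[Center k B] B := T.smulRight 1 + ∑ a, (C a).smulRight (e a)
  have hP : ∀ x, P x = T x • (1 : B) + ∑ a, C a x • e a := fun x => by simp [P]
  have hmem : x ∈ LinearMap.eqLocus P LinearMap.id := by
    refine eq_top_of_le hc hT ?_ ?_ x
    · rw [LinearMap.mem_eqLocus, hP]
      simp [hT1, hC1]
    · intro q v hv
      have hle : V q ≤ (LinearMap.eqLocus P LinearMap.id).restrictScalars k := by
        rw [← hspan, Submodule.span_le]
        rintro _ ⟨i, rfl⟩
        change P _ = _
        rw [hP, hTV q _ (hspan q ▸ Submodule.subset_span ⟨i, rfl⟩)]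
        simp [hC]
      exact hle hv
  rw [LinearMap.mem_eqLocus, hP] at hmem
  exact hmem.symm

end IsTracelessFamily

end Coordinates

/-! ### Normal forms of the pairings. -/

section NormalForms

variable {k W : Type*} [Field k] [AddCommGroup W] [Module k W] [FiniteDimensional k W]

/-- A nondegenerate symmetric bilinear form has an orthogonal basis whose values lie in a set of
representatives of the square classes. -/
theorem exists_orthogonal_basis_mem (h2 : (2 : k) ≠ 0) {A : Set k}
    (hA : ∀ d : k, d ≠ 0 → ∃ r ≠ 0, r * r * d ∈ A) (β : LinearMap.BilinForm k W)
    (hβ : ∀ x y, β x y = β y x) (hnd : ∀ x, (∀ y, β x y = 0) → x = 0) :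
    ∃ b : Module.Basis (Fin (Module.finrank k W)) k W,
      (∀ i j, i ≠ j → β (b i) (b j) = 0) ∧ ∀ i, β (b i) (b i) ∈ A := by
  have : Invertible (2 : k) := invertibleOfNonzero h2
  obtain ⟨v, hv⟩ := LinearMap.BilinForm.exists_orthogonal_basis (B := β) ⟨fun x y => hβ x y⟩
  have hv' : ∀ i j, i ≠ j → β (v i) (v j) = 0 := fun i j hij => hv hij
  have hvi : ∀ i, β (v i) (v i) ≠ 0 := by
    intro i h0
    refine v.ne_zero i (hnd _ fun y => ?_)
    have : β (v i) = 0 := v.ext fun j => by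
      by_cases hij : i = j
      · rw [← hij, h0, LinearMap.zero_apply]
      · rw [hv' i j hij, LinearMap.zero_apply]
    rw [this, LinearMap.zero_apply]
  choose r hr hrA using fun i => hA _ (hvi i)
  refine ⟨v.isUnitSMul fun i => (hr i).isUnit, fun i j hij => ?_, fun i => ?_⟩
  · rw [Module.Basis.isUnitSMul_apply, Module.Basis.isUnitSMul_apply, map_smul, LinearMap.map_smul₂,
      hv' i j hij, smul_zero, smul_zero]
  · rw [Module.Basis.isUnitSMul_apply, map_smul, LinearMap.map_smul₂, smul_smul]
    exact hrA i

/-- A property of patterns `ε` of diagonal entries such that every nondegenerate symmetric bilinear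
form is diagonalized with one of these patterns. -/
def HasDiagonalForms (k : Type*) [Field k] (W : Type*) [AddCommGroup W] [Module k W]
    (P : ℕ → (ℕ → k) → Prop) : Prop :=
  ∀ β : LinearMap.BilinForm k W, (∀ x y, β x y = β y x) → (∀ x, (∀ y, β x y = 0) → x = 0) →
    ∃ (ε : ℕ → k) (b : Module.Basis (Fin (Module.finrank k W)) k W), P (Module.finrank k W) ε ∧
      ∀ i j, β (b i) (b j) = if j = i then ε i else 0

theorem hasDiagonalForms_complex (W : Type*) [AddCommGroup W] [Module ℂ W]
    [FiniteDimensional ℂ W] : HasDiagonalForms ℂ W fun _ ε => ε = fun _ => 1 := by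
  intro β hβ hnd
  obtain ⟨b, hb, hb1⟩ := exists_orthogonal_basis_mem two_ne_zero (A := {1}) (fun d hd => by
    obtain ⟨r, hr⟩ := IsAlgClosed.exists_pow_nat_eq d⁻¹ (n := 2) two_pos
    refine ⟨r, ?_, ?_⟩
    · rintro rfl
      rw [zero_pow two_ne_zero, eq_comm, inv_eq_zero] at hr
      exact hd hr
    · rw [← sq, hr, inv_mul_cancel₀ hd]
      rfl) β hβ hnd
  refine ⟨_, b, rfl, fun i j => ?_⟩
  split_ifs with h
  · rw [h]
    exact hb1 i
  · exact hb i j (Ne.symm h)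

theorem hasDiagonalForms_real (W : Type*) [AddCommGroup W] [Module ℝ W]
    [FiniteDimensional ℝ W] :
    HasDiagonalForms ℝ W fun n ε => ∃ p ≤ n, ε = fun i => if i < p then 1 else -1 := by
  classical
  intro β hβ hnd
  obtain ⟨b, hb, hb1⟩ := exists_orthogonal_basis_mem two_ne_zero (A := {1, -1}) (fun d hd => by
    refine ⟨(Real.sqrt |d|)⁻¹, inv_ne_zero (Real.sqrt_ne_zero'.2 (abs_pos.2 hd)), ?_⟩
    rw [← mul_inv, Real.mul_self_sqrt (abs_nonneg d)]
    rcases lt_or_gt_of_ne hd with h | h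
    · right
      rw [abs_of_neg h]
      field_simp
      rfl
    · left
      rw [abs_of_pos h, inv_mul_cancel₀ hd]) β hβ hnd
  -- The basis is reindexed so that its `p` positive vectors come first.
  let p := Fintype.card {i : Fin (Module.finrank ℝ W) // β (b i) (b i) = 1}
  have hp : p ≤ Module.finrank ℝ W := by
    simpa using Fintype.card_subtype_le fun i : Fin (Module.finrank ℝ W) => β (b i) (b i) = 1
  have hcard : Fintype.card {i : Fin (Module.finrank ℝ W) // (i : ℕ) < p} = p := by
    rw [Fintype.card_subtype, Fin.card_filter_val_lt, min_eq_right hp]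
  let e : {i : Fin (Module.finrank ℝ W) // (i : ℕ) < p} ≃ {i : Fin (Module.finrank ℝ W) // β (b i) (b i) = 1} :=
    Fintype.equivOfCardEq hcard
  refine ⟨_, b.reindex e.extendSubtype.symm, ⟨p, hp, rfl⟩, fun i j => ?_⟩
  rw [Module.Basis.reindex_apply, Module.Basis.reindex_apply, Equiv.symm_symm]
  split_ifs with h h1
  · rw [h]
    exact e.extendSubtype_mem i h1
  · rw [h]
    exact (hb1 _).resolve_left (e.extendSubtype_not_mem i h1)
  · exact hb _ _ fun h' => h (e.extendSubtype.injective h'.symm)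

end NormalForms

/-- Choice of values compatible with an involution. -/
theorem exists_compatible_choice {Q X : Type*} {ι : Q → Q} (hι : Function.Involutive ι)
    {R : Q → X → X → Prop} (hsymm : ∀ q a b, R q a b → R (ι q) b a)
    (hfix : ∀ q, ι q = q → ∃ a, R q a a) (hne : ∀ q, ι q ≠ q → ∃ a b, R q a b) :
    ∃ F : Q → X, ∀ q, R q (F q) (F (ι q)) := by
  classical
  -- Any linear order serves: the smaller member of each orbit carries the choice, and the larger
  -- takes the second entry of the same pair.
  let _ : LinearOrder Q := IsWellOrder.linearOrder WellOrderingRel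
  have hex : ∀ q, ∃ p : X × X, R q p.1 p.2 ∧ (ι q = q → p.1 = p.2) := by
    intro q
    by_cases hq : ι q = q
    · obtain ⟨a, ha⟩ := hfix q hq
      exact ⟨(a, a), ha, fun _ => rfl⟩
    · obtain ⟨a, b, hab⟩ := hne q hq
      exact ⟨(a, b), hab, fun h => absurd h hq⟩
  choose p hp hp' using hex
  refine ⟨fun q => if q ≤ ι q then (p q).1 else (p (ι q)).2, fun q => ?_⟩
  rcases lt_trichotomy q (ι q) with h | h | h
  · simp only [hι q]
    rw [if_pos h.le, if_neg (not_le.2 h)]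
    exact hp q
  · beta_reduce
    rw [← h, if_pos le_rfl, if_pos h.le]
    have := hp q
    rwa [← hp' q h.symm] at this
  · simp only [hι q]
    rw [if_pos h.le, if_neg (not_le.2 h)]
    have := hsymm _ _ _ (hp (ι q))
    rwa [hι q] at this

section DualBases

variable {k W W' : Type*} [Field k] [AddCommGroup W] [Module k W] [FiniteDimensional k W]
  [AddCommGroup W'] [Module k W'] [FiniteDimensional k W']

theorem finrank_eq_of_nondegenerate (β : W →ₗ[k] W' →ₗ[k] k) (h1 : ∀ x, (∀ y, β x y = 0) → x = 0)
    (h2 : ∀ y, (∀ x, β x y = 0) → y = 0) : Module.finrank k W = Module.finrank k W' := by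
  refine le_antisymm ?_ ?_
  · rw [← Subspace.dual_finrank_eq (K := k) (V := W')]
    refine LinearMap.finrank_le_finrank_of_injective (f := β) ?_
    refine (injective_iff_map_eq_zero β).2 fun x hx => h1 x fun y => ?_
    rw [hx, LinearMap.zero_apply]
  · rw [← Subspace.dual_finrank_eq (K := k) (V := W)]
    refine LinearMap.finrank_le_finrank_of_injective (f := β.flip) ?_
    refine (injective_iff_map_eq_zero β.flip).2 fun y hy => h2 y fun x => ?_
    rw [← β.flip_apply, hy, LinearMap.zero_apply]

theorem exists_dual_bases (β : W →ₗ[k] W' →ₗ[k] k) (h1 : ∀ x, (∀ y, β x y = 0) → x = 0)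
    (h2 : ∀ y, (∀ x, β x y = 0) → y = 0) :
    ∃ (b : Module.Basis (Fin (Module.finrank k W)) k W)
      (b' : Module.Basis (Fin (Module.finrank k W')) k W'),
      ∀ i j, β (b i) (b' j) = if (j : ℕ) = i then 1 else 0 := by
  have hf := finrank_eq_of_nondegenerate β h1 h2
  have hinj : Function.Injective β := (injective_iff_map_eq_zero β).2 fun x hx => h1 x fun y => by
    rw [hx, LinearMap.zero_apply]
  let e : W ≃ₗ[k] Module.Dual k W' := LinearEquiv.ofInjectiveOfFinrankEq β hinj
    (hf.trans (Subspace.dual_finrank_eq).symm)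
  let b' := Module.finBasis k W'
  refine ⟨(b'.dualBasis.map e.symm).reindex (finCongr hf.symm), b', fun i j => ?_⟩
  have : ∀ x, β x = e x := fun x => rfl
  rw [this, Module.Basis.reindex_apply, Module.Basis.map_apply, LinearEquiv.apply_symm_apply,
    Module.Basis.dualBasis_apply_self]
  congr 1
  simp [Fin.ext_iff]

end DualBases

namespace IsTracelessFamily

variable {k G Q B : Type*} [Field k] [CommGroup G] [CommGroup Q] [NonAssocCommRing B]
  [Module k B] [SMulCommClass k B B] [IsScalarTower k B B] [Nontrivial B]
  {𝓑 : G → Submodule k B} [IsGrading 𝓑] {π : G →* Q} {τ : Q → G} {V : Q → Submodule k B}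
  (hc : IsGradedCentral 𝓑 π) (hT : IsTracelessFamily 𝓑 π τ V)
  {T : B →ₗ[Center k B] Center k B} {u : Q → Center k B}

include hc in
-- Dividing by `u` lands in degree one, which is `k`; so the component is the line through `u`.
theorem _root_.GradedJordan.IsGradedCentral.exists_coordinate {g : G} {u : Center k B}
    (hu : u ∈ centerGrading 𝓑 g) (hu0 : u ≠ 0) :
    ∃ ρ : Center k B →ₗ[k] k, ∀ z ∈ centerGrading 𝓑 g, z = ρ z • u := by
  obtain ⟨v, hv, huv⟩ := hc.exists_inv hu hu0
  obtain ⟨f, hf⟩ := exists_dual_family (F := k) (v := ![u])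
    (LinearIndependent.of_subsingleton 0 hu0)
  refine ⟨f 0, fun z hz => ?_⟩
  obtain ⟨c, hzc⟩ := hc.exists_algebraMap (z * v) (by
    have := IsGrading.mul_mem hz hv
    rwa [mul_inv_cancel] at this)
  have hz : z = c • u := by
    rw [Algebra.smul_def, ← hzc, mul_assoc, mul_comm v, huv, mul_one]
  have h1 : f 0 u = 1 := by simpa using hf 0 0
  rw [hz, map_smul, h1, smul_eq_mul, mul_one]

include hc hT in
-- The traces of these products lie on the line through `u`, and a central product is determined by
-- its trace, so nondegeneracy is inherited from `exists_mul_ne_zero` on either side.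
theorem exists_pairing (hs : IsGradedSimple 𝓑) (hT1 : T 1 = 1)
    (hTg : ∀ g, ∀ x ∈ 𝓑 g, T x ∈ centerGrading 𝓑 g) {q r : Q} (hqr : r = q⁻¹)
    {u : Center k B} (hu : u ∈ centerGrading 𝓑 (τ q * τ r)) (hu0 : u ≠ 0) :
    ∃ β : V q →ₗ[k] V r →ₗ[k] k, (∀ (x : V q) (y : V r), T ((x : B) * y) = β x y • u) ∧
      (∀ x, (∀ y, β x y = 0) → x = 0) ∧ ∀ y, (∀ x, β x y = 0) → y = 0 := by
  obtain ⟨ρ, hρ⟩ := hc.exists_coordinate hu hu0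
  let β : V q →ₗ[k] V r →ₗ[k] k := LinearMap.mk₂ k (fun x y => ρ (T ((x : B) * y)))
    (fun x x' y => by rw [Submodule.coe_add, add_mul, map_add, map_add])
    (fun c x y => by rw [Submodule.coe_smul, smul_mul_assoc, LinearMap.map_smul_of_tower, map_smul])
    (fun x y y' => by rw [Submodule.coe_add, mul_add, map_add, map_add])
    (fun c x y => by rw [Submodule.coe_smul, mul_smul_comm, LinearMap.map_smul_of_tower, map_smul])
  have hβ : ∀ (x : V q) (y : V r), T ((x : B) * y) = β x y • u := fun x y =>
    hρ _ (hTg _ _ (IsGrading.mul_mem (hT.le q x.2) (hT.le r y.2)))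
  have hβ0 : ∀ (x : V q) (y : V r), β x y = 0 → (x : B) * y = 0 := fun x y h0 => by
    rw [eq_apply_smul_one_of_mem_center hT1 (hT.mul_mem q r x x.2 y y.2), hβ, h0, zero_smul, zero_smul]
  refine ⟨β, hβ, fun x hx => ?_, fun y hy => ?_⟩
  · by_contra hx0
    obtain ⟨w, hw, hxw⟩ := exists_mul_ne_zero hc hT hs x.2 fun h => hx0 (Subtype.ext h)
    exact hxw (hβ0 x ⟨w, hqr ▸ hw⟩ (hx _))
  · by_contra hy0
    obtain ⟨w, hw, hyw⟩ := exists_mul_ne_zero hc hT hs y.2 fun h => hy0 (Subtype.ext h)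
    have hw' : w ∈ V q := by rwa [hqr, inv_inv] at hw
    rw [mul_comm] at hyw
    exact hyw (hβ0 ⟨w, hw'⟩ y (hy _))

theorem exists_nat_family {n : ℕ} {W : Submodule k B} (b : Module.Basis (Fin n) k W) :
    ∃ e : ℕ → B, (∀ i : Fin n, e i = b i) ∧ LinearIndependent k (fun i : Fin n => e i) ∧
      Submodule.span k (Set.range fun i : Fin n => e i) = W := by
  let e : ℕ → B := fun i => if h : i < n then b ⟨i, h⟩ else 0
  have he : ∀ i : Fin n, e i = b i := fun i => dif_pos i.2
  have he' : (fun i : Fin n => e i) = W.subtype ∘ b := funext he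
  refine ⟨e, he, ?_, ?_⟩
  · rw [he']
    exact b.linearIndependent.map' _ W.ker_subtype
  · rw [he', Set.range_comp, Submodule.span_image, b.span_eq, Submodule.map_subtype_top]

/-- Bases of the components of the traceless family in which the form is normalized. -/
theorem exists_bases [FiniteDimensional k B] (hc : IsGradedCentral 𝓑 π)
    (hT : IsTracelessFamily 𝓑 π τ V) (hs : IsGradedSimple 𝓑)
    (hT1 : T 1 = 1) (hTg : ∀ g, ∀ x ∈ 𝓑 g, T x ∈ centerGrading 𝓑 g)
    (hu : ∀ q, u q ∈ centerGrading 𝓑 (τ q * τ q⁻¹)) (hu0 : ∀ q, u q ≠ 0)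
    (husymm : ∀ q, u q⁻¹ = u q) {P : ℕ → (ℕ → k) → Prop}
    (hP : ∀ q, HasDiagonalForms k (V q) P) :
    ∃ (ε : Q → ℕ → k) (e : Q → ℕ → B),
      (∀ q, LinearIndependent k fun i : Fin (Module.finrank k (V q)) => e q i) ∧
      (∀ q, Submodule.span k (Set.range fun i : Fin (Module.finrank k (V q)) => e q i) = V q) ∧
      (∀ q, q⁻¹ = q → P (Module.finrank k (V q)) (ε q)) ∧
      (∀ q, q⁻¹ ≠ q → ε q = fun _ => 1) ∧
      (∀ q, Module.finrank k (V q⁻¹) = Module.finrank k (V q)) ∧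
      ∀ q, ∀ i < Module.finrank k (V q), ∀ j < Module.finrank k (V q⁻¹),
        T (e q i * e q⁻¹ j) = if j = i then ε q i • u q else 0 := by
  let U : Q → (ℕ → k) × (ℕ → B) → Prop := fun q a =>
    LinearIndependent k (fun i : Fin (Module.finrank k (V q)) => a.2 i) ∧
    Submodule.span k (Set.range fun i : Fin (Module.finrank k (V q)) => a.2 i) = V q ∧
    (q⁻¹ = q → P (Module.finrank k (V q)) a.1) ∧ (q⁻¹ ≠ q → a.1 = fun _ => 1)
  -- The bases at `q` and `q⁻¹` must be chosen together; the relation is symmetric because `u q⁻¹ =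
  -- u q` and the two patterns agree. Fixed points use diagonalization, other pairs use dual bases.
  let R : Q → (ℕ → k) × (ℕ → B) → (ℕ → k) × (ℕ → B) → Prop := fun q a b =>
    U q a ∧ U q⁻¹ b ∧ a.1 = b.1 ∧ Module.finrank k (V q⁻¹) = Module.finrank k (V q) ∧
    ∀ i < Module.finrank k (V q), ∀ j < Module.finrank k (V q⁻¹),
      T (a.2 i * b.2 j) = if j = i then a.1 i • u q else 0
  obtain ⟨F, hF⟩ : ∃ F : Q → (ℕ → k) × (ℕ → B), ∀ q, R q (F q) (F q⁻¹) := by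
    refine exists_compatible_choice inv_involutive ?_ ?_ ?_
    · rintro q a b ⟨ha, hb, hab, hf, h⟩
      refine ⟨hb, by rwa [inv_inv], hab.symm, by rw [inv_inv]; exact hf.symm, ?_⟩
      rw [inv_inv, husymm]
      intro i hi j hj
      rw [mul_comm, h j hj i hi, hab]
      by_cases hij : i = j
      · rw [if_pos hij, if_pos hij.symm, hij]
      · rw [if_neg hij, if_neg (Ne.symm hij)]
    · intro q hq
      have huq : u q ∈ centerGrading 𝓑 (τ q * τ q) := by
        have := hu q
        rwa [hq] at this
      obtain ⟨β, hβ, hnd, -⟩ := exists_pairing hc hT hs hT1 hTg hq.symm huq (hu0 q)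
      obtain ⟨ε, b, hε, hb⟩ := hP q β (fun x y => by
        have := hβ x y
        rw [mul_comm, hβ y x] at this
        exact (smul_left_injective k (hu0 q) this).symm) hnd
      obtain ⟨e, he, he1, he2⟩ := exists_nat_family b
      have hU : U q (ε, e) := ⟨he1, he2, fun _ => hε, fun h => absurd hq h⟩
      refine ⟨(ε, e), hU, by rwa [hq], rfl, by rw [hq], ?_⟩
      rw [hq]
      intro i hi j hj
      have h1 := hβ (b ⟨i, hi⟩) (b ⟨j, hj⟩)
      rw [← he, ← he, hb] at h1
      rw [h1]
      simp [Fin.ext_iff]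
    · intro q hq
      obtain ⟨β, hβ, hnd, hnd'⟩ := exists_pairing hc hT hs hT1 hTg rfl (hu q) (hu0 q)
      have hf := finrank_eq_of_nondegenerate β hnd hnd'
      obtain ⟨b, b', hb⟩ := exists_dual_bases β hnd hnd'
      obtain ⟨e, he, he1, he2⟩ := exists_nat_family b
      obtain ⟨e', he', he1', he2'⟩ := exists_nat_family b'
      refine ⟨(fun _ => 1, e), (fun _ => 1, e'), ⟨he1, he2, fun h => absurd h hq, fun _ => rfl⟩,
        ⟨he1', he2', fun h => absurd (inv_injective h) hq, fun _ => rfl⟩, rfl, hf.symm, ?_⟩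
      intro i hi j hj
      have h1 := hβ (b ⟨i, hi⟩) (b' ⟨j, hj⟩)
      rw [← he, ← he', hb] at h1
      rw [h1]
      simp
  exact ⟨fun q => (F q).1, fun q => (F q).2, fun q => (hF q).1.1, fun q => (hF q).1.2.1,
    fun q => (hF q).1.2.2.1, fun q => (hF q).1.2.2.2, fun q => (hF q).2.2.2.1,
    fun q => (hF q).2.2.2.2⟩

/-- Only finitely many components of the traceless family are nonzero. -/
theorem finite_support [FiniteDimensional k B] (hT : IsTracelessFamily 𝓑 π τ V) :
    (Function.support fun q => Module.finrank k (V q)).Finite := by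
  have hfin : {g | 𝓑 g ≠ ⊥}.Finite := WellFoundedGT.finite_ne_bot_of_iSupIndep IsGrading.indep
  refine (hfin.image π).subset fun q hq => ⟨τ q, fun h0 => hq ?_, hT.apply_section q⟩
  have : V q = ⊥ := eq_bot_iff.2 (h0 ▸ hT.le q)
  simp [this]

end IsTracelessFamily

/-! ### Loop algebras and the comparison map. -/

section LoopFrame

variable {k G S : Type*} [CommRing k] [CommGroup G] [CommRing S] [Algebra k S]

/-- The components `D g` form a graded subalgebra and are spanned by units. -/
structure IsLoopFrame (D : G → Submodule k S) : Prop where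
  one_mem : 1 ∈ D 1
  mul_mem : ∀ g h : G, ∀ x ∈ D g, ∀ y ∈ D h, x * y ∈ D (g * h)
  exists_unit : ∀ g, ∃ s ∈ D g, ∃ t ∈ D g⁻¹, s * t = 1 ∧ ∀ d ∈ D g, ∃ c : k, d = c • s

variable {G' A : Type*} [CommGroup G'] [NonUnitalNonAssocRing A] [Module k A] [SMulCommClass k A A]
  [IsScalarTower k A A]

/-- The `G`-grading of `⨁_g A_{π(g)} ⊗ D_g`. -/
def loopSubalgebraGrading (π : G →* G') (𝓐 : G' → Submodule k A) [IsGrading 𝓐]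
    (D : G → Submodule k S) (hD : ∀ g h : G, ∀ x ∈ D g, ∀ y ∈ D h, x * y ∈ D (g * h)) (g : G) :
    Submodule k (loopSubalgebra π 𝓐 D hD) :=
  (loopComponent π 𝓐 D g).comap (loopSubalgebra π 𝓐 D hD).toSubmodule.subtype

/-- An injective homomorphism that maps components onto the components of a loop algebra. -/
theorem gradedIsomorphic_of_map_eq {B : Type*} [NonUnitalNonAssocRing B] [Module k B]
    {𝓑 : G → Submodule k B} (h𝓑 : ⨆ g, 𝓑 g = ⊤) {π : G →* G'} {𝓐 : G' → Submodule k A} [IsGrading 𝓐]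
    {D : G → Submodule k S} (hD : ∀ g h : G, ∀ x ∈ D g, ∀ y ∈ D h, x * y ∈ D (g * h))
    (f : B →ₗ[k] A ⊗[k] S) (hf : Function.Injective f) (hmul : ∀ x y, f (x * y) = f x * f y)
    (hmap : ∀ g, (𝓑 g).map f = loopComponent π 𝓐 D g) :
    GradedIsomorphic 𝓑 (loopSubalgebraGrading π 𝓐 D hD) := by
  have hrange : LinearMap.range f = (loopSubalgebra π 𝓐 D hD).toSubmodule := by
    rw [← Submodule.map_top, ← h𝓑, Submodule.map_iSup]
    simp only [hmap]
    rfl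
  let e : B ≃ₗ[k] loopSubalgebra π 𝓐 D hD :=
    (LinearEquiv.ofInjective f hf).trans (LinearEquiv.ofEq _ _ hrange)
  have he : ∀ x, ((e x : loopSubalgebra π 𝓐 D hD) : A ⊗[k] S) = f x := fun _ => rfl
  refine ⟨e, fun x y => Subtype.ext (hmul x y), fun g x => ?_⟩
  change x ∈ 𝓑 g ↔ f x ∈ loopComponent π 𝓐 D g
  rw [← hmap]
  exact ⟨Submodule.mem_map_of_mem, fun ⟨y, hy, hxy⟩ => hf hxy ▸ hy⟩

end LoopFrame

namespace BilinJordan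

variable {k V : Type*} [CommRing k] [AddCommGroup V] [Module k V] (b : LinearMap.BilinForm k V)

/-- The coefficient of `1` as a linear map. -/
def fstₗ : BilinJordan b →ₗ[k] k where
  toFun := fst
  map_add' := fst_add
  map_smul' := fst_smul

/-- The projection to `V` as a linear map. -/
def sndₗ : BilinJordan b →ₗ[k] V where
  toFun := snd
  map_add' := snd_add
  map_smul' := snd_smul

/-- The inclusion of `V`. -/
def inr : V →ₗ[k] BilinJordan b where
  toFun v := ⟨0, v⟩
  map_add' u v := BilinJordan.ext (by simp [fst_add]) (by simp [snd_add])
  map_smul' c v := BilinJordan.ext (by simp [fst_smul]) (by simp [snd_smul])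

theorem eq_smul_one_add_inr (x : BilinJordan b) : x = x.fst • 1 + inr b x.snd := by
  refine BilinJordan.ext ?_ ?_
  · simp [fst_add, fst_smul, fst_one, inr]
  · simp [snd_add, snd_smul, snd_one, inr]

theorem inr_mul_inr (u v : V) : inr b u * inr b v = b u v • 1 := by
  refine BilinJordan.ext ?_ ?_
  · simp [fst_mul, fst_smul, fst_one, inr]
  · simp [snd_mul, snd_smul, snd_one, inr]

end BilinJordan

section LoopMap

variable {k G Q B S : Type*} [Field k] [CommGroup G] [CommGroup Q] [NonAssocCommRing B]
  [Module k B] [SMulCommClass k B B] [IsScalarTower k B B] [CommRing S] [Algebra k S]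
  {κ : Q → ℕ} [Fintype (Σ q, Fin (κ q))] {ε : Q → ℕ → k}
  (Φ : Center k B →ₐ[k] S) (s : Q → S)
  (T : B →ₗ[Center k B] Center k B) (C : (Σ q, Fin (κ q)) → B →ₗ[Center k B] Center k B)

/-- The map to the tensor product given by the coordinates `T` and `C`. -/
noncomputable def loopMap (ε : Q → ℕ → k) : B →ₗ[k] BilinJordan (stdForm κ ε) ⊗[k] S :=
  TensorProduct.mk k (BilinJordan (stdForm κ ε)) S 1 ∘ₗ Φ.toLinearMap ∘ₗ T.restrictScalars k +
    ∑ a, TensorProduct.mk k (BilinJordan (stdForm κ ε)) S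
        (BilinJordan.inr _ (Finsupp.single a 1)) ∘ₗ
      LinearMap.mulRight k (s a.1) ∘ₗ Φ.toLinearMap ∘ₗ (C a).restrictScalars k

theorem loopMap_apply (x : B) : loopMap Φ s T C ε x = 1 ⊗ₜ Φ (T x) +
    ∑ a, BilinJordan.inr (stdForm κ ε) (Finsupp.single a 1) ⊗ₜ (Φ (C a x) * s a.1) := by
  simp [loopMap]

theorem loopMap_injective (hΦ : Function.Injective Φ) (hs : ∀ q, IsUnit (s q))
    {e : (Σ q, Fin (κ q)) → B} (hexp : ∀ x, x = T x • (1 : B) + ∑ a, C a x • e a) :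
    Function.Injective (loopMap Φ s T C ε) := by
  classical
  refine (injective_iff_map_eq_zero _).2 fun x hx => ?_
  rw [loopMap_apply] at hx
  have hT : T x = 0 := by
    have := congrArg ((TensorProduct.lid k S) ∘ (BilinJordan.fstₗ _).rTensor S) hx
    simp only [Function.comp_apply, map_add, map_sum, LinearMap.rTensor_tmul,
      TensorProduct.lid_tmul, map_zero] at this
    have h1 : BilinJordan.fstₗ (stdForm κ ε) 1 = 1 := rfl
    have h2 : ∀ v, BilinJordan.fstₗ (stdForm κ ε) (BilinJordan.inr _ v) = 0 := fun v => rfl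
    simp only [h1, h2, one_smul, zero_smul, Finset.sum_const_zero, add_zero] at this
    exact hΦ (this.trans (map_zero Φ).symm)
  have hC : ∀ a, C a x = 0 := by
    intro a
    have := congrArg ((TensorProduct.lid k S) ∘
      ((Finsupp.lapply a) ∘ₗ BilinJordan.sndₗ (stdForm κ ε)).rTensor S) hx
    simp only [Function.comp_apply, map_add, map_sum, LinearMap.rTensor_tmul,
      TensorProduct.lid_tmul, map_zero, LinearMap.comp_apply] at this
    have h1 : BilinJordan.sndₗ (stdForm κ ε) 1 = 0 := rfl
    have h2 : ∀ v, BilinJordan.sndₗ (stdForm κ ε) (BilinJordan.inr _ v) = v := fun v => rfl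
    simp only [h1, h2, map_zero, zero_smul, zero_add, Finsupp.lapply_apply, Finsupp.single_apply,
      ite_smul, one_smul, Finset.sum_ite_eq', Finset.mem_univ, if_true] at this
    exact hΦ ((((hs a.1).mul_left_eq_zero).1 this).trans (map_zero Φ).symm)
  rw [hexp x, hT, zero_smul, zero_add]
  exact Finset.sum_eq_zero fun a _ => by rw [hC a, zero_smul]

/-- The products `e a * e c` are central, so their coordinates `C` vanish and only their traces
matter. This reduces multiplicativity to `hform`, a condition on basis vectors. -/
theorem loopMap_mul {e : (Σ q, Fin (κ q)) → B}
    (hexp : ∀ x, x = T x • (1 : B) + ∑ a, C a x • e a) (hT1 : T 1 = 1) (hTe : ∀ a, T (e a) = 0)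
    (hC1 : ∀ a, C a 1 = 0)
    (hCe : ∀ a c, C a (e c) = open Classical in if a = c then 1 else 0)
    (hmul : ∀ a c, e a * e c ∈ Set.center B)
    (hform : ∀ a c, Φ (T (e a * e c)) =
      stdForm κ ε (Finsupp.single a 1) (Finsupp.single c 1) • (s a.1 * s c.1)) (x y : B) :
    loopMap Φ s T C ε (x * y) = loopMap Φ s T C ε x * loopMap Φ s T C ε y := by
  classical
  have hxy : x * y = (T x * T y) • (1 : B) + ∑ a, (T x * C a y) • e a + ∑ a, (C a x * T y) • e a +
      ∑ a, ∑ c, (C a x * C c y) • (e a * e c) := by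
    have h : ∀ (l m : Center k B) (v w : B), (l • (1 : B) + v) * (m • (1 : B) + w) =
        (l * m) • (1 : B) + l • w + m • v + v * w := fun l m v w => by
      simp only [add_mul, mul_add, smul_mul_assoc, mul_smul_comm, one_mul, mul_one, smul_add, smul_smul,
        mul_comm m l]
      abel
    conv_lhs => rw [hexp x, hexp y, h, Finset.sum_mul_sum]
    simp only [Finset.smul_sum, smul_mul_assoc, mul_smul_comm, smul_smul, mul_comm (T y),
      fun a c => mul_comm (C a y) (C c x)]
  have hT : T (x * y) = T x * T y + ∑ a, ∑ c, (C a x * C c y) * T (e a * e c) := by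
    rw [hxy]
    simp [hT1, hTe]
  have hC : ∀ d, C d (x * y) = T x * C d y + C d x * T y := by
    intro d
    have h0 : ∀ a c, C d (e a * e c) = 0 := fun a c => by
      rw [eq_apply_smul_one_of_mem_center hT1 (hmul a c), map_smul, hC1, smul_zero]
    rw [hxy]
    simp [hC1, hCe, h0]
  rw [loopMap_apply, loopMap_apply, loopMap_apply, hT]
  simp only [hC, add_mul, mul_add, Finset.sum_mul_sum]
  simp only [add_mul, Algebra.TensorProduct.tmul_mul_tmul,
    one_mul, mul_one, map_add, map_mul, map_sum, TensorProduct.tmul_add, TensorProduct.tmul_sum,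
    BilinJordan.inr_mul_inr, hform, Finset.mul_sum, Finset.sum_mul, Finset.sum_add_distrib,
    TensorProduct.smul_tmul]
  have e1 : ∀ a c, Φ (C a x) * Φ (C c y) *
      stdForm κ ε (Finsupp.single a 1) (Finsupp.single c 1) • (s a.1 * s c.1) =
      stdForm κ ε (Finsupp.single a 1) (Finsupp.single c 1) •
        (Φ (C a x) * s a.1 * (Φ (C c y) * s c.1)) := fun a c => by
    rw [mul_smul_comm]
    congr 1
    ring
  simp only [e1, mul_assoc, mul_comm (s _) (Φ (T y))]
  abel

variable {D : G → Submodule k S} {π : G →* Q} {𝓑 : G → Submodule k B} [IsGrading 𝓑] {τ : Q → G}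

/-- The target is spanned by one element, and a nonzero component is mapped into it injectively. -/
theorem IsLoopFrame.exists_apply_eq (hD : IsLoopFrame D) (hc : IsGradedCentral 𝓑 π)
    (hΦ : Function.Injective Φ) (hΦD : ∀ g, ∀ z ∈ centerGrading 𝓑 g, Φ z ∈ D g) {g : G}
    (hg : π g = 1) {d : S} (hd : d ∈ D g) : ∃ z ∈ centerGrading 𝓑 g, Φ z = d := by
  obtain ⟨u, hu, hu0⟩ := Submodule.exists_mem_ne_zero_of_ne_bot ((hc.apply_eq_one_iff g).1 hg)
  obtain ⟨s, -, -, -, -, hs⟩ := hD.exists_unit g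
  obtain ⟨c, hcu⟩ := hs _ (hΦD g u hu)
  obtain ⟨c', rfl⟩ := hs d hd
  have hc0 : c ≠ 0 := by
    rintro rfl
    rw [zero_smul] at hcu
    exact hu0 (hΦ (hcu.trans (map_zero Φ).symm))
  refine ⟨(c' * c⁻¹) • u, Submodule.smul_mem _ _ hu, ?_⟩
  rw [map_smul, hcu, smul_smul, mul_assoc, inv_mul_cancel₀ hc0, mul_one]

/-- On degree `g` the coordinate `C a` has degree `g * (τ a.1)⁻¹`; it vanishes unless `π g = a.1`,
and the factor `s a.1` restores degree `g`. Conversely, generators of the component are images of `z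
• 1` and `z • e a`. -/
theorem map_loopMap [Nontrivial B] (hD : IsLoopFrame D) (hc : IsGradedCentral 𝓑 π)
    (hΦ : Function.Injective Φ) (hΦD : ∀ g, ∀ z ∈ centerGrading 𝓑 g, Φ z ∈ D g)
    (hτ : ∀ q, π (τ q) = q) (hs : ∀ q, s q ∈ D (τ q))
    (hs' : ∀ q, ∃ t ∈ D (τ q)⁻¹, s q * t = 1) {e : (Σ q, Fin (κ q)) → B}
    (he : ∀ a, e a ∈ 𝓑 (τ a.1))
    (hT1 : T 1 = 1) (hTe : ∀ a, T (e a) = 0) (hTg : ∀ g, ∀ x ∈ 𝓑 g, T x ∈ centerGrading 𝓑 g)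
    (hC1 : ∀ a, C a 1 = 0)
    (hCe : ∀ a c, C a (e c) = open Classical in if a = c then 1 else 0)
    (hCg : ∀ a g, ∀ x ∈ 𝓑 g, C a x ∈ centerGrading 𝓑 (g * (τ a.1)⁻¹)) (g : G) :
    (𝓑 g).map (loopMap Φ s T C ε) =
      loopComponent π (BilinJordan.grading (stdForm κ ε) (stdGrading k κ)) D g := by
  classical
  refine le_antisymm ?_ (Submodule.map₂_le.2 ?_)
  · rintro _ ⟨x, hx, rfl⟩
    rw [loopMap_apply]
    refine add_mem ?_ (Submodule.sum_mem _ fun a _ => ?_)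
    · by_cases hg : π g = 1
      · refine Submodule.apply_mem_map₂ (TensorProduct.mk k _ S) ?_ (hΦD g _ (hTg g x hx))
        refine ⟨?_, zero_mem _⟩
        simp [trivialGrading, hg]
      · rw [hc.eq_zero_of_mem hg (hTg g x hx), map_zero, TensorProduct.tmul_zero]
        exact zero_mem _
    · by_cases hg : π g = a.1
      · refine Submodule.apply_mem_map₂ (TensorProduct.mk k _ S) ⟨zero_mem _, ?_⟩ ?_
        · exact Finsupp.single_mem_supported k 1 hg.symm
        · have := hD.mul_mem _ _ _ (hΦD _ _ (hCg a g x hx)) _ (hs a.1)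
          rwa [inv_mul_cancel_right] at this
      · rw [hc.eq_zero_of_mem _ (hCg a g x hx), map_zero, zero_mul, TensorProduct.tmul_zero]
        · exact zero_mem _
        · rwa [map_mul, map_inv, hτ, ne_eq, mul_inv_eq_one]
  · rintro x ⟨hx1, hx2⟩ d hd
    rw [TensorProduct.mk_apply, BilinJordan.eq_smul_one_add_inr _ x, TensorProduct.add_tmul]
    refine add_mem ?_ ?_
    · by_cases hg : π g = 1
      · obtain ⟨z, hz, rfl⟩ := hD.exists_apply_eq Φ hc hΦ hΦD hg hd
        rw [← TensorProduct.smul_tmul']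
        refine Submodule.smul_mem _ _ ⟨z • 1, ?_, ?_⟩
        · have := IsGrading.mul_mem (𝓐 := 𝓑) hz (IsGrading.one_mem 𝓑)
          rwa [mul_one] at this
        · rw [loopMap_apply]
          simp [hT1, hC1]
      · have h0 : x.fst ∈ trivialGrading k Q (π g) := hx1
        rw [trivialGrading, if_neg hg, Submodule.mem_bot] at h0
        rw [h0, zero_smul, TensorProduct.zero_tmul]
        exact zero_mem _
    · have hsum : BilinJordan.inr (stdForm κ ε) x.snd = ∑ a : Σ q, Fin (κ q),
          x.snd a • BilinJordan.inr (stdForm κ ε) (Finsupp.single a 1) := by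
        conv_lhs => rw [← Finsupp.univ_sum_single x.snd]
        rw [map_sum]
        refine Finset.sum_congr rfl fun a _ => ?_
        rw [← map_smul, Finsupp.smul_single, smul_eq_mul, mul_one]
      rw [hsum, TensorProduct.sum_tmul]
      refine Submodule.sum_mem _ fun a _ => ?_
      rw [← TensorProduct.smul_tmul']
      by_cases hg : π g = a.1
      · obtain ⟨t, ht, hst⟩ := hs' a.1
        obtain ⟨z, hz, hzd⟩ := hD.exists_apply_eq (g := g * (τ a.1)⁻¹) Φ hc hΦ hΦD
          (by rw [map_mul, map_inv, hτ, hg, mul_inv_cancel]) (hD.mul_mem _ _ _ hd _ ht)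
        refine Submodule.smul_mem _ _ ⟨z • e a, ?_, ?_⟩
        · have := IsGrading.mul_mem (𝓐 := 𝓑) hz (he a)
          rwa [inv_mul_cancel_right] at this
        · rw [loopMap_apply, map_smul, hTe, smul_zero, map_zero, TensorProduct.tmul_zero, zero_add,
            Finset.sum_eq_single a]
          · rw [map_smul, hCe, if_pos rfl, smul_eq_mul, mul_one, hzd, mul_assoc, mul_comm t, hst,
              mul_one]
          · intro c _ hca
            rw [map_smul, hCe, if_neg hca, smul_zero, map_zero, zero_mul, TensorProduct.tmul_zero]
          · simp
      · have : x.snd a = 0 := by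
          by_contra h
          exact hg (hx2 (Finsupp.mem_support_iff.2 h)).symm
        rw [this, zero_smul]
        exact zero_mem _

end LoopMap

section Existence

variable {k G Q B S : Type*} [Field k] [CommGroup G] [CommGroup Q] [NonAssocCommRing B]
  [Module k B] [SMulCommClass k B B] [IsScalarTower k B B] [CommRing S] [Algebra k S]
  {𝓑 : G → Submodule k B} [IsGrading 𝓑] {π : G →* Q} {D : G → Submodule k S}

/-- A graded-simple algebra that is quadratic over its center is a loop algebra of the Jordan algebra
of a bilinear form. -/
theorem exists_gradedIsomorphic [FiniteDimensional k B] [Nontrivial S] (h2 : (2 : k) ≠ 0)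
    (hs : IsGradedSimple 𝓑) (hc : IsGradedCentral 𝓑 π) (hq : IsQuadraticModulo (Center k B) B)
    (hD : IsLoopFrame D) {Φ : Center k B →ₐ[k] S} (hΦ : Function.Injective Φ)
    (hΦD : ∀ g, ∀ z ∈ centerGrading 𝓑 g, Φ z ∈ D g) {P : ℕ → (ℕ → k) → Prop}
    (hP : ∀ W : Submodule k B, HasDiagonalForms k W P) :
    ∃ (κ : Q → ℕ) (ε : Q → ℕ → k), IsBalanced κ ∧ (∀ q, q⁻¹ = q → P (κ q) (ε q)) ∧
      (∀ q, q⁻¹ ≠ q → ε q = fun _ => 1) ∧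
      GradedIsomorphic 𝓑 (loopSubalgebraGrading π
        (BilinJordan.grading (stdForm κ ε) (stdGrading k κ)) D hD.mul_mem) := by
  classical
  have : Nontrivial B := hs.nontrivial
  obtain ⟨τ, V, hT⟩ := hc.exists_isTracelessFamily hq h2
  obtain ⟨T, hT1, hTV, hTg⟩ := IsTracelessFamily.exists_trace hc hT
  choose s hs1 t ht hst hspan using fun q => hD.exists_unit (τ q)
  -- The normalizing unit is fixed by `Φ (u q) = s q * s q⁻¹`: this makes the normalized pairing
  -- match the standard form, and its symmetry gives `u q⁻¹ = u q`.
  choose u hu hu' using fun q => hD.exists_apply_eq (g := τ q * τ q⁻¹) Φ hc hΦ hΦD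
    (by rw [map_mul, hT.apply_section, hT.apply_section, mul_inv_cancel])
    (hD.mul_mem _ _ _ (hs1 q) _ (hs1 q⁻¹))
  have hsu : ∀ q, IsUnit (s q) := fun q => IsUnit.of_mul_eq_one _ (hst q)
  have hu0 : ∀ q, u q ≠ 0 := fun q h0 => by
    have h1 := hu' q
    rw [h0, map_zero] at h1
    exact ((hsu q).mul (hsu q⁻¹)).ne_zero h1.symm
  have husymm : ∀ q, u q⁻¹ = u q := fun q => hΦ (by rw [hu', hu', inv_inv, mul_comm])
  obtain ⟨ε, e, hli, hsp, hε, hε1, hf, he⟩ := IsTracelessFamily.exists_bases hc hT hs hT1 hTg hu hu0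
    husymm (fun q => hP (V q))
  let κ : Q → ℕ := fun q => Module.finrank k (V q)
  have hfin : (Function.support κ).Finite := hT.finite_support
  have : Finite (Σ q, Fin (κ q)) := by
    have := hfin.to_subtype
    let j : (Σ q, Fin (κ q)) → Σ q : Function.support κ, Fin (κ q) := fun a =>
      ⟨⟨a.1, fun h0 => (Fin.cast h0 a.2).elim0⟩, a.2⟩
    refine Finite.of_injective j ?_
    rintro ⟨q, i⟩ ⟨r, i'⟩ h
    have h1 : q = r := congrArg (fun a => (a.1 : Q)) h
    subst h1
    simpa [j] using h
  let _ : Fintype (Σ q, Fin (κ q)) := Fintype.ofFinite _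
  let E : (Σ q, Fin (κ q)) → B := fun a => e a.1 a.2
  have hEV : ∀ a, E a ∈ V a.1 := fun a => hsp a.1 ▸ Submodule.subset_span ⟨a.2, rfl⟩
  obtain ⟨C, hC1, hCe, hCg⟩ := IsTracelessFamily.exists_coordinates hc hT (e := E) hli hsp
  have hexp := IsTracelessFamily.eq_trace_add_sum hc hT (e := E) hsp hT1 hTV hC1 hCe
  have hTe : ∀ a, T (E a) = 0 := fun a => hTV _ _ (hEV a)
  refine ⟨κ, ε, ⟨hf, hfin⟩, hε, hε1, gradedIsomorphic_of_map_eq IsGrading.iSup_eq_top hD.mul_mem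
    (loopMap Φ s T C ε) (loopMap_injective Φ s T C hΦ hsu hexp) ?_ ?_⟩
  · refine loopMap_mul Φ s T C hexp hT1 hTe hC1 hCe
      (fun a c => hT.mul_mem _ _ _ (hEV a) _ (hEV c)) ?_
    rintro ⟨q, i⟩ ⟨r, j⟩
    rw [stdForm_single]
    by_cases hqr : r = q⁻¹
    · subst hqr
      rw [show E ⟨q, i⟩ * E ⟨q⁻¹, j⟩ = e q i * e q⁻¹ j from rfl, he q i i.2 j j.2]
      by_cases hij : (j : ℕ) = i
      · simp [hij, hu']
      · simp [hij]
    · rw [IsTracelessFamily.mul_eq_zero_of_ne hc hT (fun h => hqr (eq_inv_of_mul_eq_one_right h))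
        (hEV ⟨q, i⟩) (hEV ⟨r, j⟩)]
      simp [hqr]
  · exact map_loopMap Φ s T C hD hc hΦ hΦD hT.apply_section hs1 (fun q => ⟨t q, ht q, hst q⟩)
      (fun a => hT.le _ (hEV a)) hT1 hTe hTg hC1 hCe hCg

end Existence

/-! ### Graded division as anisotropy of the norm. -/

section Division

variable {k G Q V S : Type*} [Field k] [CommGroup G] [CommGroup Q] [AddCommGroup V] [Module k V]
  [CommRing S] [Nontrivial S] [Algebra k S] {π : G →* Q} {D : G → Submodule k S}
  {b : LinearMap.BilinForm k V} {𝓥 : Q → Submodule k V} [IsGrading (BilinJordan.grading b 𝓥)]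

theorem tmul_right_injective {A : Type*} [AddCommGroup A] [Module k A] {s : S} (hs : IsUnit s) :
    Function.Injective fun a : A => a ⊗ₜ[k] s := by
  obtain ⟨f, hf⟩ := exists_dual_family (F := k) (v := ![s])
    (LinearIndependent.of_subsingleton 0 hs.ne_zero)
  have hf1 : f 0 s = 1 := by simpa using hf 0 0
  intro a a' h
  have := congrArg (TensorProduct.rid k A ∘ (f 0).lTensor A) h
  simpa [hf1] using this

/-- A loop algebra of the Jordan algebra of a bilinear form is a graded-division algebra if and only
if the norm `c² - b(v, v)` of every nonzero homogeneous element is nonzero. -/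
theorem isGradedDivision_iff {k' B : Type*} [CommRing k'] [NonAssocRing B] [Module k' B]
    {𝓑 : G → Submodule k' B} (hπ : Function.Surjective π) (hD : IsLoopFrame D)
    (f : B ≃+ loopSubalgebra π (BilinJordan.grading b 𝓥) D hD.mul_mem)
    (hmul : ∀ x y, f (x * y) = f x * f y)
    (hfg : ∀ g x, x ∈ 𝓑 g ↔ f x ∈ loopSubalgebraGrading π (BilinJordan.grading b 𝓥) D hD.mul_mem g) :
    IsGradedDivision 𝓑 ↔ ∀ q, ∀ a ∈ BilinJordan.grading b 𝓥 q, a ≠ 0 →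
      a.fst * a.fst ≠ b a.snd a.snd := by
  let ψ : B → BilinJordan b ⊗[k] S := fun x => f x
  have hψmul : ∀ x y, ψ (x * y) = ψ x * ψ y := fun x y => congrArg Subtype.val (hmul x y)
  have hψinj : Function.Injective ψ := Subtype.val_injective.comp f.injective
  have hψg : ∀ g x, x ∈ 𝓑 g ↔ ψ x ∈ loopComponent π (BilinJordan.grading b 𝓥) D g := hfg
  have hψsurj : ∀ g, ∀ y ∈ loopComponent π (BilinJordan.grading b 𝓥) D g, ∃ x, ψ x = y := by
    intro g y hy
    obtain ⟨x, hx⟩ := f.surjective ⟨y, Submodule.mem_iSup_of_mem g hy⟩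
    exact ⟨x, congrArg Subtype.val hx⟩
  have hψ1 : ψ 1 = 1 := by
    obtain ⟨x, hx⟩ := hψsurj 1 (1 ⊗ₜ 1) (Submodule.apply_mem_map₂ (TensorProduct.mk k _ S)
      (by rw [map_one]; exact IsGrading.one_mem _) hD.one_mem)
    have := hψmul 1 x
    rw [one_mul, hx, ← Algebra.TensorProduct.one_def, mul_one] at this
    exact this.symm
  constructor
  · intro hdiv q a ha ha0 hn
    obtain ⟨g, rfl⟩ := hπ q
    obtain ⟨s, hs, t, ht, hst, -⟩ := hD.exists_unit g
    have hsu : IsUnit s := IsUnit.of_mul_eq_one _ hst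
    have hmem : a ⊗ₜ[k] s ∈ loopComponent π (BilinJordan.grading b 𝓥) D g :=
      Submodule.apply_mem_map₂ (TensorProduct.mk k _ S) ha hs
    obtain ⟨x, hx⟩ := hψsurj g _ hmem
    have hx0 : x ≠ 0 := by
      rintro rfl
      refine ha0 (tmul_right_injective (k := k) hsu ?_)
      change a ⊗ₜ[k] s = 0 ⊗ₜ[k] s
      rw [← hx, TensorProduct.zero_tmul]
      exact congrArg Subtype.val (map_zero f)
    obtain ⟨y, hy1, hy2⟩ := hdiv g x ((hψg g x).2 (hx ▸ hmem)) hx0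
    have e1 : ∀ (σ : S) (Y : BilinJordan b ⊗[k] S), (a ⊗ₜ[k] (σ * s)) * Y =
        (1 ⊗ₜ[k] σ) * ((a ⊗ₜ[k] s) * Y) := fun σ Y => by
      induction Y with
      | zero => simp
      | tmul c d => simp [mul_assoc]
      | add Y Z hY hZ => rw [mul_add, hY, hZ, mul_add, mul_add]
    -- The equation a² = 2ca − n(a)1 with n(a) = 0. With the relations defining an inverse it forces
    -- `a = 2c1`; hence the vector part is 0 and `c = 2c`.
    have haa : a * a = (2 * a.fst) • a := by
      refine BilinJordan.ext ?_ ?_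
      · rw [BilinJordan.fst_mul, ← hn, BilinJordan.fst_smul]
        ring
      · rw [BilinJordan.snd_mul, BilinJordan.snd_smul, ← add_smul]
        ring_nf
    have h3 : ψ x = 1 ⊗ₜ[k] ((2 * a.fst) • s) := by
      conv_lhs => rw [← hy2, hψmul, hψmul, hx, Algebra.TensorProduct.tmul_mul_tmul, haa,
        TensorProduct.smul_tmul, ← smul_mul_assoc, e1, ← hx, ← hψmul, hy1, hψ1, mul_one]
    rw [hx, ← TensorProduct.smul_tmul] at h3
    have h4 := tmul_right_injective (k := k) hsu h3
    have h5 : a.snd = 0 := by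
      rw [h4, BilinJordan.snd_smul, BilinJordan.snd_one, smul_zero]
    have h6 : a.fst = 2 * a.fst := by
      conv_lhs => rw [h4, BilinJordan.fst_smul, BilinJordan.fst_one, mul_one]
    refine ha0 (BilinJordan.ext ?_ h5)
    rw [BilinJordan.fst_zero]
    linear_combination -h6
  · intro hn g x hx hx0
    obtain ⟨s, hs, t, ht, hst, hspan⟩ := hD.exists_unit g
    obtain ⟨a, ha, hxa⟩ : ∃ a ∈ BilinJordan.grading b 𝓥 (π g), a ⊗ₜ[k] s = ψ x := by
      have hle : loopComponent π (BilinJordan.grading b 𝓥) D g ≤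
          (BilinJordan.grading b 𝓥 (π g)).map ((TensorProduct.mk k _ S).flip s) := by
        refine Submodule.map₂_le.2 fun a ha d hd => ?_
        obtain ⟨c, rfl⟩ := hspan d hd
        refine ⟨c • a, Submodule.smul_mem _ _ ha, ?_⟩
        simp
      exact hle ((hψg g x).1 hx)
    have ha0 : a ≠ 0 := by
      rintro rfl
      rw [TensorProduct.zero_tmul] at hxa
      exact hx0 (hψinj (hxa.symm.trans (congrArg Subtype.val (map_zero f)).symm))
    have hna := sub_ne_zero.2 (hn _ a ha ha0)
    set n := a.fst * a.fst - b a.snd a.snd with hndef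
    -- The conjugate divided by the norm.
    let a' : BilinJordan b := ⟨n⁻¹ * a.fst, -(n⁻¹ • a.snd)⟩
    -- If `π g` does not square to 1, the norm vanishes for degree reasons. Thus `a'` has the degree
    -- required of an inverse.
    have hq : (π g)⁻¹ = π g := by
      by_contra h
      have hqq : π g * π g ≠ 1 := fun h' => h (eq_inv_of_mul_eq_one_left h').symm
      have hq1 : π g ≠ 1 := fun h' => h (by rw [h', inv_one])
      have h1 : a.fst ∈ trivialGrading k Q (π g) := ha.1
      have h2 : (a * a).fst ∈ trivialGrading k Q (π g * π g) := (IsGrading.mul_mem ha ha).1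
      rw [trivialGrading, if_neg hq1, Submodule.mem_bot] at h1
      rw [trivialGrading, if_neg hqq, Submodule.mem_bot, BilinJordan.fst_mul, h1, mul_zero,
        zero_add] at h2
      exact hna (by rw [hndef, h1, h2]; ring)
    have ha' : a' ∈ BilinJordan.grading b 𝓥 (π g⁻¹) := by
      rw [map_inv, hq]
      exact ⟨Submodule.smul_mem _ n⁻¹ ha.1, neg_mem (Submodule.smul_mem _ n⁻¹ ha.2)⟩
    have haa : a * a' = 1 := by
      refine BilinJordan.ext ?_ ?_
      · rw [BilinJordan.fst_mul, BilinJordan.fst_one, ← inv_mul_cancel₀ hna]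
        simp only [a', map_neg, map_smul, smul_eq_mul]
        rw [hndef]
        ring
      · rw [BilinJordan.snd_mul, BilinJordan.snd_one]
        simp only [a']
        module
    have haaa : (a * a) * a' = a := by
      have h1 : n⁻¹ * n = 1 := inv_mul_cancel₀ hna
      refine BilinJordan.ext ?_ ?_
      · rw [BilinJordan.fst_mul, BilinJordan.fst_mul, BilinJordan.snd_mul]
        simp only [a', map_neg, map_smul, map_add, LinearMap.add_apply, LinearMap.smul_apply,
          smul_eq_mul]
        linear_combination a.fst * h1 + a.fst * n⁻¹ * (-hndef)
      · rw [BilinJordan.snd_mul, BilinJordan.fst_mul, BilinJordan.snd_mul]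
        simp only [a']
        match_scalars
        linear_combination h1 + n⁻¹ * (-hndef)
    obtain ⟨y, hy⟩ := hψsurj g⁻¹ (a' ⊗ₜ t) (Submodule.apply_mem_map₂ (TensorProduct.mk k _ S) ha' ht)
    refine ⟨y, hψinj ?_, hψinj ?_⟩
    · rw [hψmul, hψ1, ← hxa, hy, Algebra.TensorProduct.tmul_mul_tmul, haa, hst,
        Algebra.TensorProduct.one_def]
    · rw [hψmul, hψmul, ← hxa, hy, Algebra.TensorProduct.tmul_mul_tmul,
        Algebra.TensorProduct.tmul_mul_tmul, haaa, mul_assoc, hst, mul_one]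

end Division

section StdForm

variable {k Q : Type*} [Field k] [CommGroup Q] {κ : Q → ℕ} {ε : Q → ℕ → k}

theorem mem_twoTorsion {q : Q} : q ∈ twoTorsion Q ↔ q⁻¹ = q := by
  rw [twoTorsion, MonoidHom.mem_ker, powMonoidHom_apply, sq, mul_eq_one_iff_inv_eq]

theorem eq_sum_of_mem_stdGrading {q : Q} {v : StdSpace k κ} (hv : v ∈ stdGrading k κ q) :
    v = ∑ i : Fin (κ q), Finsupp.single ⟨q, i⟩ (v ⟨q, i⟩) := by
  classical
  ext ⟨r, j⟩
  rw [Finsupp.finsetSum_apply]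
  by_cases hqr : q = r
  · subst hqr
    rw [Finset.sum_eq_single j]
    · rw [Finsupp.single_eq_same]
    · intro i _ hij
      exact Finsupp.single_eq_of_ne fun h => hij (by simpa using h.symm)
    · simp
  · rw [Finset.sum_eq_zero fun i _ => Finsupp.single_eq_of_ne fun h => hqr
      (congrArg Sigma.fst h).symm]
    by_contra h
    exact hqr (hv (Finsupp.mem_support_iff.2 h)).symm

theorem stdForm_self {q : Q} {v : StdSpace k κ} (hv : v ∈ stdGrading k κ q) :
    stdForm κ ε v v =
      open Classical in if q⁻¹ = q then ∑ i : Fin (κ q), ε q i * v ⟨q, i⟩ ^ 2 else 0 := by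
  classical
  conv_lhs => rw [eq_sum_of_mem_stdGrading hv]
  simp only [map_sum, LinearMap.sum_apply, stdForm_single]
  by_cases hq : q⁻¹ = q
  · rw [if_pos hq]
    refine Finset.sum_congr rfl fun i _ => ?_
    rw [Finset.sum_eq_single i]
    · rw [if_pos ⟨hq.symm, rfl⟩]
      ring
    · intro j _ hij
      rw [if_neg fun h => hij (Fin.ext h.2.symm), mul_zero]
    · simp
  · rw [if_neg hq]
    exact Finset.sum_eq_zero fun i _ => Finset.sum_eq_zero fun j _ => by
      rw [if_neg fun h => hq h.1.symm, mul_zero]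

theorem single_mem_stdGrading {q : Q} (i : Fin (κ q)) (c : k) :
    Finsupp.single ⟨q, i⟩ c ∈ stdGrading k κ q :=
  Finsupp.single_mem_supported k c rfl

theorem inr_mem_grading {q : Q} {v : StdSpace k κ} (hv : v ∈ stdGrading k κ q) :
    BilinJordan.inr (stdForm κ ε) v ∈ BilinJordan.grading (stdForm κ ε) (stdGrading k κ) q :=
  ⟨zero_mem _, hv⟩

theorem eq_zero_of_mem_stdGrading {q : Q} {v : StdSpace k κ} (hv : v ∈ stdGrading k κ q)
    (h : ∀ i, v ⟨q, i⟩ = 0) : v = 0 := by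
  rw [eq_sum_of_mem_stdGrading hv]
  exact Finset.sum_eq_zero fun i _ => by rw [h, Finsupp.single_zero]

theorem fst_eq_zero_of_mem_grading {q : Q} (hq : q ≠ 1) {a : BilinJordan (stdForm κ ε)}
    (ha : a ∈ BilinJordan.grading (stdForm κ ε) (stdGrading k κ) q) : a.fst = 0 := by
  have h : a.fst ∈ trivialGrading k Q q := ha.1
  rwa [trivialGrading, if_neg hq, Submodule.mem_bot] at h

/-- Every nonzero homogeneous element of `𝒥(V, b)` has nonzero norm. -/
def IsNormAnisotropic (κ : Q → ℕ) (ε : Q → ℕ → k) : Prop :=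
  ∀ q, ∀ a ∈ BilinJordan.grading (stdForm κ ε) (stdGrading k κ) q, a ≠ 0 →
    a.fst * a.fst ≠ stdForm κ ε a.snd a.snd

theorem IsNormAnisotropic.form_ne_zero (h : IsNormAnisotropic κ ε) {q : Q} {v : StdSpace k κ}
    (hv : v ∈ stdGrading k κ q) (hv0 : v ≠ 0) : stdForm κ ε v v ≠ 0 := by
  have := h q _ (inr_mem_grading hv) fun h0 => hv0 (congrArg BilinJordan.snd h0)
  intro h0
  refine this ?_
  change (0 : k) * 0 = stdForm κ ε v v
  rw [h0, mul_zero]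

/-- For q² ≠ 1 the space V_q pairs only with V_{q⁻¹}, so it is totally isotropic. -/
theorem IsNormAnisotropic.mem_twoTorsion (h : IsNormAnisotropic κ ε) {q : Q} (hq : κ q ≠ 0) :
    q ∈ twoTorsion Q := by
  by_contra hq2
  rw [GradedJordan.mem_twoTorsion] at hq2
  have hv := single_mem_stdGrading (k := k) (⟨0, Nat.pos_of_ne_zero hq⟩ : Fin (κ q)) 1
  refine h.form_ne_zero hv (by simp) ?_
  rw [stdForm_self hv, if_neg hq2]

/-- In degree `1`, no vector has square `1`. -/
theorem IsNormAnisotropic.form_ne_one (h : IsNormAnisotropic κ ε) {v : StdSpace k κ}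
    (hv : v ∈ stdGrading k κ 1) : stdForm κ ε v v ≠ 1 := by
  have := h 1 ⟨1, v⟩ ⟨by simp [trivialGrading], hv⟩ fun h0 => one_ne_zero (α := k)
    (congrArg BilinJordan.fst h0)
  intro h1
  exact this (by rw [h1, mul_one])

end StdForm

section Real

variable {Q : Type*} [CommGroup Q] {κ : Q → ℕ} {σ : twoTorsion Q → ℤ}

theorem stdSign_of_mem (κ : Q → ℕ) (σ : twoTorsion Q → ℤ) (q : twoTorsion Q) (i : ℕ) :
    stdSign κ σ q i = if 2 * (i : ℤ) < κ q + σ q then 1 else -1 := by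
  rw [stdSign, dif_pos q.2]

theorem stdForm_pair {k : Type*} [Field k] {ε : Q → ℕ → k} {q : Q} (hq : q⁻¹ = q) {i j : Fin (κ q)}
    (hij : i ≠ j) (c d : k) :
    stdForm κ ε (Finsupp.single ⟨q, i⟩ c + Finsupp.single ⟨q, j⟩ d)
      (Finsupp.single ⟨q, i⟩ c + Finsupp.single ⟨q, j⟩ d) =
    ε q i * c ^ 2 + ε q j * d ^ 2 := by
  have hij' : (i : ℕ) ≠ j := fun h => hij (Fin.ext h)
  simp only [map_add, LinearMap.add_apply, stdForm_single]
  rw [if_pos ⟨hq.symm, rfl⟩, if_neg fun h => hij' h.2, if_neg fun h => hij' h.2.symm,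
    if_pos ⟨hq.symm, rfl⟩]
  ring

/-- Away from degree one the norm is −b(v, v), so each form must be definite. In degree one it is c²
− b(v, v), so the form must be negative definite. -/
theorem isNormAnisotropic_stdSign_iff (hσ : IsSignature κ σ) :
    IsNormAnisotropic κ (stdSign κ σ) ↔
      (∀ q, κ q ≠ 0 → q ∈ twoTorsion Q) ∧ (∀ q, |σ q| = κ q) ∧ σ 1 = -(κ 1 : ℤ) := by
  classical
  constructor
  · intro h
    have habs : ∀ q, |σ q| = κ q := by
      intro q
      by_contra hne
      obtain ⟨h1, h2⟩ := hσ q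
      have h3 : |σ q| < κ q := lt_of_le_of_ne h1 hne
      rw [abs_lt] at h3
      rw [Int.modEq_iff_dvd] at h2
      -- Parity excludes dimension one. Both signs occur, so the first basis vector is positive, the
      -- last is negative, and their sum is isotropic.
      have h4 : 2 ≤ κ q := by omega
      have hij : (⟨0, by omega⟩ : Fin (κ q)) ≠ ⟨κ q - 1, by omega⟩ := by
        intro h
        rw [Fin.mk.injEq] at h
        omega
      refine h.form_ne_zero (q := q) (v := Finsupp.single ⟨q, ⟨0, by omega⟩⟩ 1 +
        Finsupp.single ⟨q, ⟨κ q - 1, by omega⟩⟩ 1)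
        (add_mem (single_mem_stdGrading _ _) (single_mem_stdGrading _ _)) ?_ ?_
      · intro h0
        have := DFunLike.congr_fun h0 (⟨q, ⟨0, by omega⟩⟩ : Σ q, Fin (κ q))
        rw [Finsupp.add_apply, Finsupp.single_eq_same, Finsupp.single_eq_of_ne, add_zero] at this
        · exact one_ne_zero this
        · intro h
          exact hij (by simpa using h)
      · rw [stdForm_pair (mem_twoTorsion.1 q.2) hij, stdSign_of_mem, stdSign_of_mem,
          if_pos (by simp only []; omega), if_neg (by simp only []; omega)]
        norm_num
    refine ⟨fun q hq => h.mem_twoTorsion hq, habs, ?_⟩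
    by_contra hne
    have h1 := habs 1
    have h2 : σ 1 = κ 1 := by
      rcases abs_choice (σ 1) with h3 | h3
      · rw [← h3, h1]; rfl
      · exact absurd (by rw [← neg_neg (σ 1), ← h3, h1]; rfl) hne
    have h3 : 0 < κ 1 := by
      rcases Nat.eq_zero_or_pos (κ 1) with h0 | h0
      · rw [h2, h0] at hne
        simp at hne
      · exact h0
    have hv := single_mem_stdGrading (k := ℝ) (⟨0, h3⟩ : Fin (κ 1)) 1
    refine h.form_ne_one hv ?_
    have hsgn : stdSign κ σ 1 0 = 1 := by
      refine (stdSign_of_mem κ σ 1 0).trans (if_pos ?_)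
      rw [h2]
      change 2 * ((0 : ℕ) : ℤ) < κ 1 + κ 1
      omega
    rw [stdForm_single, if_pos ⟨inv_one.symm, rfl⟩, one_mul, one_mul]
    exact hsgn
  · rintro ⟨hκ, habs, h1⟩ q a ha ha0 hn
    have hv : a.snd ∈ stdGrading ℝ κ q := ha.2
    -- A form with constant sign `δ` has no norm zeros if the scalar part is absent or if `δ = -1`,
    -- because then only squares of one sign are added.
    have hfin : ∀ δ : ℝ, δ ≠ 0 → (∀ i < κ q, q⁻¹ = q → stdSign κ σ q i = δ) →
        (a.fst = 0 ∨ δ = -1) → a = 0 := by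
      intro δ hδ hsgn hor
      rw [stdForm_self hv] at hn
      have hzero : a.fst = 0 ∧ ∀ i, a.snd ⟨q, i⟩ = 0 := by
        by_cases hq : q⁻¹ = q
        · rw [if_pos hq, Finset.sum_congr rfl fun i _ => by rw [hsgn i i.2 hq],
            ← Finset.mul_sum] at hn
          have hs0 : ∀ i ∈ Finset.univ, 0 ≤ a.snd (⟨q, i⟩ : Σ q, Fin (κ q)) ^ 2 :=
            fun i _ => sq_nonneg _
          have hsn := Finset.sum_nonneg hs0
          have hs : ∑ i : Fin (κ q), a.snd ⟨q, i⟩ ^ 2 = 0 := by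
            rcases hor with h | h
            · rw [h, mul_zero, eq_comm, mul_eq_zero] at hn
              exact hn.resolve_left hδ
            · rw [h] at hn
              nlinarith [mul_self_nonneg a.fst]
          refine ⟨?_, fun i => ?_⟩
          · rw [hs, mul_zero] at hn
            exact mul_self_eq_zero.1 hn
          · exact pow_eq_zero_iff two_ne_zero |>.1
              ((Finset.sum_eq_zero_iff_of_nonneg hs0).1 hs i (Finset.mem_univ i))
        · rw [if_neg hq] at hn
          refine ⟨mul_self_eq_zero.1 hn, fun i => ?_⟩
          exact absurd (mem_twoTorsion.1 (hκ q fun h0 => (Fin.cast h0 i).elim0)) hq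
      exact BilinJordan.ext hzero.1 (eq_zero_of_mem_stdGrading hv hzero.2)
    by_cases hq1 : q = 1
    · subst hq1
      refine ha0 (hfin (-1) (by norm_num) (fun i hi _ => ?_) (Or.inr rfl))
      have := stdSign_of_mem κ σ 1 i
      rw [h1] at this
      rw [if_neg] at this
      · exact this
      · change ¬ 2 * (i : ℤ) < κ 1 + -(κ 1)
        omega
    · have hf := fst_eq_zero_of_mem_grading hq1 ha
      by_cases hq : q ∈ twoTorsion Q
      · rcases abs_choice (σ ⟨q, hq⟩) with h3 | h3
        · refine ha0 (hfin 1 one_ne_zero (fun i hi _ => ?_) (Or.inl hf))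
          have := stdSign_of_mem κ σ ⟨q, hq⟩ i
          rw [← h3, habs] at this
          rwa [if_pos (by simp only []; omega)] at this
        · refine ha0 (hfin (-1) (by norm_num) (fun i hi _ => ?_) (Or.inl hf))
          have := stdSign_of_mem κ σ ⟨q, hq⟩ i
          rw [← neg_neg (σ ⟨q, hq⟩), ← h3, habs] at this
          rwa [if_neg (by simp only []; omega)] at this
      · exact ha0 (hfin 1 one_ne_zero (fun i hi h => absurd (mem_twoTorsion.2 h) hq) (Or.inl hf))

end Real

section Complex

variable {Q : Type*} [CommGroup Q] {κ : Q → ℕ}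

/-- In dimension at least two, the sum of one unit vector and `Complex.I` times another is
isotropic; in degree one a unit vector `v` makes 1 + v a norm zero. -/
theorem isNormAnisotropic_complex_iff :
    IsNormAnisotropic κ (fun _ _ => (1 : ℂ)) ↔
      (∀ q, κ q ≠ 0 → q ∈ twoTorsion Q) ∧ (∀ q ∈ twoTorsion Q, κ q = 0 ∨ κ q = 1) ∧ κ 1 = 0 := by
  classical
  constructor
  · refine fun h => ⟨fun q hq => h.mem_twoTorsion hq, fun q hq => ?_, ?_⟩
    · by_contra! hne
      have hij : (⟨0, by omega⟩ : Fin (κ q)) ≠ ⟨1, by omega⟩ := by simp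
      refine h.form_ne_zero (q := q) (v := Finsupp.single ⟨q, ⟨0, by omega⟩⟩ 1 +
        Finsupp.single ⟨q, ⟨1, by omega⟩⟩ Complex.I)
        (add_mem (single_mem_stdGrading _ _) (single_mem_stdGrading _ _)) ?_ ?_
      · intro h0
        have := DFunLike.congr_fun h0 (⟨q, ⟨0, by omega⟩⟩ : Σ q, Fin (κ q))
        rw [Finsupp.add_apply, Finsupp.single_eq_same, Finsupp.single_eq_of_ne, add_zero] at this
        · exact one_ne_zero this
        · intro h
          simp at h
      · rw [stdForm_pair (mem_twoTorsion.1 hq) hij]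
        simp
    · by_contra h0
      refine h.form_ne_one (single_mem_stdGrading (⟨0, Nat.pos_of_ne_zero h0⟩ : Fin (κ 1)) 1) ?_
      rw [stdForm_single, if_pos ⟨inv_one.symm, rfl⟩, one_mul, one_mul]
  · rintro ⟨hκ, hκ1, h1⟩ q a ha ha0 hn
    have hv : a.snd ∈ stdGrading ℂ κ q := ha.2
    by_cases h0 : κ q = 0
    · have hv0 : a.snd = 0 := eq_zero_of_mem_stdGrading hv fun i => (Fin.cast h0 i).elim0
      rw [hv0, map_zero] at hn
      exact ha0 (BilinJordan.ext (mul_self_eq_zero.1 hn) hv0)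
    · have hq := hκ q h0
      have hq1 : κ q = 1 := (hκ1 q hq).resolve_left h0
      have hf := fst_eq_zero_of_mem_grading (fun h : q = 1 => h0 (h ▸ h1)) ha
      refine ha0 (BilinJordan.ext hf (eq_zero_of_mem_stdGrading hv fun i => ?_))
      rw [stdForm_self hv, if_pos (mem_twoTorsion.1 hq), hf, mul_zero,
        Finset.sum_eq_single i (fun j _ hj => absurd (Fin.ext (by omega)) hj) (by simp), one_mul,
        eq_comm] at hn
      exact (pow_eq_zero_iff two_ne_zero).1 hn

end Complex

/-! ### Characters and embeddings of the center into group algebras. -/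

section Characters

/-- The circle group is divisible, hence characters extend from subgroups of abelian groups. -/
theorem exists_character_extension {G : Type*} [CommGroup G] (H : Subgroup G) (χ : H →* Circle) :
    ∃ ψ : G →* Circle, ∀ h : H, ψ h = χ h := by
  let _ : DivisibleBy (Additive Circle) ℤ :=
    { div := fun z n => Additive.ofMul (Circle.exp (Complex.arg (z.toMul : ℂ) / n))
      div_zero := fun z => by simp
      div_cancel := fun {n} z hn => by
        change Additive.ofMul (Circle.exp (Complex.arg (z.toMul : ℂ) / n) ^ n) = z
        rw [← Circle.exp_zsmul, zsmul_eq_mul, mul_div_cancel₀ _ (Int.cast_ne_zero.2 hn),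
          Circle.exp_arg]
        rfl }
  obtain ⟨ψ, hψ⟩ := (Module.Baer.of_divisible (Additive Circle)).extension_property_addMonoidHom
    (MonoidHom.toAdditive H.subtype) (fun x y h => Subtype.ext h) (MonoidHom.toAdditive χ)
  exact ⟨MonoidHom.toAdditive.symm ψ, fun h => DFunLike.congr_fun hψ (Additive.ofMul h)⟩

end Characters

section Frames

variable {G : Type*} [CommGroup G]

theorem isLoopFrame_groupAlgebraComponent (k : Type*) [CommRing k] :
    IsLoopFrame (groupAlgebraComponent k (G := G)) where
  one_mem := ⟨1, rfl⟩
  mul_mem := groupAlgebraComponent_mul_mem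
  exists_unit g := by
    refine ⟨MonoidAlgebra.single g 1, ⟨1, rfl⟩, MonoidAlgebra.single g⁻¹ 1, ⟨1, rfl⟩, ?_, ?_⟩
    · rw [MonoidAlgebra.single_mul_single, mul_inv_cancel, mul_one, MonoidAlgebra.one_def]
    · rintro _ ⟨c, rfl⟩
      exact ⟨c, by simp⟩

theorem single_mem_twistedComponent {χ : G →* Circle} {g : G} {z : ℂ}
    (hz : z = (starRingEnd ℂ) z * χ g) : MonoidAlgebra.single g z ∈ twistedComponent χ g :=
  ⟨z, hz, rfl⟩

theorem isLoopFrame_twistedComponent (χ : G →* Circle) : IsLoopFrame (twistedComponent χ) where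
  one_mem := ⟨1, by simp, rfl⟩
  mul_mem := twistedComponent_mul_mem χ
  exists_unit g := by
    -- On the unit circle the quotient of `z` by its conjugate is `z * z`, so a square root of `χ g`
    -- spans the line.
    obtain ⟨z, hz⟩ : ∃ z : Circle, z * z = χ g := by
      refine ⟨Circle.exp (Complex.arg (χ g : ℂ) / 2), ?_⟩
      rw [← Circle.exp_add, add_halves, Circle.exp_arg]
    have hzc : (starRingEnd ℂ) (z : ℂ) = ((z⁻¹ : Circle) : ℂ) := (Circle.coe_inv_eq_conj z).symm
    have hzz : (z : ℂ) * ((z⁻¹ : Circle) : ℂ) = 1 := by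
      rw [← Circle.coe_mul, mul_inv_cancel, Circle.coe_one]
    refine ⟨MonoidAlgebra.single g (z : ℂ), single_mem_twistedComponent ?_,
      MonoidAlgebra.single g⁻¹ ((z⁻¹ : Circle) : ℂ), single_mem_twistedComponent ?_, ?_, ?_⟩
    · rw [hzc, ← Circle.coe_mul, ← hz, inv_mul_cancel_left]
    · rw [← Circle.coe_inv_eq_conj, ← Circle.coe_mul, inv_inv, map_inv, ← hz, mul_inv,
        mul_inv_cancel_left]
    · rw [MonoidAlgebra.single_mul_single, mul_inv_cancel, hzz, MonoidAlgebra.one_def]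
    · rintro _ ⟨w, hw, rfl⟩
      have hreal : (starRingEnd ℂ) (w * ((z⁻¹ : Circle) : ℂ)) = w * ((z⁻¹ : Circle) : ℂ) := by
        rw [map_mul, ← Circle.coe_inv_eq_conj, inv_inv]
        conv_rhs => rw [hw, ← hz, Circle.coe_mul, mul_assoc, mul_assoc, hzz, mul_one]
      obtain ⟨r, hr⟩ := Complex.conj_eq_iff_real.1 hreal
      refine ⟨r, ?_⟩
      rw [MonoidAlgebra.smul_single, Complex.real_smul, ← hr, mul_assoc, mul_comm _ (z : ℂ), hzz,
        mul_one]

end Frames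

section Coaction

theorem exists_algHom_of_finite (k L K : Type*) [Field k] [CommRing L] [Nontrivial L] [Algebra k L]
    [Module.Finite k L] [Field K] [IsAlgClosed K] [Algebra k K] : Nonempty (L →ₐ[k] K) := by
  obtain ⟨I, hI⟩ := Ideal.exists_maximal L
  let _ : Field (L ⧸ I) := Ideal.Quotient.field I
  have : Algebra.IsAlgebraic k (L ⧸ I) := Algebra.IsAlgebraic.of_finite k (L ⧸ I)
  exact ⟨(IsAlgClosed.lift (R := k) (S := L ⧸ I) (M := K)).comp (Ideal.Quotient.mkₐ k I)⟩

variable {k G Q B K : Type*} [Field k] [CommGroup G] [CommGroup Q] [NonAssocCommRing B]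
  [Module k B] [SMulCommClass k B B] [IsScalarTower k B B] [Field K] [Algebra k K]
  {𝓑 : G → Submodule k B} [IsGrading 𝓑] {π : G →* Q}

/-- A character of the center and its grading give a homomorphism to the group algebra. -/
theorem exists_coaction (𝓑 : G → Submodule k B) [IsGrading 𝓑] (φ : Center k B →ₐ[k] K) :
    ∃ Φ : Center k B →ₐ[k] MonoidAlgebra K G,
      ∀ g, ∀ z ∈ centerGrading 𝓑 g, Φ z = MonoidAlgebra.single g (φ z) := by
  obtain ⟨F, hF⟩ := IsGrading.exists_linearMap (centerGrading 𝓑) fun g =>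
    (MonoidAlgebra.lsingle g : K →ₗ[k] MonoidAlgebra K G) ∘ₗ φ.toLinearMap
  replace hF : ∀ g, ∀ z ∈ centerGrading 𝓑 g, F z = MonoidAlgebra.single g (φ z) := hF
  have h1 : F 1 = 1 := by
    rw [hF 1 1 (IsGrading.one_mem 𝓑), map_one, MonoidAlgebra.one_def]
  have hmul : ∀ x y, F (x * y) = F x * F y := by
    intro x y
    revert x
    refine IsGrading.induction (centerGrading 𝓑) (by simp) (fun g x hx => ?_)
      fun x x' h h' => by rw [add_mul, map_add, h, h', map_add, add_mul]
    revert y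
    refine IsGrading.induction (centerGrading 𝓑) (by simp) (fun h y hy => ?_)
      fun y y' h h' => by rw [mul_add, map_add, h, h', map_add, mul_add]
    rw [hF _ _ (IsGrading.mul_mem hx hy), hF g x hx, hF h y hy, MonoidAlgebra.single_mul_single,
      map_mul]
  exact ⟨AlgHom.ofLinearMap F h1 hmul, hF⟩

theorem IsGradedCentral.apply_ne_zero (hc : IsGradedCentral 𝓑 π) (φ : Center k B →ₐ[k] K) {g : G}
    {z : Center k B} (hz : z ∈ centerGrading 𝓑 g) (hz0 : z ≠ 0) : φ z ≠ 0 := by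
  obtain ⟨w, -, hzw⟩ := hc.exists_inv hz hz0
  intro h
  have := congrArg φ hzw
  rw [map_mul, h, zero_mul, map_one] at this
  exact zero_ne_one this

/-- The coefficient of `Φ z` at `g` is φ of the component of `z`, and φ cannot kill a homogeneous
unit, even if φ is not injective. -/
theorem IsGradedCentral.coaction_injective (hc : IsGradedCentral 𝓑 π) {φ : Center k B →ₐ[k] K}
    {Φ : Center k B →ₐ[k] MonoidAlgebra K G}
    (hΦ : ∀ g, ∀ z ∈ centerGrading 𝓑 g, Φ z = MonoidAlgebra.single g (φ z)) :
    Function.Injective Φ := by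
  classical
  have key : ∀ g z, (Φ z).coeff g = φ (IsGrading.proj (centerGrading 𝓑) g z) := by
    intro g
    refine IsGrading.induction (centerGrading 𝓑) (by simp) (fun h z hz => ?_)
      fun z w hz hw => by rw [map_add, MonoidAlgebra.coeff_add, Finsupp.add_apply, hz, hw, map_add,
        map_add]
    rw [hΦ h z hz, MonoidAlgebra.coeff_single, Finsupp.single_apply]
    by_cases hgh : h = g
    · subst hgh
      rw [if_pos rfl, IsGrading.proj_of_mem hz]
    · rw [if_neg hgh, IsGrading.proj_of_mem_ne hz hgh, map_zero]
  refine (injective_iff_map_eq_zero Φ).2 fun z hz => IsGrading.ext_proj (centerGrading 𝓑) fun g => ?_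
  rw [map_zero]
  by_contra h0
  refine hc.apply_ne_zero φ (IsGrading.proj_mem _ g z) h0 ?_
  rw [← key, hz]
  rfl

end Coaction

section TwistedLoop

variable {G Q B : Type*} [CommGroup G] [CommGroup Q] [NonAssocCommRing B]
  [Module ℝ B] [SMulCommClass ℝ B B] [IsScalarTower ℝ B B] [Nontrivial B]
  {𝓑 : G → Submodule ℝ B} [IsGrading 𝓑] {π : G →* Q}

theorem smul_eq_conj_mul (c : ℝ) {w ζ : ℂ} (h : w = (starRingEnd ℂ) w * ζ) :
    c • w = (starRingEnd ℂ) (c • w) * ζ := by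
  rw [Complex.real_smul, map_mul, Complex.conj_ofReal, mul_assoc, ← h]

/-- A character `φ` of the center determines a character `χ` of `G` with
`φ z = conj (φ z) * χ g` for `z` of degree `g`. -/
theorem IsGradedCentral.exists_character (hc : IsGradedCentral 𝓑 π) (φ : Center ℝ B →ₐ[ℝ] ℂ) :
    ∃ χ : G →* Circle, ∀ g, ∀ z ∈ centerGrading 𝓑 g, φ z = (starRingEnd ℂ) (φ z) * χ g := by
  choose u hu v hv huv using hc.exists_unit
  have hker : ∀ h : π.ker, π h = 1 := fun h => h.2
  have hu0 : ∀ h : π.ker, u h ≠ 0 := fun h h0 => by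
    have := huv h (hker h)
    rw [h0, zero_mul] at this
    exact zero_ne_one (congrArg Subtype.val this)
  have hφ : ∀ h : π.ker, φ (u h) ≠ 0 := fun h => hc.apply_ne_zero φ (hu h) (hu0 h)
  -- The quotient of `φ (u h)` by its conjugate. Real multiples of `u h` give the same quotient, so
  -- any nonzero element of the line computes it; multiplicativity follows by using `u g * u h`.
  let χ₀ : π.ker → Circle := fun h => (Circle.ofConjDivSelf (φ (u h)) (hφ h))⁻¹
  have hχ₀ : ∀ h : π.ker, (χ₀ h : ℂ) = φ (u h) / (starRingEnd ℂ) (φ (u h)) := fun h => by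
    rw [Circle.coe_inv, Circle.ofConjDivSelf_coe, inv_div]
  have hconj : ∀ h : π.ker, (starRingEnd ℂ) (φ (u h)) ≠ 0 := fun h => by
    rw [ne_eq, map_eq_zero]; exact hφ h
  have key : ∀ (h : π.ker), ∀ z ∈ centerGrading 𝓑 (h : G),
      φ z = (starRingEnd ℂ) (φ z) * χ₀ h := by
    intro h z hz
    obtain ⟨ρ, hρ⟩ := hc.exists_coordinate (hu h) (hu0 h)
    rw [hρ z hz, map_smul]
    refine smul_eq_conj_mul _ ?_
    rw [hχ₀, mul_div_cancel₀ _ (hconj h)]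
  have huniq : ∀ (h : π.ker) (ζ : Circle), (∃ z ∈ centerGrading 𝓑 (h : G), z ≠ 0 ∧
      φ z = (starRingEnd ℂ) (φ z) * ζ) → χ₀ h = ζ := by
    rintro h ζ ⟨z, hz, hz0, hzζ⟩
    have h1 := key h z hz
    conv_lhs at h1 => rw [hzζ]
    refine Circle.ext (mul_left_cancel₀ ?_ h1).symm
    rw [ne_eq, map_eq_zero]
    exact hc.apply_ne_zero φ hz hz0
  let χ₁ : π.ker →* Circle :=
    { toFun := χ₀
      map_one' := huniq 1 1 ⟨1, IsGrading.one_mem 𝓑,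
        fun h => one_ne_zero (congrArg Subtype.val h), by simp⟩
      map_mul' := fun g h => huniq (g * h) _ ⟨u g * u h, IsGrading.mul_mem (hu g) (hu h), fun h0 => by
          have := congrArg φ h0
          rw [map_mul, map_zero] at this
          exact mul_ne_zero (hφ g) (hφ h) this, by
          rw [map_mul, map_mul, Circle.coe_mul, mul_mul_mul_comm, ← key g _ (hu g),
            ← key h _ (hu h)]⟩ }
  -- The extension may be arbitrary off the kernel, where the center has no components.
  obtain ⟨χ, hχ⟩ := exists_character_extension π.ker χ₁
  refine ⟨χ, fun g z hz => ?_⟩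
  by_cases hg : π g = 1
  · have := key ⟨g, hg⟩ z hz
    rwa [show χ₀ ⟨g, hg⟩ = χ g from (hχ ⟨g, hg⟩).symm] at this
  · rw [hc.eq_zero_of_mem hg hz]
    simp

theorem IsGradedCentral.exists_twistedLoop [FiniteDimensional ℝ B] (hc : IsGradedCentral 𝓑 π) :
    ∃ χ : G →* Circle,
      GradedIsomorphic (centerGrading 𝓑) (twistedLoopGrading π χ (trivialGrading ℝ Q)) := by
  have : Nontrivial (Center ℝ B) := ⟨1, 0, fun h => one_ne_zero (congrArg Subtype.val h)⟩
  obtain ⟨φ⟩ := exists_algHom_of_finite ℝ (Center ℝ B) ℂ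
  obtain ⟨χ, hχ⟩ := hc.exists_character φ
  obtain ⟨Φ, hΦ⟩ := exists_coaction 𝓑 φ
  have hinj := hc.coaction_injective hΦ
  have hΦD : ∀ g, ∀ z ∈ centerGrading 𝓑 g, Φ z ∈ twistedComponent χ g := fun g z hz => by
    rw [hΦ g z hz]
    exact single_mem_twistedComponent (hχ g z hz)
  refine ⟨χ, gradedIsomorphic_of_map_eq (IsGrading.iSup_eq_top (𝓐 := centerGrading 𝓑))
    (twistedComponent_mul_mem χ) (TensorProduct.mk ℝ ℝ (MonoidAlgebra ℂ G) 1 ∘ₗ Φ.toLinearMap)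
    ?_ ?_ ?_⟩
  · intro x y hxy
    have := congrArg (TensorProduct.lid ℝ (MonoidAlgebra ℂ G)) hxy
    simp only [LinearMap.comp_apply, TensorProduct.mk_apply, TensorProduct.lid_tmul, one_smul] at this
    exact hinj this
  · intro x y
    simp
  · intro g
    refine le_antisymm ?_ (Submodule.map₂_le.2 ?_)
    · rintro _ ⟨z, hz, rfl⟩
      by_cases hg : π g = 1
      · refine Submodule.apply_mem_map₂ (TensorProduct.mk ℝ ℝ _) ?_ (hΦD g z hz)
        simp [trivialGrading, hg]
      · rw [hc.eq_zero_of_mem hg hz, map_zero]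
        exact zero_mem _
    · intro a ha d hd
      by_cases hg : π g = 1
      · obtain ⟨z, hz, rfl⟩ :=
          (isLoopFrame_twistedComponent χ).exists_apply_eq Φ hc hinj hΦD hg hd
        refine ⟨a • z, Submodule.smul_mem _ _ hz, ?_⟩
        rw [map_smul, LinearMap.comp_apply, TensorProduct.mk_apply, TensorProduct.mk_apply,
          TensorProduct.smul_tmul', smul_eq_mul, mul_one]
        rfl
      · rw [trivialGrading, if_neg hg, Submodule.mem_bot] at ha
        rw [ha, TensorProduct.mk_apply, TensorProduct.zero_tmul]
        exact zero_mem _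

/-- The embedding must come from the given isomorphism, since the parameters are sought for every
admissible χ. -/
theorem exists_algHom_of_twistedLoop {χ : G →* Circle}
    (h : GradedIsomorphic (centerGrading 𝓑) (twistedLoopGrading π χ (trivialGrading ℝ Q))) :
    ∃ Φ : Center ℝ B →ₐ[ℝ] MonoidAlgebra ℂ G, Function.Injective Φ ∧
      ∀ g, ∀ z ∈ centerGrading 𝓑 g, Φ z ∈ twistedComponent χ g := by
  obtain ⟨f, hmul, hg⟩ := h
  let ι := (twistedLoopAlgebra π χ (trivialGrading ℝ Q)).toSubmodule.subtype
  let F : Center ℝ B →ₗ[ℝ] MonoidAlgebra ℂ G :=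
    (TensorProduct.lid ℝ (MonoidAlgebra ℂ G)).toLinearMap ∘ₗ ι ∘ₗ f.toLinearMap
  have hF : ∀ z, F z = TensorProduct.lid ℝ (MonoidAlgebra ℂ G) (f z) := fun _ => rfl
  have hFinj : Function.Injective F := (TensorProduct.lid ℝ (MonoidAlgebra ℂ G)).injective.comp
    (Subtype.val_injective.comp f.injective)
  have hlid : ∀ x y : ℝ ⊗[ℝ] MonoidAlgebra ℂ G, TensorProduct.lid ℝ _ (x * y) =
      TensorProduct.lid ℝ _ x * TensorProduct.lid ℝ _ y :=
    map_mul (Algebra.TensorProduct.lid ℝ (MonoidAlgebra ℂ G))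
  have hFmul : ∀ x y, F (x * y) = F x * F y := fun x y => by
    rw [hF, hF, hF, ← hlid]
    exact congrArg (fun t : twistedLoopAlgebra π χ (trivialGrading ℝ Q) =>
      TensorProduct.lid ℝ (MonoidAlgebra ℂ G) (t : ℝ ⊗[ℝ] MonoidAlgebra ℂ G)) (hmul x y)
  have hFD : ∀ g, ∀ z ∈ centerGrading 𝓑 g, F z ∈ twistedComponent χ g := by
    intro g z hz
    have hle : loopComponent π (trivialGrading ℝ Q) (twistedComponent χ) g ≤
        (twistedComponent χ g).comap (TensorProduct.lid ℝ (MonoidAlgebra ℂ G)).toLinearMap :=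
      Submodule.map₂_le.2 fun a _ d hd => by
        rw [Submodule.mem_comap, TensorProduct.mk_apply, LinearEquiv.coe_coe,
          TensorProduct.lid_tmul]
        exact Submodule.smul_mem _ _ hd
    exact hle ((hg g z).1 hz)
  -- Graded isomorphisms are not assumed unital: the image of 1 is a nonzero idempotent of degree
  -- one, that is, a nonzero idempotent of ℂ.
  have hF1 : F 1 = 1 := by
    obtain ⟨w, -, hw⟩ := hFD 1 1 (IsGrading.one_mem 𝓑)
    have h1 : F 1 * F 1 = F 1 := by rw [← hFmul, one_mul]
    have h2 : F 1 ≠ 0 := fun h0 => one_ne_zero (α := B)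
      (congrArg Subtype.val (hFinj (h0.trans (map_zero F).symm)))
    rw [hw, MonoidAlgebra.single_mul_single, one_mul] at h1
    have h3 : w * w = w := by
      have := congrArg (fun t => t.coeff 1) h1
      simpa using this
    have hw0 : w ≠ 0 := by
      rintro rfl
      rw [MonoidAlgebra.single_zero] at hw
      exact h2 hw
    rw [hw, MonoidAlgebra.one_def, mul_left_cancel₀ hw0 (h3.trans (mul_one w).symm)]
  exact ⟨AlgHom.ofLinearMap F hF1 hFmul, hFinj, hFD⟩

end TwistedLoop

/-! ### Change of ground field. -/

section RestrictScalars

variable {k K G B : Type*} [CommRing k] [CommRing K] [Algebra k K] [CommGroup G]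
  [NonAssocCommRing B] [Module k B] [Module K B] [IsScalarTower k K B]

/-- The components of a `K`-graded algebra as subspaces over `k`. -/
abbrev restrictGrading (k : Type*) [CommRing k] [Algebra k K] [Module k B] [IsScalarTower k K B]
    (𝓑 : G → Submodule K B) : G → Submodule k B :=
  fun g => (𝓑 g).restrictScalars k

variable {𝓑 : G → Submodule K B}

theorem isGrading_of_restrictGrading (h : IsGrading (restrictGrading k 𝓑)) : IsGrading 𝓑 where
  indep g := by
    rw [Submodule.disjoint_def]
    intro x hx hx'
    refine Submodule.disjoint_def.1 (h.indep g) x hx ?_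
    rw [← Submodule.restrictScalars_mem k] at hx'
    simpa only [Submodule.restrictScalars_iSup] using hx'
  iSup_eq_top := by
    rw [← Submodule.restrictScalars_eq_top_iff k]
    simpa only [Submodule.restrictScalars_iSup] using h.iSup_eq_top
  mul_mem hx hy := h.mul_mem hx hy

theorem isGradedSimple_of_restrictGrading (h : IsGradedSimple (restrictGrading k 𝓑)) :
    IsGradedSimple 𝓑 := by
  refine ⟨h.1, fun I hI hg => ?_⟩
  rw [← Submodule.restrictScalars_eq_bot_iff (S := k), ← Submodule.restrictScalars_eq_top_iff k]
  refine h.2 _ hI ?_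
  conv_lhs => rw [hg]
  simp only [Submodule.restrictScalars_iSup]
  rfl

variable [SMulCommClass k B B] [IsScalarTower k B B] [SMulCommClass K B B] [IsScalarTower K B B]

variable (k K B) in
/-- The center does not depend on the ground ring. -/
def centerEquiv : Center k B ≃+* Center K B where
  toFun z := ⟨z.1, z.2⟩
  invFun z := ⟨z.1, z.2⟩
  map_mul' _ _ := rfl
  map_add' _ _ := rfl

theorem IsQuadraticModulo.center (h : IsQuadraticModulo (Center k B) B) :
    IsQuadraticModulo (Center K B) B := by
  obtain ⟨I, hI, h⟩ := h
  refine ⟨I.comap (centerEquiv k K B).symm, Ideal.comap_ne_top _ hI, fun x => ?_⟩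
  obtain ⟨a, b, hab⟩ := h x
  refine ⟨centerEquiv k K B a, centerEquiv k K B b, fun f => ?_⟩
  exact hab
    { toFun := fun y => (centerEquiv k K B).symm (f y)
      map_add' := fun y z => by rw [map_add, map_add]
      map_smul' := fun z y => congrArg (centerEquiv k K B).symm (f.map_smul (centerEquiv k K B z) y) }

theorem isGradedCentral_of_restrictGrading [IsGrading (restrictGrading k 𝓑)]
    (h : IsGradedSimple (restrictGrading k 𝓑))
    (h1 : ∀ u ∈ centerGrading 𝓑 1, ∃ c : K, u = algebraMap K _ c) :
    IsGradedCentral 𝓑 (QuotientGroup.mk' (centerSupport (restrictGrading k 𝓑))) where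
  surjective := QuotientGroup.mk'_surjective _
  exists_inv {g u} hu hu0 := by
    obtain ⟨v, hv, huv⟩ := h.exists_inv (u := (centerEquiv k K B).symm u) hu
      ((map_ne_zero_iff _ (RingEquiv.injective _)).2 hu0)
    exact ⟨centerEquiv k K B v, hv, congrArg (centerEquiv k K B) huv⟩
  apply_eq_one_iff g := by
    rw [QuotientGroup.mk'_apply, QuotientGroup.eq_one_iff, h.mem_centerSupport,
      Submodule.ne_bot_iff, Submodule.ne_bot_iff]
    constructor
    · rintro ⟨z, hz, hz0⟩
      exact ⟨centerEquiv k K B z, hz, (map_ne_zero_iff _ (RingEquiv.injective _)).2 hz0⟩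
    · rintro ⟨z, hz, hz0⟩
      exact ⟨(centerEquiv k K B).symm z, hz, (map_ne_zero_iff _ (RingEquiv.injective _)).2 hz0⟩
  exists_algebraMap := h1

end RestrictScalars

/-! ### The two classifications. -/

section RealParameters

variable {G B : Type*} [CommGroup G] [NonAssocCommRing B] [Module ℝ B] [SMulCommClass ℝ B B]
  [IsScalarTower ℝ B B] [FiniteDimensional ℝ B] {𝓑 : G → Submodule ℝ B} [IsGrading 𝓑]

theorem exists_hasRealParameters (hs : IsGradedSimple 𝓑) (h1 : CenterIdentityReal 𝓑)
    (hq : IsQuadraticModulo (Center ℝ B) B) {χ : G →* Circle} (hχ : CenterIsTwistedLoop 𝓑 χ) :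
    ∃ κ σ, HasRealParameters 𝓑 χ κ σ := by
  have := hs.nontrivial
  obtain ⟨Φ, hΦ, hΦD⟩ := exists_algHom_of_twistedLoop hχ
  obtain ⟨κ, ε, hκ, hε, hε', hiso⟩ := exists_gradedIsomorphic two_ne_zero hs
    (hs.isGradedCentral h1) hq (isLoopFrame_twistedComponent χ) hΦ hΦD
    fun W => hasDiagonalForms_real W
  choose p hp hpε using fun q : twoTorsion (G ⧸ centerSupport 𝓑) => hε q (mem_twoTorsion.1 q.2)
  -- There are `p` positive and `κ - p` negative entries; with this value `i < p` is the condition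
  -- `2 * i < κ + σ`.
  let σ : twoTorsion (G ⧸ centerSupport 𝓑) → ℤ := fun q => 2 * p q - κ q
  have hεσ : ε = stdSign κ σ := by
    funext q i
    by_cases h : q ∈ twoTorsion (G ⧸ centerSupport 𝓑)
    · rw [stdSign_of_mem κ σ ⟨q, h⟩, hpε ⟨q, h⟩]
      refine if_congr ?_ rfl rfl
      simp only [σ]
      omega
    · rw [stdSign, dif_neg h, hε' q fun h' => h (mem_twoTorsion.2 h')]
  subst hεσ
  refine ⟨κ, σ, hκ, fun q => ⟨?_, ?_⟩, hiso⟩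
  · have := hp q
    rw [abs_le]
    simp only [σ]
    omega
  · simp only [σ, Int.ModEq]
    omega

theorem HasRealParameters.isGradedDivision_iff {χ : G →* Circle}
    {κ : G ⧸ centerSupport 𝓑 → ℕ} {σ : twoTorsion (G ⧸ centerSupport 𝓑) → ℤ}
    (h : HasRealParameters 𝓑 χ κ σ) : IsGradedDivision 𝓑 ↔
      (∀ q, κ q ≠ 0 → q ∈ twoTorsion (G ⧸ centerSupport 𝓑)) ∧ (∀ q, |σ q| = κ q) ∧
        σ 1 = -(κ 1 : ℤ) := by
  obtain ⟨-, hσ, f, hmul, hf⟩ := h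
  rw [← isNormAnisotropic_stdSign_iff hσ]
  exact GradedJordan.isGradedDivision_iff (QuotientGroup.mk'_surjective _)
    (isLoopFrame_twistedComponent χ) f.toAddEquiv hmul hf

end RealParameters

section ComplexParameter

variable {G B : Type*} [CommGroup G] [NonAssocCommRing B] [Module ℝ B] [SMulCommClass ℝ B B]
  [IsScalarTower ℝ B B]

theorem HasComplexParameter.isGradedDivision_iff {𝓑 : G → Submodule ℝ B}
    {κ : G ⧸ centerSupport 𝓑 → ℕ} (h : HasComplexParameter 𝓑 κ) : IsGradedDivision 𝓑 ↔
      (∀ q, κ q ≠ 0 → q ∈ twoTorsion (G ⧸ centerSupport 𝓑)) ∧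
        (∀ q ∈ twoTorsion (G ⧸ centerSupport 𝓑), κ q = 0 ∨ κ q = 1) ∧ κ 1 = 0 := by
  obtain ⟨-, f, hmul, hf⟩ := h
  rw [← isNormAnisotropic_complex_iff]
  exact GradedJordan.isGradedDivision_iff (QuotientGroup.mk'_surjective _)
    (isLoopFrame_groupAlgebraComponent ℂ) f.toAddEquiv hmul hf

theorem exists_hasComplexParameter_restrictGrading [Module ℂ B] [IsScalarTower ℝ ℂ B]
    [SMulCommClass ℂ B B] [IsScalarTower ℂ B B] [FiniteDimensional ℂ B] {𝓑 : G → Submodule ℂ B}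
    [IsGrading (restrictGrading ℝ 𝓑)] (hs : IsGradedSimple (restrictGrading ℝ 𝓑))
    (h1 : ∀ u ∈ centerGrading 𝓑 1, ∃ c : ℂ, u = algebraMap ℂ _ c)
    (hq : IsQuadraticModulo (Center ℝ B) B) :
    ∃ κ, HasComplexParameter (restrictGrading ℝ 𝓑) κ := by
  have := hs.nontrivial
  have hg : IsGrading 𝓑 := isGrading_of_restrictGrading (k := ℝ) inferInstance
  have hc := isGradedCentral_of_restrictGrading hs h1
  have : Nontrivial (Center ℂ B) := ⟨0, 1, fun h => zero_ne_one (congrArg Subtype.val h)⟩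
  obtain ⟨φ⟩ := exists_algHom_of_finite ℂ (Center ℂ B) ℂ
  obtain ⟨Φ, hΦ⟩ := exists_coaction 𝓑 φ
  obtain ⟨κ, ε, hκ, hε, hε', f, hmul, hf⟩ := exists_gradedIsomorphic two_ne_zero
    (isGradedSimple_of_restrictGrading hs) hc hq.center (isLoopFrame_groupAlgebraComponent ℂ)
    (hc.coaction_injective hΦ) (fun g z hz => ⟨φ z, (hΦ g z hz).symm⟩)
    fun W => hasDiagonalForms_complex W
  have hε1 : ε = fun _ _ => 1 := by
    funext q
    by_cases h : q⁻¹ = q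
    · exact hε q h
    · exact hε' q h
  subst hε1
  exact ⟨κ, hκ, f.restrictScalars ℝ, hmul, hf⟩

/-- The copy of ℂ in the center acts by multiplication and has degree one, so every component is a
complex subspace and `B` is a graded complex algebra with the same center. The loop construction
over ℂ then needs no twist, since the lines of the group algebra are already complex. -/
theorem exists_hasComplexParameter [FiniteDimensional ℝ B] {𝓑 : G → Submodule ℝ B} [IsGrading 𝓑]
    (hs : IsGradedSimple 𝓑) (h1 : CenterIdentityComplex 𝓑)
    (hq : IsQuadraticModulo (Center ℝ B) B) : ∃ κ, HasComplexParameter 𝓑 κ := by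
  obtain ⟨f, -, hf⟩ := h1
  let _ : Module ℂ B := Module.compHom B f.toRingHom
  have hsmul : ∀ (c : ℂ) (x : B), c • x = (f c : B) * x := fun _ _ => rfl
  have : IsScalarTower ℝ ℂ B := ⟨fun r c x => by
    rw [hsmul, hsmul, map_smul]
    exact smul_mul_assoc r _ x⟩
  have : SMulCommClass ℂ B B := ⟨fun c x y => (f c).2.left_comm x y⟩
  have : IsScalarTower ℂ B B := ⟨fun c x y => ((f c).2.left_assoc x y).symm⟩
  have : FiniteDimensional ℂ B := FiniteDimensional.right ℝ ℂ B
  have hmem : ∀ c, (f c : B) ∈ 𝓑 1 := fun c => by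
    have : f c ∈ centerGrading 𝓑 1 := hf ▸ ⟨c, rfl⟩
    exact this
  let 𝓒 : G → Submodule ℂ B := fun g =>
    { (𝓑 g).toAddSubmonoid with
      smul_mem' := fun c x hx => by
        have := IsGrading.mul_mem (hmem c) (show x ∈ 𝓑 g from hx)
        rwa [one_mul] at this }
  have hr : restrictGrading ℝ 𝓒 = 𝓑 := rfl
  have : IsGrading (restrictGrading ℝ 𝓒) := ‹_›
  refine exists_hasComplexParameter_restrictGrading (𝓑 := 𝓒) hs (fun u hu => ?_) hq
  obtain ⟨c, hc⟩ : (⟨u.1, u.2⟩ : Center ℝ B) ∈ LinearMap.range f.toLinearMap := hf ▸ hu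
  refine ⟨c, Subtype.ext ?_⟩
  rw [Algebra.algebraMap_eq_smul_one]
  change (u : B) = c • (1 : B)
  rw [hsmul, mul_one]
  exact (congrArg Subtype.val hc).symm

end ComplexParameter

end GradedJordan

theorem corollary5p4 {G B : Type*} [CommGroup G]
    [NonAssocCommRing B] [Module ℝ B] [SMulCommClass ℝ B B] [IsScalarTower ℝ B B]
    [IsCommJordan B] [FiniteDimensional ℝ B]
    (𝓑 : G → Submodule ℝ B) [GradedJordan.IsGrading 𝓑]
    (hsimple : GradedJordan.IsGradedSimple 𝓑)
    (hdeg : GradedJordan.HasDegreeOver (GradedJordan.Center ℝ B) B 2) :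
    (GradedJordan.CenterIdentityReal 𝓑 ∨ GradedJordan.CenterIdentityComplex 𝓑) ∧
    (GradedJordan.CenterIdentityReal 𝓑 →
      (∃ χ : G →* Circle, GradedJordan.CenterIsTwistedLoop 𝓑 χ) ∧
      ∀ χ : G →* Circle, GradedJordan.CenterIsTwistedLoop 𝓑 χ →
        (∃ κ σ, GradedJordan.HasRealParameters 𝓑 χ κ σ) ∧
        ∀ κ σ, GradedJordan.HasRealParameters 𝓑 χ κ σ →
          (GradedJordan.IsGradedDivision 𝓑 ↔
            (∀ q, κ q ≠ 0 → q ∈ GradedJordan.twoTorsion (G ⧸ GradedJordan.centerSupport 𝓑)) ∧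
            (∀ q, |σ q| = κ q) ∧
            σ 1 = -(κ 1 : ℤ))) ∧
    (GradedJordan.CenterIdentityComplex 𝓑 →
      (∃ κ, GradedJordan.HasComplexParameter 𝓑 κ) ∧
      ∀ κ, GradedJordan.HasComplexParameter 𝓑 κ →
        (GradedJordan.IsGradedDivision 𝓑 ↔
          (∀ q, κ q ≠ 0 → q ∈ GradedJordan.twoTorsion (G ⧸ GradedJordan.centerSupport 𝓑)) ∧
          (∀ q ∈ GradedJordan.twoTorsion (G ⧸ GradedJordan.centerSupport 𝓑),
            κ q = 0 ∨ κ q = 1) ∧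
          κ 1 = 0)) := by
  have hq := hdeg.isQuadraticModulo
  have := hsimple.nontrivial
  refine ⟨hsimple.centerIdentity, fun h1 => ⟨?_, fun χ hχ => ⟨?_, fun κ σ h => ?_⟩⟩,
    fun h1 => ⟨?_, fun κ h => ?_⟩⟩
  · exact (hsimple.isGradedCentral h1).exists_twistedLoop
  · exact GradedJordan.exists_hasRealParameters hsimple h1 hq hχ
  · exact h.isGradedDivision_iff
  · exact GradedJordan.exists_hasComplexParameter hsimple h1 hq
  · exact h.isGradedDivision_iff
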